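/- **Setting.** Let $d\in\{2,3\}$, let $\Omega\subset\mathbb R^d$ be a bounded open set (for example a Lipschitz polyhedron), and let $\mu,\epsilon$ be Hermitian matrix fields on $\Omega$ such that $\mu^{-1},\epsilon$ have entries in $L^\infty(\Omega)$ and, for some $\gamma,\beta>0$, $\overline\xi\cdot\mu^{-1}\xi\ge\gamma|\xi|^2$ and $\overline\xi\cdot\epsilon\,\xi\ge\beta|\xi|^2$ for all complex vectors $\xi$, a.e. in $\Omega$ (for $d=2$ the curl is the scalar $\partial_1u_2-\partial_2u_1$ and $\mu$ is scalar). Let $(u,v)=\int_\Omega u\cdot\overline v$. Let $H_0(\mathrm{curl},\Omega)$ and $H^1_0(\Omega)$ be the closures of the smooth compactly supported complex fields, respectively functions, in the graph norm of the curl, respectively in the $H^1$ norm. On $H_0(\mathrm{curl},\Omega)$ put $$a(u,v)=(\mu^{-1}\mathrm{curl}\,u,\mathrm{curl}\,v),\quad A(u,v)=a(u,v)+\tfrac\gamma\beta(\epsilon u,v),\quad \|u\|_a=a(u,u)^{1/2},\ \|u\|_A=A(u,u)^{1/2},\ \|u\|_{0,\epsilon}=(\epsilon u,u)^{1/2},$$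 and let $X=\{u\in H_0(\mathrm{curl},\Omega):(\epsilon u,\nabla p)=0\ \forall p\in H^1_0(\Omega)\}$. Let $\lambda_1\le\lambda_2\le\dots$ be the eigenvalues, repeated according to multiplicity, of: find $\lambda\in\mathbb R$, $0\ne u\in X$ with $a(u,v)=\lambda(\epsilon u,v)$ for all $v\in X$; let $M(\lambda)$ be the span of the eigenfunctions for $\lambda$. Fix $k,q\ge1$ with $0<\lambda_k=\dots=\lambda_{k+q-1}<\lambda_{k+q}$ and, if $k\ge2$, $\lambda_{k-1}<\lambda_k$. Put $\widetilde\lambda=\lambda+\gamma/\beta$ for every number $\lambda$, $\overline C=(\gamma/\beta)^{1/2}$, $C_4(\lambda)=4\widetilde\lambda(1+\lambda\overline C^{-2})$ and $\rho=\min\{|\widetilde\lambda_j^{-1}-\widetilde\lambda_k^{-1}|:\lambda_j\ne\lambda_k\}$, and let $J=\{k-1,k,k+q\}\setminus\{0\}$. Fix an integer $r\ge0$. For a conforming simplicial mesh $\pi_h$ of $\overline\Omega$, let $V_h$ be the space of the $u\in H_0(\mathrm{curl},\Omega)$ that on each cell are of the form $p+x\times q$ with $p$ polynomial of degree at most $r$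 and $q$ homogeneous polynomial of degree $r$ (edge elements of the first family; for $d=2$, $q$ is scalar and $x\times q$ is $q\,(x_2,-x_1)$), let $U_h$ be the space of the $p\in H_0^1(\Omega)$ that on each cell are polynomials of degree at most $r+1$, and let $X_h=\{u\in V_h:(\epsilon u,\nabla p)=0\ \forall p\in U_h\}$. Let $\lambda_{1,h}\le\lambda_{2,h}\le\dots$ be the eigenvalues, repeated according to multiplicity, of $a(u,v)=\lambda_h(\epsilon u,v)$ for all $v\in X_h$, posed in $X_h$. For an eigenvalue $\lambda$ let $M_h(\lambda)$ be the span of the eigenfunctions for all $\lambda_{j,h}$ with $\lambda_j=\lambda$, and $$\delta_h(\lambda)=\sup_{u\in M(\lambda),\,\|u\|_A=1}\ \inf_{v\in V_h}\|u-v\|_A .$$ For a constant $C_3>0$ let $(\mathrm E_h(\lambda))$ be the following property: for every $u_h\in X_h$ with $\|u_h\|_A=1$ that is an eigenfunction for some $\lambda_{j,h}$ with $\lambda_j=\lambda$ there is $u\in M(\lambda)$ with $\|u-u_h\|_A\le C_3\delta_h(\lambda)$, and for every $u\in M(\lambda)$ with $\|u\|_A=1$ there is $u_h\in M_h(\lambda)$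 with $\|u-u_h\|_A\le C_3\delta_h(\lambda)$. **Schemes.** Given meshes $\pi_{h_0},\dots,\pi_{h_l}$, start with $(\lambda^{h_0},u^{h_0},\sigma)\in\mathbb R\times V_{h_0}\times U_{h_0}$, $\|u^{h_0}\|_a=1$, such that $a(u^{h_0},v)+\overline{(\epsilon v,\nabla\sigma)}=\lambda^{h_0}(\epsilon u^{h_0},v)$ for all $v\in V_{h_0}$ and $(\epsilon u^{h_0},\nabla p)=0$ for all $p\in U_{h_0}$; set $\widehat u^{h_0}=u^{h_0}/\|u^{h_0}\|_A$. In step $i=1,\dots,l$ find $u'\in V_{h_i}$ with $$a(u',v)-\lambda^{h_{s(i)}}(\epsilon u',v)=(\epsilon u^{h_{i-1}},v)\quad\forall v\in V_{h_i},$$ and set $u^{h_i}=u'/\|u'\|_a$, $\widehat u^{h_i}=u'/\|u'\|_A$, $\lambda^{h_i}=a(u^{h_i},u^{h_i})/(\epsilon u^{h_i},u^{h_i})$. In Scheme 3.1 (Rayleigh quotient iteration) $s(i)=i-1$; in Scheme 3.2 (fixed shift, parameter $i_0\ge0$) $s(i)=\min(i-1,i_0)$. **Thresholds.** Let $\delta_0,\delta_0'>0$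 satisfy $\delta_0\le\min\{\overline C(4\sqrt{\widetilde\lambda_k})^{-1},\frac12\}$, $\delta_0'\le\frac{\lambda_k}2$, $\frac{\delta_0'}{(\widetilde\lambda_k-\delta_0')\widetilde\lambda_k}\le\frac\rho4$; for all $j\in J$, $C_4(\lambda_j)C_3\delta_0^2<\widetilde\lambda_j$ and $\frac{C_4(\lambda_j)C_3^2\delta_0^2}{(\widetilde\lambda_j-C_4(\lambda_j)C_3\delta_0^2)\widetilde\lambda_j}\le\frac\rho4$; and $(3+C_3)\delta_0+3\overline C^{-2}C_4(\lambda_k)\delta_0^2+\overline C^{-2}(3\lambda_k+2\overline C^2)\delta_0\le\frac12$. **Theorem.** There is a constant $C_0>0$, depending only on the data above ($\Omega,\mu,\epsilon,\gamma,\beta,r,k,q,C_3,\delta_0,\delta_0'$) and not on the meshes, on $l$, or on the scheme, with the following property. Let $l\ge1$, let $(\lambda_k^{h_i},u_k^{h_i},\widehat u_k^{h_i})$, $0\le i\le l$, be produced by Scheme 3.1 or Scheme 3.2 on some meshes $\pi_{h_0},\dots,\pi_{h_l}$, and let $\lambda_0=\lambda_k^{h_{s(l)}}$ be the shift used in step $l$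 (so $\lambda_0=\lambda_k^{h_{l-1}}$ for Scheme 3.1, and $\lambda_0=\lambda_k^{h_{i_0}}$ for Scheme 3.2 with $l>i_0$). Assume that $(\mathrm E_{h_l}(\lambda_j))$ holds for all $j\in J$, and that $\overline u_k\in M(\lambda_k)$ is such that $$\|\widehat u_k^{h_{l-1}}-\overline u_k\|_A\le\delta_0,\qquad \delta_{h_l}(\lambda_j)\le\delta_0\ (j\in J),\qquad |\lambda_k^{h_{l-1}}-\lambda_k|\le\delta_0',\qquad |\lambda_0-\lambda_k|\le\delta_0'.$$ Then there is $u_k\in M(\lambda_k)$ with $$\|\widehat u_k^{h_l}-u_k\|_A\le\frac{C_0}2\Big(|\lambda_0-\lambda_k|\big(|\lambda_k^{h_{l-1}}-\lambda_k|+\|\widehat u_k^{h_{l-1}}-\overline u_k\|_{0,\epsilon}\big)+\delta_{h_l}(\lambda_k)\Big).$$ -/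

import Mathlib

open MeasureTheory
open scoped ContDiff ENNReal

noncomputable section

namespace Maxwell

/-- Points of `ℝ^d`. -/
abbrev Pt (d : ℕ) : Type := EuclideanSpace ℝ (Fin d)

/-- Values of `ℂ^n`-valued fields. -/
abbrev CVec (n : ℕ) : Type := EuclideanSpace ℂ (Fin n)

/-- The space `L²(Ω)^n` of complex vector fields. -/
abbrev VecL2 {d : ℕ} (Ω : Set (Pt d)) (n : ℕ) : Type :=
  Lp (CVec n) 2 (volume.restrict Ω)

/-- The coefficients of the curl: `(curl u)_i = ∑ j k, e_{ijk} ∂_j u_k`. In dimension two there is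
one component, `∂_0 u_1 - ∂_1 u_0`; in dimension three `e` is the Levi-Civita symbol.
The number of components of the curl is `d.choose 2`, that is `1` for `d = 2`, `3` for `d = 3`. -/
def curlTensor (d : ℕ) (i : Fin (d.choose 2)) (j k : Fin d) : ℝ :=
  if d = 2 then (k : ℝ) - (j : ℝ)
  else if d = 3 then ((j : ℝ) - (i : ℝ)) * ((k : ℝ) - (i : ℝ)) * ((k : ℝ) - (j : ℝ)) / 2
  else 0

/-- The classical curl of a differentiable field. -/
def curlField {d : ℕ} (φ : Pt d → CVec d) (x : Pt d) : CVec (d.choose 2) :=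
  WithLp.toLp 2 fun i => ∑ j, ∑ k,
    (curlTensor d i j k : ℂ) * (fderiv ℝ φ x (EuclideanSpace.single j 1)) k

/-- The classical gradient of a differentiable complex function. -/
def gradField {d : ℕ} (φ : Pt d → ℂ) (x : Pt d) : CVec d :=
  WithLp.toLp 2 fun j => fderiv ℝ φ x (EuclideanSpace.single j 1)

/-- Smooth functions with compact support in `Ω`. -/
def IsTest {d : ℕ} (Ω : Set (Pt d)) {F : Type} [NormedAddCommGroup F] [NormedSpace ℝ F]
    (φ : Pt d → F) : Prop :=
  ContDiff ℝ ∞ φ ∧ HasCompactSupport φ ∧ tsupport φ ⊆ Ω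

/-- Pairs of square integrable fields. A field `u` with square integrable curl is represented by
the pair `(u, curl u)`. -/
abbrev Field {d : ℕ} (Ω : Set (Pt d)) : Type := VecL2 Ω d × VecL2 Ω (d.choose 2)

/-- `H₀(curl, Ω)`, the closure of the smooth compactly supported fields in the graph norm of the
curl. Its elements are the pairs `f = (u, curl u)`. -/
def H0curl {d : ℕ} (Ω : Set (Pt d)) : Submodule ℂ (Field Ω) :=
  (Submodule.span ℂ {f : Field Ω | ∃ φ : Pt d → CVec d, IsTest Ω φ ∧
    f.1 =ᵐ[volume.restrict Ω] φ ∧ f.2 =ᵐ[volume.restrict Ω] curlField φ}).topologicalClosure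

/-- `H¹₀(Ω)`, the closure of the smooth compactly supported functions in the `H¹` norm. Its
elements are the pairs `(p, ∇p)`. -/
def H10 {d : ℕ} (Ω : Set (Pt d)) :
    Submodule ℂ (Lp ℂ 2 (volume.restrict Ω) × VecL2 Ω d) :=
  (Submodule.span ℂ {p : Lp ℂ 2 (volume.restrict Ω) × VecL2 Ω d |
    ∃ φ : Pt d → ℂ, IsTest Ω φ ∧
      p.1 =ᵐ[volume.restrict Ω] φ ∧ p.2 =ᵐ[volume.restrict Ω] gradField φ}).topologicalClosure

/-- The data of the Maxwell eigenvalue problem: a bounded open set, the two coefficient matrices,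
Hermitian almost everywhere, and the two ellipticity constants. The lower bounds make both
matrices positive definite (the inverse of a singular matrix is `0` here and violates its bound).
In dimension two the curl is a scalar and `μ` is a `1 × 1` matrix. -/
structure Problem (d : ℕ) where
  Ω : Set (Pt d)
  isOpen : IsOpen Ω
  isBounded : Bornology.IsBounded Ω
  μ : Pt d → Matrix (Fin (d.choose 2)) (Fin (d.choose 2)) ℂ
  ε : Pt d → Matrix (Fin d) (Fin d) ℂ
  γ : ℝ
  β : ℝ
  γ_pos : 0 < γ
  β_pos : 0 < β
  μ_hermitian : ∀ᵐ x ∂(volume.restrict Ω), (μ x).IsHermitian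
  ε_hermitian : ∀ᵐ x ∂(volume.restrict Ω), (ε x).IsHermitian
  μ_inv_bounded : ∀ i j, MemLp (fun x => (μ x)⁻¹ i j) ∞ (volume.restrict Ω)
  ε_bounded : ∀ i j, MemLp (fun x => ε x i j) ∞ (volume.restrict Ω)
  μ_inv_lower : ∀ᵐ x ∂(volume.restrict Ω), ∀ ξ : Fin (d.choose 2) → ℂ,
    γ * ∑ i, ‖ξ i‖ ^ 2 ≤ (dotProduct (star ξ) ((μ x)⁻¹.mulVec ξ)).re
  ε_lower : ∀ᵐ x ∂(volume.restrict Ω), ∀ ξ : Fin d → ℂ,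
    β * ∑ i, ‖ξ i‖ ^ 2 ≤ (dotProduct (star ξ) ((ε x).mulVec ξ)).re

namespace Problem

variable {d : ℕ} (P : Problem d)

/-- `(ε u, v)`. -/
def epsForm (u v : VecL2 P.Ω d) : ℂ :=
  ∫ x in P.Ω, ∑ i, ∑ j, P.ε x i j * u x j * star (v x i)

/-- `a(f, g) = (μ⁻¹ curl f, curl g)`. -/
def aForm (f g : Field P.Ω) : ℂ :=
  ∫ x in P.Ω, ∑ i, ∑ j, (P.μ x)⁻¹ i j * f.2 x j * star (g.2 x i)

/-- The ratio `γ / β`. -/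
def shiftConst : ℝ := P.γ / P.β

/-- `A(f, g) = a(f, g) + (γ / β) (ε f, g)`. -/
def AForm (f g : Field P.Ω) : ℂ :=
  P.aForm f g + (P.shiftConst : ℂ) * P.epsForm f.1 g.1

/-- `‖f‖_a`. -/
def normSmallA (f : Field P.Ω) : ℝ := Real.sqrt (P.aForm f f).re

/-- `‖f‖_A`. -/
def normA (f : Field P.Ω) : ℝ := Real.sqrt (P.AForm f f).re

/-- `‖f‖_{0,ε}`. -/
def normEps (f : Field P.Ω) : ℝ := Real.sqrt (P.epsForm f.1 f.1).re

/-- The Rayleigh quotient `a(f, f) / (ε f, f)`. -/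
def rayleigh (f : Field P.Ω) : ℝ := (P.aForm f f).re / (P.epsForm f.1 f.1).re

/-- The space of the `f` in `H₀(curl, Ω)` with `div (ε f) = 0`. -/
def X : Set (Field P.Ω) :=
  {f | f ∈ H0curl P.Ω ∧ ∀ p ∈ H10 P.Ω, P.epsForm f.1 p.2 = 0}

/-- `f` is an eigenfunction with eigenvalue `lam` of the variational eigenvalue problem
`a(f, v) = lam (ε f, v)` for all `v ∈ W`, posed in `W`. -/
def IsEigenfunction (W : Set (Field P.Ω)) (lam : ℝ) (f : Field P.Ω) : Prop :=
  f ∈ W ∧ f ≠ 0 ∧ ∀ v ∈ W, P.aForm f v = (lam : ℂ) * P.epsForm f.1 v.1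

/-- `lam` is the `j`-th eigenvalue (`j = 1, 2, …`) of the eigenvalue problem posed in `W`, the
eigenvalues being arranged in increasing order and repeated according to multiplicity: fewer than
`j` eigenvalues are smaller than `lam`, and at least `j` do not exceed it. -/
def IsNthEigenvalue (W : Set (Field P.Ω)) (j : ℕ) (lam : ℝ) : Prop :=
  Module.rank ℂ (Submodule.span ℂ {f | ∃ s < lam, P.IsEigenfunction W s f}) < (j : Cardinal) ∧
  (j : Cardinal) ≤ Module.rank ℂ (Submodule.span ℂ {f | ∃ s ≤ lam, P.IsEigenfunction W s f})

/-- `M(lam)`, the space spanned by the eigenfunctions of the Maxwell problem for `lam`. -/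
def M (lam : ℝ) : Submodule ℂ (Field P.Ω) :=
  Submodule.span ℂ {f | P.IsEigenfunction P.X lam f}

end Problem

/-- A conforming simplicial mesh of `Ω`: a finite set of nondegenerate closed simplices, given by
their vertex sets, any two of which meet in a common face, and whose union is `closure Ω`. -/
structure Mesh {d : ℕ} (Ω : Set (Pt d)) where
  cells : Finset (Finset (Pt d))
  card_eq : ∀ κ ∈ cells, κ.card = d + 1
  indep : ∀ κ ∈ cells, AffineIndependent ℝ (fun v : κ => (v : Pt d))
  inter : ∀ κ ∈ cells, ∀ κ₁ ∈ cells,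
    convexHull ℝ (κ : Set (Pt d)) ∩ convexHull ℝ (κ₁ : Set (Pt d)) =
      convexHull ℝ ((κ : Set (Pt d)) ∩ (κ₁ : Set (Pt d)))
  union : ⋃ κ ∈ cells, convexHull ℝ (κ : Set (Pt d)) = closure Ω

/-- The value of a complex polynomial at a point of `ℝ^d`. -/
def polyAt {d : ℕ} (p : MvPolynomial (Fin d) ℂ) (x : Pt d) : ℂ :=
  MvPolynomial.eval (fun i => (x i : ℂ)) p

/-- The local space `[P_r]^d ⊕ x × [P̃_r]^d` of the edge element of the first family of order `r`.
For `d = 3` the second summand consists of the products `x × q` with `q` homogeneous of degree `r`;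
for `d = 2` it consists of the fields `q (x_1, -x_0)`. -/
def IsEdgePoly {d : ℕ} (r : ℕ) (F : Pt d → CVec d) : Prop :=
  ∃ (p : Fin d → MvPolynomial (Fin d) ℂ) (q : Fin (d.choose 2) → MvPolynomial (Fin d) ℂ),
    (∀ k, (p k).totalDegree ≤ r) ∧ (∀ i, (q i).IsHomogeneous r) ∧
    ∀ x k, F x k = polyAt (p k) x +
      ∑ i, ∑ j, (curlTensor d i j k : ℂ) * (x j : ℂ) * polyAt (q i) x

namespace Problem

variable {d : ℕ} (P : Problem d)

/-- The edge element space `V_h` of order `r`. -/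
def V (r : ℕ) (T : Mesh P.Ω) : Set (Field P.Ω) :=
  {f | f ∈ H0curl P.Ω ∧ ∀ κ ∈ T.cells, ∃ F : Pt d → CVec d, IsEdgePoly r F ∧
    f.1 =ᵐ[volume.restrict (P.Ω ∩ convexHull ℝ (κ : Set (Pt d)))] F}

/-- The Lagrange space `U_h` of degree `r + 1` with vanishing boundary values. -/
def U (r : ℕ) (T : Mesh P.Ω) : Set (Lp ℂ 2 (volume.restrict P.Ω) × VecL2 P.Ω d) :=
  {p | p ∈ H10 P.Ω ∧ ∀ κ ∈ T.cells, ∃ s : MvPolynomial (Fin d) ℂ, s.totalDegree ≤ r + 1 ∧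
    p.1 =ᵐ[volume.restrict (P.Ω ∩ convexHull ℝ (κ : Set (Pt d)))] polyAt s}

/-- The discretely divergence-free space `X_h`. -/
def Xh (r : ℕ) (T : Mesh P.Ω) : Set (Field P.Ω) :=
  {f | f ∈ P.V r T ∧ ∀ p ∈ P.U r T, P.epsForm f.1 p.2 = 0}

/-- `lamh` is one of the discrete eigenvalues belonging to the exact eigenvalue `lam`: for some
`j`, `lam` is the `j`-th exact eigenvalue and `lamh` is the `j`-th discrete one. -/
def Belongs (r : ℕ) (T : Mesh P.Ω) (lam lamh : ℝ) : Prop :=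
  ∃ j : ℕ, P.IsNthEigenvalue P.X j lam ∧ P.IsNthEigenvalue (P.Xh r T) j lamh

/-- `M_h(lam)`, the sum of the discrete eigenspaces belonging to `lam`. -/
def Mh (r : ℕ) (T : Mesh P.Ω) (lam : ℝ) : Submodule ℂ (Field P.Ω) :=
  Submodule.span ℂ
    {f | ∃ lamh, P.Belongs r T lam lamh ∧ P.IsEigenfunction (P.Xh r T) lamh f}

/-- `δ_h(lam) = sup_{u ∈ M(lam), ‖u‖_A = 1} inf_{v ∈ V_h} ‖u - v‖_A`. -/
def delta (r : ℕ) (T : Mesh P.Ω) (lam : ℝ) : ℝ :=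
  sSup {t | ∃ f ∈ P.M lam, P.normA f = 1 ∧ t = sInf {s | ∃ v ∈ P.V r T, s = P.normA (f - v)}}

/-- The a priori estimates for the eigenfunctions belonging to `lam` hold on the mesh `T` with the
constant `C3`. -/
def EigenEstimates (r : ℕ) (T : Mesh P.Ω) (C3 lam : ℝ) : Prop :=
  (∀ lamh f, P.Belongs r T lam lamh → P.IsEigenfunction (P.Xh r T) lamh f → P.normA f = 1 →
    ∃ g ∈ P.M lam, P.normA (g - f) ≤ C3 * P.delta r T lam) ∧
  (∀ g ∈ P.M lam, P.normA g = 1 →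
    ∃ f ∈ P.Mh r T lam, P.normA (g - f) ≤ C3 * P.delta r T lam)

/-- `lam + γ / β`. -/
def tl (lam : ℝ) : ℝ := lam + P.shiftConst

/-- `C̄ = (γ / β)^{1/2}`. -/
def Cbar : ℝ := Real.sqrt P.shiftConst

/-- `C₄ = 4 (lam + γ / β) (1 + lam C̄⁻²)`. -/
def C4 (lam : ℝ) : ℝ := 4 * P.tl lam * (1 + lam * (P.Cbar ^ 2)⁻¹)

/-- The distance `ρ` of `ν = (lam + γ / β)⁻¹` from the reciprocals `(s + γ / β)⁻¹` belonging to the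
other eigenvalues `s` of the Maxwell problem. -/
def rho (lam : ℝ) : ℝ :=
  sInf {t | ∃ s, s ≠ lam ∧ (∃ f, P.IsEigenfunction P.X s f) ∧
    t = |(P.tl s)⁻¹ - (P.tl lam)⁻¹|}

/-- The requirements on the thresholds `δ₀ = dl0` and `δ₀′ = dl1`. -/
structure Thresholds (k q : ℕ) (lam : ℕ → ℝ) (C3 dl0 dl1 : ℝ) : Prop where
  dl0_pos : 0 < dl0
  dl1_pos : 0 < dl1
  dl0_le : dl0 ≤ min (P.Cbar * (4 * Real.sqrt (P.tl (lam k)))⁻¹) (1 / 2)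
  dl1_le : dl1 ≤ lam k / 2
  dl1_gap : dl1 / ((P.tl (lam k) - dl1) * P.tl (lam k)) ≤ P.rho (lam k) / 4
  dl0_lt : ∀ j ∈ ({k - 1, k, k + q} : Set ℕ), j ≠ 0 →
    P.C4 (lam j) * C3 * dl0 ^ 2 < P.tl (lam j)
  dl0_gap : ∀ j ∈ ({k - 1, k, k + q} : Set ℕ), j ≠ 0 →
    P.C4 (lam j) * C3 ^ 2 * dl0 ^ 2 /
      ((P.tl (lam j) - P.C4 (lam j) * C3 * dl0 ^ 2) * P.tl (lam j)) ≤ P.rho (lam k) / 4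
  dl0_sum : (3 + C3) * dl0 + 3 * (P.Cbar ^ 2)⁻¹ * P.C4 (lam k) * dl0 ^ 2 +
    (P.Cbar ^ 2)⁻¹ * (3 * lam k + 2 * P.Cbar ^ 2) * dl0 ≤ 1 / 2

end Problem

/-- The two multigrid schemes: Rayleigh quotient iteration, and inverse iteration whose shift is
kept fixed from the iterate number `i0` on. -/
inductive Scheme where
  | rayleighQuotient : Scheme
  | fixedShift (i0 : ℕ) : Scheme

/-- The number of the iterate whose approximate eigenvalue is the shift in step `i`. -/
def Scheme.shift : Scheme → ℕ → ℕ
  | .rayleighQuotient, i => i - 1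
  | .fixedShift i0, i => min (i - 1) i0

/-- `lamh`, `u`, `uhat` are the approximate eigenvalues, and the approximate eigenfunctions
normalized in `‖·‖_a` and in `‖·‖_A`, produced by `l` steps of the scheme `S` on the meshes
`T 0, …, T l`. -/
structure IsRun {d : ℕ} (P : Problem d) (r : ℕ) (T : ℕ → Mesh P.Ω) (S : Scheme) (l : ℕ)
    (lamh : ℕ → ℝ) (u uhat : ℕ → Field P.Ω) : Prop where
  init_mem : u 0 ∈ P.V r (T 0)
  init_norm : P.normSmallA (u 0) = 1
  init_eq : ∃ σ ∈ P.U r (T 0), ∀ v ∈ P.V r (T 0),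
    P.aForm (u 0) v + star (P.epsForm v.1 σ.2) = (lamh 0 : ℂ) * P.epsForm (u 0).1 v.1
  init_div : ∀ p ∈ P.U r (T 0), P.epsForm (u 0).1 p.2 = 0
  init_hat : uhat 0 = (P.normA (u 0) : ℂ)⁻¹ • u 0
  step : ∀ i, 1 ≤ i → i ≤ l → ∃ w ∈ P.V r (T i),
    (∀ v ∈ P.V r (T i), P.aForm w v - (lamh (S.shift i) : ℂ) * P.epsForm w.1 v.1 =
      P.epsForm (u (i - 1)).1 v.1) ∧
    u i = (P.normSmallA w : ℂ)⁻¹ • w ∧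
    uhat i = (P.normA w : ℂ)⁻¹ • w ∧
    lamh i = P.rayleigh (u i)

/-- The closeness condition at step `l`, with `ubar ∈ M(lam_k)` and with the bound on the
approximate eigenvalue for the iterate number `i`. -/
structure IsClose {d : ℕ} (P : Problem d) (r k q : ℕ) (lam : ℕ → ℝ) (dl0 dl1 : ℝ)
    (T : ℕ → Mesh P.Ω) (l i : ℕ) (lamh : ℕ → ℝ) (uhat : ℕ → Field P.Ω)
    (ubar : Field P.Ω) : Prop where
  mem : ubar ∈ P.M (lam k)
  close : P.normA (uhat (l - 1) - ubar) ≤ dl0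
  delta_le : ∀ j ∈ ({k - 1, k, k + q} : Set ℕ), j ≠ 0 → P.delta r (T l) (lam j) ≤ dl0
  eig_le : |lamh i - lam k| ≤ dl1

end Maxwell

end

/-! The whole estimate comes from a single step on the last mesh. The space `V_h` has an
ε-orthonormal basis that diagonalizes `a`, made of discrete eigenfunctions in `X_h` and of discrete
gradients, on which `a` vanishes (`exists_discrete_eigenbasis`). In this basis the step equation
decouples into (s_i - λ₀) w_i = (ε u, b_i). Call cluster the basis functions in `X_h` whose
eigenvalue belongs to λ_k. Off the cluster, |s_i - λ₀| ≥ κ (s_i + γ/β), so that part of w is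
controlled in the A-norm by the ε-distance of u from the cluster space. On the cluster, |s_i - λ₀| ≤
θ with θ = |λ₀ - λ_k| + O(δ), so w is at least of order 1/θ times the size of u
(`inverse_iteration`).

Dividing the two bounds, the off-cluster part of w is O(θ (‖û - ū‖ + δ)) relative to ‖w‖_A, where û
is the normalized previous iterate and ū the exact eigenfunction near it. Expanding the product,
every term except |λ₀ - λ_k| ‖û - ū‖ carries a factor δ. The cluster part of w lies within O(δ)
‖w‖_A of M(λ_k) by the a priori estimates (`EigenEstimates.exists_near_sum`). The two parts are
joined in `exists_near_solution`, and normalization gives the theorem.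

The separation of the shift from the rest of the spectrum is measured in the reciprocals of shifted
eigenvalues. A unit discrete eigenfunction within η of M(λ) has a reciprocal within η² β/γ of the
exact one (`abs_inv_tl_sub_le`). The thresholds make this at most ρ/16 for the indices k - 1, k, k +
q, and keep the reciprocal of the shift within ρ/4. Since discrete eigenvalues are ordered,
controlling the two neighbours of the cluster controls all others (`belongs_or_separated`).
Gradients have eigenvalue 0, while the shift is at least λ_k/2.

Discrete fields are only discretely divergence free, so exact eigenfunctions must be tested against
all of H₀(curl). The Helmholtz splitting permits this (`exists_helmholtz`, `aSesq_of_mem_M`). -/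

noncomputable section

namespace Maxwell

/-! ### Seminorms of nonnegative Hermitian forms -/

section Forms

variable {F : Type*} [AddCommGroup F] [Module ℂ F]

/-- A sesquilinear form, linear in the first argument, that is Hermitian and nonnegative. -/
structure IsHermPos (B : F →ₗ[ℂ] F →ₗ⋆[ℂ] ℂ) : Prop where
  herm : ∀ x y, star (B x y) = B y x
  nonneg : ∀ x, 0 ≤ (B x x).re

/-- The seminorm of a nonnegative Hermitian form. -/
def formNorm (B : F →ₗ[ℂ] F →ₗ⋆[ℂ] ℂ) (x : F) : ℝ := Real.sqrt (B x x).re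

variable {B : F →ₗ[ℂ] F →ₗ⋆[ℂ] ℂ}

lemma formNorm_nonneg (x : F) : 0 ≤ formNorm B x := Real.sqrt_nonneg _

lemma IsHermPos.sq (hB : IsHermPos B) (x : F) : formNorm B x ^ 2 = (B x x).re :=
  Real.sq_sqrt (hB.nonneg x)

lemma IsHermPos.re_comm (hB : IsHermPos B) (x y : F) : (B x y).re = (B y x).re := by
  rw [← hB.herm x y, Complex.star_def, Complex.conj_re]

lemma IsHermPos.norm_comm (hB : IsHermPos B) (x y : F) : ‖B x y‖ = ‖B y x‖ := by
  rw [← hB.herm x y, norm_star]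

lemma IsHermPos.norm_apply_le (hB : IsHermPos B) (x y : F) :
    ‖B x y‖ ≤ formNorm B x * formNorm B y := by
  -- The arguments are swapped because `inner` is conjugate-linear in its first slot. A pre-inner
  -- product suffices, so forms with a kernel, such as `a`, are covered.
  let c : PreInnerProductSpace.Core ℂ F :=
    { inner := fun x y => B y x
      conj_inner_symm := fun x y => hB.herm x y
      re_inner_nonneg := fun x => hB.nonneg x
      add_left := fun x y z => by simp
      smul_left := fun x y r => by simp }
  have h := InnerProductSpace.Core.inner_mul_inner_self_le (𝕜 := ℂ) (c := c) x y
  have h' : ‖B y x‖ * ‖B x y‖ ≤ (B x x).re * (B y y).re := h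
  rw [hB.norm_comm y x, ← hB.sq, ← hB.sq] at h'
  have := formNorm_nonneg (B := B) x
  have := formNorm_nonneg (B := B) y
  nlinarith [abs_le_of_sq_le_sq' (a := ‖B x y‖) (b := formNorm B x * formNorm B y)
    (by nlinarith) (by positivity)]

lemma IsHermPos.add_le (hB : IsHermPos B) (x y : F) :
    formNorm B (x + y) ≤ formNorm B x + formNorm B y := by
  have h1 := hB.sq (x + y)
  have h2 := (Complex.re_le_norm _).trans (hB.norm_apply_le x y)
  have h3 := hB.re_comm x y
  simp only [map_add, LinearMap.add_apply, Complex.add_re] at h1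
  rw [← hB.sq, ← hB.sq] at h1
  exact le_of_sq_le_sq (by nlinarith)
    (add_nonneg (formNorm_nonneg _) (formNorm_nonneg _))
where le_of_sq_le_sq {a b : ℝ} (h : a ^ 2 ≤ b ^ 2) (hb : 0 ≤ b) : a ≤ b :=
  (abs_le_of_sq_le_sq' h hb).2

lemma formNorm_smul (r : ℂ) (x : F) : formNorm B (r • x) = ‖r‖ * formNorm B x := by
  have : (B (r • x) (r • x)) = ((‖r‖ ^ 2 : ℝ) : ℂ) * B x x := by
    simp only [map_smul, LinearMap.smul_apply, map_smulₛₗ, smul_eq_mul, ← mul_assoc]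
    rw [mul_comm ((starRingEnd ℂ) r), Complex.mul_conj, Complex.normSq_eq_norm_sq]
  rw [formNorm, this, Complex.re_ofReal_mul, Real.sqrt_mul (by positivity),
    Real.sqrt_sq (norm_nonneg _), formNorm]

@[simp] lemma formNorm_zero : formNorm B 0 = 0 := by simp [formNorm]

lemma formNorm_neg (x : F) : formNorm B (-x) = formNorm B x := by simp [formNorm]

lemma formNorm_sub_comm (x y : F) : formNorm B (x - y) = formNorm B (y - x) := by
  rw [← formNorm_neg, neg_sub]

lemma IsHermPos.le_sub_add (hB : IsHermPos B) (x y : F) :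
    formNorm B x ≤ formNorm B (x - y) + formNorm B y := by
  simpa using hB.add_le (x - y) y

lemma IsHermPos.sum_le (hB : IsHermPos B) {ι : Type*} (s : Finset ι) (x : ι → F) :
    formNorm B (∑ i ∈ s, x i) ≤ ∑ i ∈ s, formNorm B (x i) :=
  Finset.le_sum_of_subadditive _ formNorm_zero.le hB.add_le s x

end Forms

/-! ### Forms with bounded matrix coefficients, and projections for coercive forms -/

section CoefficientForm

variable {α : Type*} [MeasurableSpace α] {ν : Measure α} {n : ℕ}
  {m : α → Matrix (Fin n) (Fin n) ℂ}

lemma memLp_component (u : Lp (CVec n) 2 ν) (j : Fin n) : MemLp (fun x => u x j) 2 ν :=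
  (EuclideanSpace.proj (𝕜 := ℂ) j).comp_memLp' (Lp.memLp u)

lemma integrable_coefficient_term (hm : ∀ i j, MemLp (fun x => m x i j) ∞ ν)
    (u v : Lp (CVec n) 2 ν) (i j : Fin n) :
    Integrable (fun x => m x i j * u x j * star (v x i)) ν := by
  have h1 : MemLp (fun x => m x i j * u x j) 2 ν := (memLp_component u j).mul' (hm i j)
  exact h1.integrable_mul (memLp_component v i).star

/-- The sesquilinear form `∫ m u · v̄`. -/
def coefficientForm (hm : ∀ i j, MemLp (fun x => m x i j) ∞ ν) :
    Lp (CVec n) 2 ν →ₗ[ℂ] Lp (CVec n) 2 ν →ₗ⋆[ℂ] ℂ :=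
  LinearMap.mk₂'ₛₗ (RingHom.id ℂ) (starRingEnd ℂ)
    (fun u v => ∫ x, ∑ i, ∑ j, m x i j * u x j * star (v x i) ∂ν)
    (fun u u' v => by
      rw [← integral_add
        (integrable_finsetSum _ fun i _ => integrable_finsetSum _ fun j _ =>
          integrable_coefficient_term hm u v i j)
        (integrable_finsetSum _ fun i _ => integrable_finsetSum _ fun j _ =>
          integrable_coefficient_term hm u' v i j)]
      refine integral_congr_ae ?_
      filter_upwards [Lp.coeFn_add u u'] with x hx
      simp only [hx, Pi.add_apply, PiLp.add_apply, mul_add, add_mul, Finset.sum_add_distrib])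
    (fun r u v => by
      rw [RingHom.id_apply, smul_eq_mul, ← integral_const_mul]
      refine integral_congr_ae ?_
      filter_upwards [Lp.coeFn_smul r u] with x hx
      simp only [hx, Pi.smul_apply, PiLp.smul_apply, smul_eq_mul, Finset.mul_sum]
      exact Finset.sum_congr rfl fun i _ => Finset.sum_congr rfl fun j _ => by ring)
    (fun u v v' => by
      rw [← integral_add
        (integrable_finsetSum _ fun i _ => integrable_finsetSum _ fun j _ =>
          integrable_coefficient_term hm u v i j)
        (integrable_finsetSum _ fun i _ => integrable_finsetSum _ fun j _ =>
          integrable_coefficient_term hm u v' i j)]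
      refine integral_congr_ae ?_
      filter_upwards [Lp.coeFn_add v v'] with x hx
      simp only [hx, Pi.add_apply, PiLp.add_apply, star_add, mul_add, Finset.sum_add_distrib])
    (fun r u v => by
      rw [smul_eq_mul, ← integral_const_mul]
      refine integral_congr_ae ?_
      filter_upwards [Lp.coeFn_smul r v] with x hx
      simp only [hx, Pi.smul_apply, PiLp.smul_apply, smul_eq_mul, Finset.mul_sum, star_mul',
        starRingEnd_apply]
      exact Finset.sum_congr rfl fun i _ => Finset.sum_congr rfl fun j _ => by ring)

lemma coefficientForm_apply (hm : ∀ i j, MemLp (fun x => m x i j) ∞ ν) (u v : Lp (CVec n) 2 ν) :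
    coefficientForm hm u v = ∫ x, ∑ i, ∑ j, m x i j * u x j * star (v x i) ∂ν := rfl

lemma norm_sq_eq_integral (u : Lp (CVec n) 2 ν) : ‖u‖ ^ 2 = ∫ x, ‖u x‖ ^ 2 ∂ν := by
  have h := L2.inner_def (𝕜 := ℂ) u u
  rw [inner_self_eq_norm_sq_to_K] at h
  simp only [inner_self_eq_norm_sq_to_K] at h
  have h2 : ((‖u‖ ^ 2 : ℝ) : ℂ) = ((∫ x, ‖u x‖ ^ 2 ∂ν : ℝ) : ℂ) := by
    rw [← integral_complex_ofReal]
    simpa using h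
  exact_mod_cast h2

lemma integrable_norm_sq (u : Lp (CVec n) 2 ν) : Integrable (fun x => ‖u x‖ ^ 2) ν :=
  (Lp.memLp u).integrable_norm_pow (by norm_num)

lemma sum_sum_eq_dotProduct (A : Matrix (Fin n) (Fin n) ℂ) (ξ η : CVec n) :
    ∑ i, ∑ j, A i j * ξ j * star (η i) = dotProduct (star (η : Fin n → ℂ)) (A.mulVec ξ) := by
  simp only [dotProduct, Matrix.mulVec, Finset.mul_sum, Pi.star_apply]
  exact Finset.sum_congr rfl fun i _ => Finset.sum_congr rfl fun j _ => by ring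

lemma coefficientForm_lower (hm : ∀ i j, MemLp (fun x => m x i j) ∞ ν) {c : ℝ}
    (hc : ∀ᵐ x ∂ν, ∀ ξ : Fin n → ℂ,
      c * ∑ i, ‖ξ i‖ ^ 2 ≤ (dotProduct (star ξ) ((m x).mulVec ξ)).re) (u : Lp (CVec n) 2 ν) :
    c * ‖u‖ ^ 2 ≤ (coefficientForm hm u u).re := by
  have hint : Integrable (fun x => ∑ i, ∑ j, m x i j * u x j * star (u x i)) ν :=
    integrable_finsetSum _ fun i _ => integrable_finsetSum _ fun j _ =>
      integrable_coefficient_term hm u u i j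
  have hre : (coefficientForm hm u u).re =
      ∫ x, (∑ i, ∑ j, m x i j * u x j * star (u x i)).re ∂ν :=
    (integral_re hint).symm
  rw [hre, norm_sq_eq_integral, ← integral_const_mul]
  refine integral_mono_ae ((integrable_norm_sq u).const_mul c) hint.re ?_
  filter_upwards [hc] with x hx
  have := hx (u x)
  rw [sum_sum_eq_dotProduct, EuclideanSpace.norm_sq_eq]
  exact this

lemma coefficientForm_isHermPos (hm : ∀ i j, MemLp (fun x => m x i j) ∞ ν)
    (hh : ∀ᵐ x ∂ν, (m x).IsHermitian) {c : ℝ} (hc0 : 0 ≤ c)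
    (hc : ∀ᵐ x ∂ν, ∀ ξ : Fin n → ℂ,
      c * ∑ i, ‖ξ i‖ ^ 2 ≤ (dotProduct (star ξ) ((m x).mulVec ξ)).re) :
    IsHermPos (coefficientForm hm) where
  nonneg u := (by positivity : 0 ≤ c * ‖u‖ ^ 2).trans (coefficientForm_lower hm hc u)
  herm u v := by
    rw [coefficientForm_apply, coefficientForm_apply, Complex.star_def, ← integral_conj]
    refine integral_congr_ae ?_
    filter_upwards [hh] with x hx
    simp only [map_sum, map_mul, starRingEnd_apply, star_star]
    rw [Finset.sum_comm]
    refine Finset.sum_congr rfl fun i _ => Finset.sum_congr rfl fun j _ => ?_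
    rw [hx.apply]
    ring

/-- Serves to make the ε-form continuous on L², as the projection onto the closure of the gradients
requires. -/
lemma coefficientForm_self_le (hm : ∀ i j, MemLp (fun x => m x i j) ∞ ν) :
    ∃ K : ℝ, 0 ≤ K ∧ ∀ u : Lp (CVec n) 2 ν, (coefficientForm hm u u).re ≤ K * ‖u‖ ^ 2 := by
  have hb : ∀ i j, ∃ K : ℝ, 0 ≤ K ∧ ∀ᵐ x ∂ν, ‖m x i j‖ ≤ K := fun i j => by
    refine ⟨(eLpNorm (fun x => m x i j) ∞ ν).toReal, ENNReal.toReal_nonneg, ?_⟩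
    have h2 : eLpNorm (fun x => m x i j) ∞ ν ≠ ⊤ := (hm i j).2.ne
    rw [eLpNorm_exponent_top] at h2 ⊢
    filter_upwards [ae_le_eLpNormEssSup (f := fun x => m x i j) (μ := ν)] with x hx
    rw [← toReal_enorm]
    exact ENNReal.toReal_mono h2 hx
  choose K hK0 hK using hb
  refine ⟨∑ i, ∑ j, K i j, Finset.sum_nonneg fun i _ => Finset.sum_nonneg fun j _ => hK0 i j,
    fun u => ?_⟩
  refine (Complex.re_le_norm _).trans ?_
  rw [coefficientForm_apply, norm_sq_eq_integral, ← integral_const_mul]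
  refine norm_integral_le_of_norm_le ((integrable_norm_sq u).const_mul _) ?_
  filter_upwards [ae_all_iff.2 fun i => ae_all_iff.2 (hK i)] with x hx
  rw [Finset.sum_mul]
  refine (norm_sum_le _ _).trans (Finset.sum_le_sum fun i _ => ?_)
  rw [Finset.sum_mul]
  refine (norm_sum_le _ _).trans (Finset.sum_le_sum fun j _ => ?_)
  rw [norm_mul, norm_mul, norm_star, mul_assoc, sq]
  have h1 := PiLp.norm_apply_le (u x) i
  have h2 := PiLp.norm_apply_le (u x) j
  have h3 := hx i j
  have := hK0 i j
  gcongr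

/-- Projection onto a closed subspace along its orthogonal complement for a bounded coercive
Hermitian form. -/
lemma exists_projection_of_coercive {H : Type*} [NormedAddCommGroup H] [InnerProductSpace ℂ H]
    [CompleteSpace H] {B : H →ₗ[ℂ] H →ₗ⋆[ℂ] ℂ} (hB : IsHermPos B) {c C : ℝ} (hc : 0 < c)
    (hlow : ∀ x, c * ‖x‖ ^ 2 ≤ (B x x).re) (hC : ∀ x y, ‖B x y‖ ≤ C * ‖x‖ * ‖y‖)
    (K : Submodule ℂ H) (hK : IsClosed (K : Set H)) (x : H) :
    ∃ y ∈ K, ∀ z ∈ K, B (x - y) z = 0 := by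
  have : CompleteSpace K := hK.completeSpace_coe
  let b : H →L⋆[ℂ] K →L[ℂ] ℂ := LinearMap.mkContinuous₂
    (LinearMap.mk₂'ₛₗ (starRingEnd ℂ) (RingHom.id ℂ) (fun (x : H) (z : K) => B z x)
      (fun x x' z => by simp) (fun r x z => by simp) (fun x z z' => by simp)
      (fun r x z => by simp)) C fun x z => by
        rw [LinearMap.mk₂'ₛₗ_apply, hB.norm_comm]
        exact hC x z
  -- The Lax–Milgram argument: `R x` is the Riesz representative in `K` of `z ↦ B z x`, so the
  -- projection of `x` is any `y` in `K` with `R y = R x`. Coercivity bounds the restriction `T` of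
  -- `R` to `K` from below, hence its range is closed, and a vector orthogonal to the range
  -- vanishes.
  let R : H →L[ℂ] K :=
    (InnerProductSpace.toDual ℂ K).symm.toContinuousLinearEquiv.toContinuousLinearMap.comp b
  have hR : ∀ x (z : K), inner ℂ (R x) z = B z x := fun x z => by simp [R, b]
  let T : K →L[ℂ] K := R.comp K.subtypeL
  have hT : ∀ (y : K), c * ‖y‖ ≤ ‖T y‖ := fun y => by
    rcases (norm_nonneg y).eq_or_lt with h | h
    · rw [← h, mul_zero]
      exact norm_nonneg _
    · refine le_of_mul_le_mul_right ?_ h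
      calc c * ‖y‖ * ‖y‖ = c * ‖(y : H)‖ ^ 2 := by rw [sq, mul_assoc]; rfl
        _ ≤ (B y y).re := hlow y
        _ = (inner ℂ (T y) y).re := by rw [← hR]; rfl
        _ ≤ ‖T y‖ * ‖y‖ := (Complex.re_le_norm _).trans (norm_inner_le_norm _ _)
  have hanti : AntilipschitzWith (c⁻¹).toNNReal T := by
    refine ContinuousLinearMap.antilipschitz_of_bound T fun y => ?_
    rw [Real.coe_toNNReal _ (by positivity), ← div_eq_inv_mul, le_div_iff₀ hc, mul_comm]
    exact hT y
  have hclosed : IsClosed (LinearMap.range T.toLinearMap : Set K) :=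
    hanti.isClosed_range T.uniformContinuous
  have htop : LinearMap.range T.toLinearMap = ⊤ := by
    have := hclosed.completeSpace_coe
    rw [← (LinearMap.range T.toLinearMap).orthogonal_orthogonal, Submodule.eq_top_iff']
    intro v w hw
    have h0 : inner ℂ (T w) w = 0 := hw _ ⟨w, rfl⟩
    have h1 : B w w = 0 := by rw [← h0]; exact (hR w w).symm
    have h2 := hlow w
    rw [h1, Complex.zero_re] at h2
    have h3 : ‖(w : H)‖ = 0 := by
      have : ‖(w : H)‖ ^ 2 ≤ 0 := by
        by_contra! h
        nlinarith
      nlinarith [norm_nonneg (w : H)]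
    have h4 : w = 0 := Subtype.ext (norm_eq_zero.1 h3)
    rw [h4, inner_zero_left]
  obtain ⟨y, hy⟩ : R x ∈ LinearMap.range T.toLinearMap := htop ▸ Submodule.mem_top
  refine ⟨y, y.2, fun z hz => ?_⟩
  have h1 := hR x ⟨z, hz⟩
  have h2 := hR y ⟨z, hz⟩
  have h3 : R y = R x := hy
  have h4 : B z (x - y) = 0 := by
    rw [map_sub, sub_eq_zero, ← h1, ← h2, h3]
  rw [← hB.herm, h4, star_zero]

end CoefficientForm

/-! ### Weak curls and gradients -/

section TestFunctions

variable {d n : ℕ}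

lemma fderiv_component {Φ : Pt d → CVec n} {x : Pt d} (h : DifferentiableAt ℝ Φ x) (v : Pt d)
    (k : Fin n) : fderiv ℝ (fun y => Φ y k) x v = (fderiv ℝ Φ x v) k := by
  have := (((EuclideanSpace.proj k : CVec n →L[ℂ] ℂ).restrictScalars
    ℝ).hasFDerivAt.comp x h.hasFDerivAt).fderiv
  have h2 : (fun y => Φ y k) =
      ((EuclideanSpace.proj k : CVec n →L[ℂ] ℂ).restrictScalars ℝ) ∘ Φ := rfl
  rw [h2, this]
  rfl

lemma IsTest.component {Ω : Set (Pt d)} {φ : Pt d → CVec n} (h : IsTest Ω φ) (k : Fin n) :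
    IsTest Ω (fun x => φ x k) := by
  have hs : Function.support (fun x => φ x k) ⊆ Function.support φ := fun x hx h0 => by
    simp [h0] at hx
  have ht : tsupport (fun x => φ x k) ⊆ tsupport φ := closure_mono hs
  refine ⟨?_, h.2.1.mono hs, ht.trans h.2.2⟩
  exact ((EuclideanSpace.proj k : CVec n →L[ℂ] ℂ).restrictScalars
    ℝ).contDiff.comp h.1

lemma IsTest.fderiv_apply {Ω : Set (Pt d)} {G : Type} [NormedAddCommGroup G] [NormedSpace ℝ G]
    {φ : Pt d → G} (h : IsTest Ω φ) (v : Pt d) :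
    IsTest Ω (fun x => fderiv ℝ φ x v) := by
  refine ⟨(h.1.fderiv_right (m := ∞) (by simp)).clm_apply contDiff_const, ?_,
    (tsupport_fderiv_apply_subset ℝ v).trans h.2.2⟩
  exact h.2.1.fderiv_apply ℝ v

lemma integrable_smul_test {Ω : Set (Pt d)} {ψ : Pt d → ℝ} (hψ : IsTest Ω ψ)
    {φ : Pt d → ℂ} (hφ : Continuous φ) : Integrable (fun x => ψ x • φ x) := by
  refine (hψ.1.continuous.smul hφ).integrable_of_hasCompactSupport ?_
  exact hψ.2.1.smul_right

lemma integrable_test_smul {Ω : Set (Pt d)} {ψ : Pt d → ℝ} (hψ : IsTest Ω ψ)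
    {φ : Pt d → ℂ} (hφ : MemLp φ 2 (volume.restrict Ω)) : Integrable (fun x => ψ x • φ x) := by
  have h1 : MemLp (fun x => (ψ x : ℂ)) 2 (volume.restrict Ω) := by
    refine (Complex.continuous_ofReal.comp hψ.1.continuous).memLp_of_hasCompactSupport ?_
    exact hψ.2.1.comp_left Complex.ofReal_zero
  have h2 : IntegrableOn (fun x => ψ x • φ x) Ω := by
    simp only [Complex.real_smul]
    exact h1.integrable_mul hφ
  refine (integrableOn_iff_integrable_of_support_subset fun x hx => ?_).1 h2
  by_contra hn
  have : x ∉ tsupport ψ := fun h => hn (hψ.2.2 h)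
  exact hx (by simp [image_eq_zero_of_notMem_tsupport this])

lemma setIntegral_smul_test {Ω : Set (Pt d)} {ψ : Pt d → ℝ} (hψ : IsTest Ω ψ) (φ : Pt d → ℂ) :
    ∫ x in Ω, ψ x • φ x = ∫ x, ψ x • φ x := by
  refine setIntegral_eq_integral_of_forall_compl_eq_zero fun x hx => ?_
  have : x ∉ tsupport ψ := fun h => hx (hψ.2.2 h)
  rw [image_eq_zero_of_notMem_tsupport this, zero_smul]

lemma integral_test_smul_fderiv {Ω : Set (Pt d)} {ψ : Pt d → ℝ} (hψ : IsTest Ω ψ)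
    {φ : Pt d → ℂ} (hφ : ContDiff ℝ 1 φ) (v : Pt d) :
    ∫ x in Ω, ψ x • fderiv ℝ φ x v = - ∫ x in Ω, fderiv ℝ ψ x v • φ x := by
  rw [setIntegral_smul_test hψ, setIntegral_smul_test (hψ.fderiv_apply v)]
  refine integral_smul_fderiv_eq_neg_fderiv_smul_of_integrable
    (integrable_smul_test (hψ.fderiv_apply v) hφ.continuous)
    (integrable_smul_test hψ ((hφ.continuous_fderiv one_ne_zero).clm_apply continuous_const))
    (integrable_smul_test hψ hφ.continuous)
    (fun x _ => (hψ.1.differentiable (by simp)) x) (fun x _ => hφ.differentiable one_ne_zero x)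

/-- Integration by parts is an identity between continuous functionals. It is checked on smooth
fields and passes to the closures that define `H0curl` and `H10`. -/
lemma eq_zero_on_span_closure {H : Type*} [NormedAddCommGroup H] [NormedSpace ℂ H] {S : Set H}
    (L : H →L[ℂ] ℂ) (h : ∀ f ∈ S, L f = 0) {f : H}
    (hf : f ∈ (Submodule.span ℂ S).topologicalClosure) : L f = 0 := by
  have : (Submodule.span ℂ S).topologicalClosure ≤ LinearMap.ker L.toLinearMap :=
    Submodule.topologicalClosure_minimal _ (Submodule.span_le.2 fun f hf => h f hf)
      L.isClosed_ker
  exact this hf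

lemma memLp_test {Ω : Set (Pt d)} {ψ : Pt d → ℝ} (hψ : IsTest Ω ψ) (e : CVec n) :
    MemLp (fun x => ψ x • e) 2 (volume.restrict Ω) := by
  refine (hψ.1.continuous.smul continuous_const).memLp_of_hasCompactSupport ?_
  exact hψ.2.1.smul_right

/-- The functional `u ↦ ∫ ψ u_k`. -/
def testFunctional {Ω : Set (Pt d)} {ψ : Pt d → ℝ} (hψ : IsTest Ω ψ) (k : Fin n) :
    VecL2 Ω n →L[ℂ] ℂ :=
  innerSL ℂ ((memLp_test hψ (EuclideanSpace.single k 1)).toLp)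

lemma testFunctional_apply {Ω : Set (Pt d)} {ψ : Pt d → ℝ} (hψ : IsTest Ω ψ) (k : Fin n)
    (u : VecL2 Ω n) : testFunctional hψ k u = ∫ x in Ω, ψ x • u x k := by
  rw [testFunctional, innerSL_apply_apply, L2.inner_def]
  refine integral_congr_ae ?_
  filter_upwards [(memLp_test (n := n) hψ (EuclideanSpace.single k 1)).coeFn_toLp] with x hx
  rw [hx]
  simp [PiLp.inner_apply, mul_comm, apply_ite (starRingEnd ℂ)]

/-- The functional `p ↦ ∫ ψ p`. -/
def scalarTestFunctional {Ω : Set (Pt d)} {ψ : Pt d → ℝ} (hψ : IsTest Ω ψ) :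
    Lp ℂ 2 (volume.restrict Ω) →L[ℂ] ℂ :=
  innerSL ℂ (((hψ.1.continuous.smul continuous_const).memLp_of_hasCompactSupport
    (μ := volume.restrict Ω) (p := 2) hψ.2.1.smul_right : MemLp (fun x => ψ x • (1 : ℂ)) 2 _).toLp)

lemma scalarTestFunctional_apply {Ω : Set (Pt d)} {ψ : Pt d → ℝ} (hψ : IsTest Ω ψ)
    (p : Lp ℂ 2 (volume.restrict Ω)) : scalarTestFunctional hψ p = ∫ x in Ω, ψ x • p x := by
  rw [scalarTestFunctional, innerSL_apply_apply, L2.inner_def]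
  refine integral_congr_ae ?_
  filter_upwards [((hψ.1.continuous.smul continuous_const).memLp_of_hasCompactSupport
    (μ := volume.restrict Ω) (p := 2) hψ.2.1.smul_right :
      MemLp (fun x => ψ x • (1 : ℂ)) 2 _).coeFn_toLp] with x hx
  rw [hx]
  simp [mul_comm]

lemma H10.weak_gradient {Ω : Set (Pt d)} {p : Lp ℂ 2 (volume.restrict Ω) × VecL2 Ω d}
    (hp : p ∈ H10 Ω) {ψ : Pt d → ℝ} (hψ : IsTest Ω ψ) (j : Fin d) :
    ∫ x in Ω, ψ x • p.2 x j = - ∫ x in Ω, fderiv ℝ ψ x (EuclideanSpace.single j 1) • p.1 x := by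
  have hψ' := hψ.fderiv_apply (EuclideanSpace.single j 1)
  have := eq_zero_on_span_closure
    (((testFunctional hψ j).comp (ContinuousLinearMap.snd ℂ _ _)) +
      (scalarTestFunctional hψ').comp (ContinuousLinearMap.fst ℂ _ _)) ?_ hp
  · simp only [add_apply, ContinuousLinearMap.comp_apply,
      ContinuousLinearMap.coe_fst', ContinuousLinearMap.coe_snd', testFunctional_apply,
      scalarTestFunctional_apply] at this
    exact eq_neg_of_add_eq_zero_left this
  · rintro p ⟨φ, hφ, h1, h2⟩
    simp only [add_apply, ContinuousLinearMap.comp_apply,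
      ContinuousLinearMap.coe_fst', ContinuousLinearMap.coe_snd', testFunctional_apply,
      scalarTestFunctional_apply]
    have e1 : ∫ x in Ω, fderiv ℝ ψ x (EuclideanSpace.single j 1) • p.1 x =
        ∫ x in Ω, fderiv ℝ ψ x (EuclideanSpace.single j 1) • φ x :=
      integral_congr_ae (by filter_upwards [h1] with x hx; rw [hx])
    have e2 : ∫ x in Ω, ψ x • p.2 x j =
        ∫ x in Ω, ψ x • fderiv ℝ φ x (EuclideanSpace.single j 1) :=
      integral_congr_ae (by filter_upwards [h2] with x hx; rw [hx]; rfl)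
    rw [e1, e2, integral_test_smul_fderiv hψ (hφ.1.of_le (by simp)), neg_add_cancel]

lemma H0curl.weak_curl {Ω : Set (Pt d)} {f : Field Ω}
    (hf : f ∈ H0curl Ω) {ψ : Pt d → ℝ} (hψ : IsTest Ω ψ) (i : Fin (d.choose 2)) :
    ∫ x in Ω, ψ x • f.2 x i = - ∑ j, ∑ k, (curlTensor d i j k : ℂ) *
      ∫ x in Ω, fderiv ℝ ψ x (EuclideanSpace.single j 1) • f.1 x k := by
  have hψ' := fun j : Fin d => hψ.fderiv_apply (EuclideanSpace.single j 1)
  have := eq_zero_on_span_closure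
    (((testFunctional hψ i).comp (ContinuousLinearMap.snd ℂ _ _)) +
      ∑ j, ∑ k, (curlTensor d i j k : ℂ) •
      (testFunctional (hψ' j) k).comp (ContinuousLinearMap.fst ℂ _ _)) ?_ hf
  · simp only [add_apply, ContinuousLinearMap.comp_apply,
      sum_apply, smul_apply, smul_eq_mul,
      ContinuousLinearMap.coe_fst', ContinuousLinearMap.coe_snd', testFunctional_apply] at this
    exact eq_neg_of_add_eq_zero_left this
  · rintro p ⟨φ, hφ, h1, h2⟩
    simp only [add_apply, ContinuousLinearMap.comp_apply,
      sum_apply, smul_apply, smul_eq_mul,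
      ContinuousLinearMap.coe_fst', ContinuousLinearMap.coe_snd', testFunctional_apply]
    have hd : Differentiable ℝ φ := hφ.1.differentiable (by simp)
    have e1 : ∀ j k, ∫ x in Ω, fderiv ℝ ψ x (EuclideanSpace.single j 1) • p.1 x k =
        - ∫ x in Ω, ψ x • fderiv ℝ (fun y => φ y k) x (EuclideanSpace.single j 1) := fun j k => by
      rw [integral_test_smul_fderiv hψ ((hφ.component k).1.of_le (by simp)), neg_neg]
      exact integral_congr_ae (by filter_upwards [h1] with x hx; rw [hx])
    have e2 : ∫ x in Ω, ψ x • p.2 x i = ∑ j, ∑ k, (curlTensor d i j k : ℂ) *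
        ∫ x in Ω, ψ x • fderiv ℝ (fun y => φ y k) x (EuclideanSpace.single j 1) := by
      have hint : ∀ j k, Integrable (fun x => (curlTensor d i j k : ℂ) *
          ψ x • fderiv ℝ (fun y => φ y k) x (EuclideanSpace.single j 1))
          (volume.restrict Ω) := fun j k =>
        ((integrable_smul_test hψ
          ((hφ.component k).fderiv_apply _).1.continuous).restrict).const_mul _
      simp only [← integral_const_mul]
      simp only [← integral_finsetSum Finset.univ fun k _ => hint _ k]
      rw [← integral_finsetSum Finset.univ fun j _ => integrable_finsetSum _ fun k _ => hint j k]
      refine integral_congr_ae ?_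
      filter_upwards [h2] with x hx
      rw [hx]
      simp only [curlField, Finset.smul_sum, fderiv_component (hd x), Complex.real_smul]
      exact Finset.sum_congr rfl fun j _ => Finset.sum_congr rfl fun k _ => by ring
    simp only [e1, e2, mul_neg, Finset.sum_neg_distrib, add_neg_cancel]

/-- The closure of the graph of the curl is still a graph, since the second component is the weak
curl of the first. This is what makes the ε-form definite on `H0curl`. -/
lemma H0curl.eq_zero_of_fst_eq_zero {Ω : Set (Pt d)} (hΩ : IsOpen Ω) {f : Field Ω}
    (hf : f ∈ H0curl Ω) (h0 : f.1 = 0) : f = 0 := by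
  have hz : ∀ᵐ x ∂(volume.restrict Ω), ∀ k, f.1 x k = 0 := by
    rw [h0]
    filter_upwards [Lp.coeFn_zero (E := CVec d) (μ := volume.restrict Ω) (p := 2)] with x hx k
    rw [hx]
    rfl
  have key : ∀ i, ∀ᵐ x, x ∈ Ω → f.2 x i = 0 := fun i => by
    refine hΩ.ae_eq_zero_of_integral_contDiff_smul_eq_zero ?_ fun ψ h1 h2 h3 => ?_
    · exact locallyIntegrableOn_of_locallyIntegrable_restrict
        ((memLp_component f.2 i).locallyIntegrable (by norm_num))
    · have hψ : IsTest Ω ψ := ⟨h1, h2, h3⟩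
      rw [← setIntegral_smul_test hψ, H0curl.weak_curl hf hψ i, neg_eq_zero]
      refine Finset.sum_eq_zero fun j _ => Finset.sum_eq_zero fun k _ => ?_
      rw [integral_eq_zero_of_ae, mul_zero]
      filter_upwards [hz] with x hx
      simp [hx k]
  refine Prod.ext h0 ?_
  refine Lp.ext ?_
  have : ∀ᵐ x ∂(volume.restrict Ω), ∀ i, f.2 x i = 0 := by
    rw [ae_restrict_iff' hΩ.measurableSet]
    filter_upwards [ae_all_iff.2 key] with x hx hxΩ i using hx i hxΩ
  filter_upwards [this, Lp.coeFn_zero (E := CVec (d.choose 2)) (μ := volume.restrict Ω) (p := 2)]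
    with x hx h0
  refine (PiLp.ext fun i => ?_).trans h0.symm
  exact hx i

/-- Weak gradients are local: testing with functions supported in the interior of `K` identifies the
gradient there, and the frontier of a convex set is null. Applied to mesh cells, this shows that
gradients of Lagrange functions are piecewise polynomial. -/
lemma H10.gradient_eq_on {Ω : Set (Pt d)} (hΩ : IsOpen Ω)
    {p : Lp ℂ 2 (volume.restrict Ω) × VecL2 Ω d} (hp : p ∈ H10 Ω) {K : Set (Pt d)}
    (hK : Convex ℝ K) {s : Pt d → ℂ} (hs : ContDiff ℝ 1 s)
    (h : p.1 =ᵐ[volume.restrict (Ω ∩ K)] s) :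
    p.2 =ᵐ[volume.restrict (Ω ∩ K)] gradField s := by
  set O := Ω ∩ interior K with hO
  have hOo : IsOpen O := hΩ.inter isOpen_interior
  have hOm : volume.restrict O ≤ volume.restrict (Ω ∩ K) :=
    Measure.restrict_mono (Set.inter_subset_inter_right _ interior_subset) le_rfl
  have hOO : volume.restrict O = volume.restrict (Ω ∩ K) := by
    refine Measure.restrict_congr_set ?_
    refine Filter.EventuallyEq.inter Filter.EventuallyEq.rfl ?_
    exact interior_ae_eq_of_null_frontier (hK.addHaar_frontier volume)
  have key : ∀ j, ∀ᵐ x, x ∈ O → p.2 x j - fderiv ℝ s x (EuclideanSpace.single j 1) = 0 :=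
      fun j => by
    have hcont : Continuous fun x => fderiv ℝ s x (EuclideanSpace.single j 1) :=
      (hs.continuous_fderiv one_ne_zero).clm_apply continuous_const
    have hloc : LocallyIntegrable (fun x => p.2 x j) (volume.restrict Ω) :=
      (memLp_component p.2 j).locallyIntegrable (by norm_num)
    refine hOo.ae_eq_zero_of_integral_contDiff_smul_eq_zero ?_ fun ψ h1 h2 h3 => ?_
    · refine LocallyIntegrableOn.sub ?_ (hcont.locallyIntegrable.locallyIntegrableOn _)
      exact (locallyIntegrableOn_of_locallyIntegrable_restrict hloc).mono_set Set.inter_subset_left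
    · have hψ : IsTest O ψ := ⟨h1, h2, h3⟩
      have hψΩ : IsTest Ω ψ := ⟨h1, h2, h3.trans Set.inter_subset_left⟩
      have e1 := H10.weak_gradient hp hψΩ j
      rw [setIntegral_smul_test hψΩ, setIntegral_smul_test (hψΩ.fderiv_apply _),
        ← setIntegral_smul_test (hψ.fderiv_apply _)] at e1
      have e2 : ∫ x in O, fderiv ℝ ψ x (EuclideanSpace.single j 1) • p.1 x =
          ∫ x in O, fderiv ℝ ψ x (EuclideanSpace.single j 1) • s x := by
        refine integral_congr_ae ?_
        filter_upwards [h.filter_mono (ae_mono hOm)] with x hx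
        rw [hx]
      rw [e2, ← integral_test_smul_fderiv hψ hs, setIntegral_smul_test hψ] at e1
      simp only [smul_sub]
      rw [integral_sub, e1, sub_self]
      · exact integrable_test_smul hψΩ (memLp_component p.2 j)
      · exact integrable_smul_test hψ hcont
  rw [← hOO]
  change ∀ᵐ x ∂_, _
  rw [ae_restrict_iff' hOo.measurableSet]
  filter_upwards [ae_all_iff.2 key] with x hx hxO
  refine PiLp.ext fun j => ?_
  exact sub_eq_zero.1 (hx j hxO)

lemma curlTensor_antisymm (i : Fin (d.choose 2)) (j k : Fin d) :
    curlTensor d i k j = - curlTensor d i j k := by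
  unfold curlTensor
  split_ifs <;> ring

/-- An antisymmetric tensor is contracted with the symmetric second derivative; exchanging the two
summation indices shows that the result equals its own negative. -/
lemma curlField_gradField {φ : Pt d → ℂ} (hφ : ContDiff ℝ ∞ φ) (x : Pt d) :
    curlField (gradField φ) x = 0 := by
  have hd1 : Differentiable ℝ (fderiv ℝ φ) :=
    (hφ.fderiv_right (m := ∞) (by simp)).differentiable (by simp)
  have hg : DifferentiableAt ℝ (gradField φ) x := by
    exact (differentiableAt_piLp 2).2 fun j =>
      ((hd1 x).clm_apply (differentiableAt_const (EuclideanSpace.single j 1)) :)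
  have hc : ∀ j k, (fderiv ℝ (gradField φ) x (EuclideanSpace.single j 1)) k =
      fderiv ℝ (fderiv ℝ φ) x (EuclideanSpace.single j 1) (EuclideanSpace.single k 1) :=
      fun j k => by
    rw [← fderiv_component hg]
    have : (fun y => gradField φ y k) = fun y => fderiv ℝ φ y (EuclideanSpace.single k 1) := rfl
    rw [this, fderiv_clm_apply (hd1 x) (differentiableAt_const _)]
    simp
  have hsymm : IsSymmSndFDerivAt ℝ φ x := hφ.contDiffAt.isSymmSndFDerivAt
    (by
      simp only [minSmoothness_of_isRCLikeNormedField]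
      exact WithTop.coe_le_coe.2 (le_top : (2 : ℕ∞) ≤ ⊤))
  refine PiLp.ext fun i => ?_
  have h1 : (curlField (gradField φ) x) i = - (curlField (gradField φ) x) i := by
    simp only [curlField, hc]
    conv_lhs => rw [Finset.sum_comm]
    rw [← Finset.sum_neg_distrib]
    refine Finset.sum_congr rfl fun j _ => ?_
    rw [← Finset.sum_neg_distrib]
    refine Finset.sum_congr rfl fun k _ => ?_
    rw [curlTensor_antisymm, hsymm.eq]
    push_cast
    ring
  have h2 : (2 : ℂ) * (curlField (gradField φ) x) i = 0 := by linear_combination h1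
  simpa using h2

lemma IsTest.gradField {Ω : Set (Pt d)} {φ : Pt d → ℂ} (h : IsTest Ω φ) :
    IsTest Ω (gradField φ) := by
  have hs : Function.support (Maxwell.gradField φ) ⊆ tsupport φ := fun x hx => by
    by_contra hn
    apply hx
    refine PiLp.ext fun j => ?_
    exact image_eq_zero_of_notMem_tsupport (f := fun x => fderiv ℝ φ x (EuclideanSpace.single j 1))
      (fun hn' => hn (tsupport_fderiv_apply_subset ℝ (EuclideanSpace.single j 1) hn'))
  refine ⟨?_, ?_, (closure_minimal hs (isClosed_tsupport φ)).trans h.2.2⟩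
  · exact (contDiff_piLp 2).2 fun j =>
      (h.fderiv_apply (EuclideanSpace.single j 1)).1
  · exact HasCompactSupport.of_support_subset_isCompact h.2.1 hs

lemma H10.gradient_mem_H0curl {Ω : Set (Pt d)}
    {p : Lp ℂ 2 (volume.restrict Ω) × VecL2 Ω d} (hp : p ∈ H10 Ω) :
    ((p.2, 0) : Field Ω) ∈ H0curl Ω := by
  let L : (Lp ℂ 2 (volume.restrict Ω) × VecL2 Ω d) →L[ℂ] Field Ω :=
    (ContinuousLinearMap.snd ℂ _ _).prod 0
  have hle : H10 Ω ≤ (H0curl Ω).comap L.toLinearMap := by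
    refine Submodule.topologicalClosure_minimal _ (Submodule.span_le.2 ?_) ?_
    · rintro p ⟨φ, hφ, -, h2⟩
      refine Submodule.le_topologicalClosure _ (Submodule.subset_span ?_)
      refine ⟨gradField φ, hφ.gradField, h2, ?_⟩
      filter_upwards [Lp.coeFn_zero (E := CVec (d.choose 2)) (μ := volume.restrict Ω) (p := 2)]
        with x hx
      rw [curlField_gradField hφ.1]
      exact hx
    · exact (Submodule.isClosed_topologicalClosure _).preimage L.continuous
  exact hle hp

end TestFunctions

/-! ### Polynomial fields and the local edge space -/

section Polynomials

variable {d : ℕ}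

/-- The derivative of a polynomial. -/
def polyDeriv (s : MvPolynomial (Fin d) ℂ) (x : Pt d) : Pt d →L[ℝ] ℂ :=
  ∑ j, (ContinuousLinearMap.toSpanSingleton ℝ (polyAt (MvPolynomial.pderiv j s) x)).comp
    (EuclideanSpace.proj j : Pt d →L[ℝ] ℝ)

lemma polyDeriv_apply (s : MvPolynomial (Fin d) ℂ) (x v : Pt d) :
    polyDeriv s x v = ∑ j, (v j : ℂ) * polyAt (MvPolynomial.pderiv j s) x := by
  simp [polyDeriv]

lemma hasFDerivAt_polyAt (s : MvPolynomial (Fin d) ℂ) (x : Pt d) :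
    HasFDerivAt (polyAt s) (polyDeriv s x) x := by
  induction s using MvPolynomial.induction_on with
  | C a =>
    have : polyAt (MvPolynomial.C a : MvPolynomial (Fin d) ℂ) = fun _ => a := by
      funext y; simp [polyAt]
    rw [this]
    refine (hasFDerivAt_const a x).congr_fderiv (ContinuousLinearMap.ext fun v => ?_)
    simp [polyDeriv_apply, polyAt]
  | add p q hp hq =>
    have : polyAt (p + q) = polyAt p + polyAt q := by funext y; simp [polyAt]
    rw [this]
    refine (hp.add hq).congr_fderiv (ContinuousLinearMap.ext fun v => ?_)
    simp [polyDeriv_apply, polyAt, mul_add, Finset.sum_add_distrib]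
  | mul_X p i hp =>
    have h1 : polyAt (p * MvPolynomial.X i) = fun y => polyAt p y * (y i : ℂ) := by
      funext y; simp [polyAt]
    have h2 : HasFDerivAt (fun y : Pt d => (y i : ℂ))
        (Complex.ofRealCLM.comp (EuclideanSpace.proj i : Pt d →L[ℝ] ℝ)) x :=
      (Complex.ofRealCLM.comp (EuclideanSpace.proj i : Pt d →L[ℝ] ℝ)).hasFDerivAt
    rw [h1]
    refine (hp.mul h2).congr_fderiv (ContinuousLinearMap.ext fun v => ?_)
    have h3 : ∀ j, polyAt (MvPolynomial.pderiv j (p * MvPolynomial.X i)) x =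
        (x i : ℂ) * polyAt (MvPolynomial.pderiv j p) x + if i = j then polyAt p x else 0 :=
      fun j => by
        by_cases h : i = j
        · subst h; simp [polyAt, add_comm]
        · simp [polyAt, h]
    simp only [add_apply, smul_apply, polyDeriv_apply, h3, mul_add, Finset.sum_add_distrib,
      mul_ite, mul_zero, Finset.sum_ite_eq, Finset.mem_univ, if_true, smul_eq_mul, Finset.mul_sum,
      ContinuousLinearMap.comp_apply, PiLp.proj_apply, Complex.ofRealCLM_apply]
    rw [add_comm, mul_comm (polyAt p x)]
    congr 1
    exact Finset.sum_congr rfl fun j _ => by ring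

lemma contDiff_polyAt (s : MvPolynomial (Fin d) ℂ) : ContDiff ℝ 1 (polyAt s) := by
  have hcont : ∀ p : MvPolynomial (Fin d) ℂ, Continuous (polyAt p : Pt d → ℂ) := fun p =>
    continuous_iff_continuousAt.2 fun x => (hasFDerivAt_polyAt p x).continuousAt
  refine contDiff_one_iff_fderiv.2 ⟨fun x => (hasFDerivAt_polyAt s x).differentiableAt, ?_⟩
  have : fderiv ℝ (polyAt s) = fun x : Pt d => polyDeriv s x :=
    funext fun x => (hasFDerivAt_polyAt s x).fderiv
  rw [this]
  refine continuous_clm_apply.2 fun v => ?_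
  simp only [polyDeriv_apply]
  exact continuous_finsetSum _ fun j _ => continuous_const.mul (hcont _)

lemma gradField_polyAt (s : MvPolynomial (Fin d) ℂ) (x : Pt d) (k : Fin d) :
    gradField (polyAt s) x k = polyAt (MvPolynomial.pderiv k s) x := by
  simp [gradField, (hasFDerivAt_polyAt s x).fderiv, polyDeriv_apply, apply_ite (Complex.ofReal)]

lemma totalDegree_pderiv_le {r : ℕ} {s : MvPolynomial (Fin d) ℂ} (hs : s.totalDegree ≤ r + 1)
    (k : Fin d) : (MvPolynomial.pderiv k s).totalDegree ≤ r := by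
  rw [s.as_sum, map_sum]
  refine MvPolynomial.totalDegree_finsetSum_le fun m hm => ?_
  rw [MvPolynomial.pderiv_monomial]
  -- If `m k = 0`, truncated subtraction would not lower the degree, but then the coefficient of the
  -- monomial is zero.
  by_cases h0 : m k = 0
  · simp [h0]
  refine (MvPolynomial.totalDegree_monomial_le _ _).trans ?_
  have h1 : m.sum (fun _ e => e) ≤ r + 1 := (MvPolynomial.le_totalDegree hm).trans hs
  have h2 : m = (m - Finsupp.single k 1) + Finsupp.single k 1 := by
    ext j
    rcases eq_or_ne j k with rfl | h
    · simp; omega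
    · simp [Finsupp.single_eq_of_ne h]
  have h3 := congrArg Finsupp.degree h2
  rw [map_add, Finsupp.degree_single] at h3
  change m.degree ≤ r + 1 at h1
  change (m - Finsupp.single k 1).degree ≤ r
  omega

/-- Embeds the local edge space in a space of polynomial fields of bounded degree, from which finite
dimensionality follows. -/
lemma IsEdgePoly.exists_poly {r : ℕ} {F : Pt d → CVec d} (h : IsEdgePoly r F) :
    ∃ p : Fin d → MvPolynomial (Fin d) ℂ, (∀ k, (p k).totalDegree ≤ r + 1) ∧
      ∀ x k, F x k = polyAt (p k) x := by
  obtain ⟨p, q, hp, hq, hF⟩ := h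
  refine ⟨fun k => p k + ∑ i, ∑ j, MvPolynomial.C (curlTensor d i j k : ℂ) *
    (MvPolynomial.X j * q i), fun k => ?_, fun x k => ?_⟩
  · refine (MvPolynomial.totalDegree_add _ _).trans (max_le ((hp k).trans (by omega)) ?_)
    refine MvPolynomial.totalDegree_finsetSum_le fun i _ =>
      MvPolynomial.totalDegree_finsetSum_le fun j _ => ?_
    refine (MvPolynomial.totalDegree_mul _ _).trans ?_
    have h1 := MvPolynomial.totalDegree_mul (MvPolynomial.X j) (q i)
    have h2 := (hq i).totalDegree_le
    rw [MvPolynomial.totalDegree_X] at h1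
    rw [MvPolynomial.totalDegree_C]
    omega
  · rw [hF]
    simp only [polyAt, map_add, map_sum, map_mul, MvPolynomial.eval_C, MvPolynomial.eval_X,
      mul_assoc]

lemma IsEdgePoly.zero (r : ℕ) : IsEdgePoly r (0 : Pt d → CVec d) :=
  ⟨0, 0, fun k => by simp, fun i => MvPolynomial.isHomogeneous_zero _ _ _,
    fun x k => by simp [polyAt]⟩

lemma IsEdgePoly.add {r : ℕ} {F F' : Pt d → CVec d} (h : IsEdgePoly r F)
    (h' : IsEdgePoly r F') : IsEdgePoly r (F + F') := by
  obtain ⟨p, q, hp, hq, hF⟩ := h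
  obtain ⟨p', q', hp', hq', hF'⟩ := h'
  refine ⟨p + p', q + q', fun k => (MvPolynomial.totalDegree_add _ _).trans
    (max_le (hp k) (hp' k)), fun i => (hq i).add (hq' i), fun x k => ?_⟩
  simp only [Pi.add_apply, PiLp.add_apply, hF, hF', polyAt, map_add, mul_add,
    Finset.sum_add_distrib]
  ring

lemma IsEdgePoly.smul {r : ℕ} {F : Pt d → CVec d} (h : IsEdgePoly r F) (c : ℂ) :
    IsEdgePoly r (c • F) := by
  obtain ⟨p, q, hp, hq, hF⟩ := h
  refine ⟨c • p, c • q, fun k => (MvPolynomial.totalDegree_smul_le _ _).trans (hp k),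
    fun i => ?_, fun x k => ?_⟩
  · rw [Pi.smul_apply, MvPolynomial.smul_eq_C_mul]
    simpa using (MvPolynomial.isHomogeneous_C (Fin d) c).mul (hq i)
  · simp only [Pi.smul_apply, PiLp.smul_apply, hF, polyAt, MvPolynomial.smul_eval, smul_eq_mul,
      mul_add, Finset.mul_sum]
    congr 1
    exact Finset.sum_congr rfl fun i _ => Finset.sum_congr rfl fun j _ => by ring

lemma isEdgePoly_gradField {r : ℕ} {s : MvPolynomial (Fin d) ℂ} (hs : s.totalDegree ≤ r + 1) :
    IsEdgePoly r (gradField (polyAt s) : Pt d → CVec d) :=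
  ⟨fun k => MvPolynomial.pderiv k s, 0, fun k => totalDegree_pderiv_le hs k,
    fun i => MvPolynomial.isHomogeneous_zero _ _ _, fun x k => by
      rw [gradField_polyAt]; simp [polyAt]⟩

/-- The field with given polynomial components. -/
def polyField (p : Fin d → MvPolynomial (Fin d) ℂ) (x : Pt d) : CVec d :=
  WithLp.toLp 2 fun k => polyAt (p k) x

lemma continuous_polyField (p : Fin d → MvPolynomial (Fin d) ℂ) : Continuous (polyField p) :=
  (PiLp.continuous_toLp 2 _).comp (continuous_pi fun k => (contDiff_polyAt (p k)).continuous)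

end Polynomials

/-! ### The edge element space: discrete gradients and finite dimension -/

namespace Problem

variable {d : ℕ} (P : Problem d)

/-- The edge element space as a submodule. -/
def VSub (r : ℕ) (T : Mesh P.Ω) : Submodule ℂ (Field P.Ω) where
  carrier := P.V r T
  zero_mem' := ⟨zero_mem _, fun κ _ => ⟨0, IsEdgePoly.zero r,
    (Lp.coeFn_zero (CVec d) 2 (volume.restrict P.Ω)).filter_mono
      (ae_mono (Measure.restrict_mono Set.inter_subset_left le_rfl))⟩⟩
  add_mem' := by
    rintro f g ⟨hf, hf'⟩ ⟨hg, hg'⟩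
    refine ⟨add_mem hf hg, fun κ hκ => ?_⟩
    obtain ⟨F, hF, hF'⟩ := hf' κ hκ
    obtain ⟨G, hG, hG'⟩ := hg' κ hκ
    refine ⟨F + G, hF.add hG, ?_⟩
    filter_upwards [hF', hG', (Lp.coeFn_add f.1 g.1).filter_mono
      (ae_mono (Measure.restrict_mono Set.inter_subset_left le_rfl))] with x h1 h2 h3
    exact h3.trans (by simp [h1, h2])
  smul_mem' := by
    rintro c f ⟨hf, hf'⟩
    refine ⟨Submodule.smul_mem _ _ hf, fun κ hκ => ?_⟩
    obtain ⟨F, hF, hF'⟩ := hf' κ hκ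
    refine ⟨c • F, hF.smul c, ?_⟩
    filter_upwards [hF', (Lp.coeFn_smul c f.1).filter_mono
      (ae_mono (Measure.restrict_mono Set.inter_subset_left le_rfl))] with x h1 h3
    exact h3.trans (by simp [h1])

lemma gradient_mem_V {r : ℕ} {T : Mesh P.Ω} {p : Lp ℂ 2 (volume.restrict P.Ω) × VecL2 P.Ω d}
    (hp : p ∈ P.U r T) : ((p.2, 0) : Field P.Ω) ∈ P.V r T := by
  refine ⟨H10.gradient_mem_H0curl hp.1, fun κ hκ => ?_⟩
  obtain ⟨s, hs, hps⟩ := hp.2 κ hκ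
  exact ⟨_, isEdgePoly_gradField hs,
    H10.gradient_eq_on P.isOpen hp.1 (convex_convexHull ℝ _) (contDiff_polyAt s) hps⟩

/-- The restriction of square integrable fields to a subset. -/
def restrictTo (K : Set (Pt d)) :
    VecL2 P.Ω d →ₗ[ℂ] (Pt d →ₘ[volume.restrict (P.Ω ∩ K)] CVec d) where
  toFun u := AEEqFun.mk u ((Lp.aestronglyMeasurable u).mono_measure
    (Measure.restrict_mono Set.inter_subset_left le_rfl))
  map_add' u v := by
    rw [AEEqFun.mk_add_mk, AEEqFun.mk_eq_mk]
    exact (Lp.coeFn_add u v).filter_mono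
      (ae_mono (Measure.restrict_mono Set.inter_subset_left le_rfl))
  map_smul' c u := by
    refine AEEqFun.mk_eq_mk.2 ?_
    exact (Lp.coeFn_smul c u).filter_mono
      (ae_mono (Measure.restrict_mono Set.inter_subset_left le_rfl))

/-- The classes of the polynomial fields on a subset. -/
def polyClass (K : Set (Pt d)) :
    (Fin d → MvPolynomial (Fin d) ℂ) →ₗ[ℂ] (Pt d →ₘ[volume.restrict (P.Ω ∩ K)] CVec d) where
  toFun p := AEEqFun.mk (polyField p) (continuous_polyField p).aestronglyMeasurable
  map_add' p q := by
    rw [AEEqFun.mk_add_mk, AEEqFun.mk_eq_mk]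
    refine Filter.Eventually.of_forall fun x => PiLp.ext fun k => ?_
    simp [polyField, polyAt]
  map_smul' c p := by
    refine AEEqFun.mk_eq_mk.2 ?_
    refine Filter.Eventually.of_forall fun x => PiLp.ext fun k => ?_
    simp [polyField, polyAt]

instance finiteDimensional_VSub (r : ℕ) (T : Mesh P.Ω) : FiniteDimensional ℂ (P.VSub r T) := by
  let Q : Submodule ℂ (Fin d → MvPolynomial (Fin d) ℂ) :=
    Submodule.pi Set.univ fun _ => MvPolynomial.restrictTotalDegree (Fin d) ℂ (r + 1)
  have hQ : FiniteDimensional ℂ Q := by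
    have e : Q ≃ₗ[ℂ] (Fin d → MvPolynomial.restrictTotalDegree (Fin d) ℂ (r + 1)) :=
      { toFun := fun p k => ⟨p.1 k, p.2 k trivial⟩
        invFun := fun p => ⟨fun k => p k, fun k _ => (p k).2⟩
        map_add' := fun _ _ => rfl
        map_smul' := fun _ _ => rfl
        left_inv := fun _ => rfl
        right_inv := fun _ => rfl }
    exact Module.Finite.equiv e.symm
  have hfd : ∀ K : Set (Pt d), FiniteDimensional ℂ (Q.map (P.polyClass K)) := fun K =>
    inferInstance
  have hmem : ∀ (f : P.VSub r T) (κ : T.cells), P.restrictTo (convexHull ℝ (κ.1 : Set (Pt d))) f.1.1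
      ∈ Q.map (P.polyClass (convexHull ℝ (κ.1 : Set (Pt d)))) := fun f κ => by
    obtain ⟨F, hF, hF'⟩ := f.2.2 κ.1 κ.2
    obtain ⟨p, hp, hp'⟩ := hF.exists_poly
    refine ⟨p, fun k _ => (MvPolynomial.mem_restrictTotalDegree _ _ _).2 (hp k), ?_⟩
    refine AEEqFun.mk_eq_mk.2 ?_
    filter_upwards [hF'] with x hx
    rw [hx]
    exact PiLp.ext fun k => (hp' x k).symm
  -- A discrete field is determined by its restrictions to the cells: these cover Ω, and the field
  -- determines its curl. Each restriction lies in a finite-dimensional polynomial space.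
  let Φ : P.VSub r T →ₗ[ℂ]
      ((κ : T.cells) → Q.map (P.polyClass (convexHull ℝ (κ.1 : Set (Pt d))))) :=
    LinearMap.pi fun κ => LinearMap.codRestrict _
      ((P.restrictTo (convexHull ℝ (κ.1 : Set (Pt d)))).comp
        ((LinearMap.fst ℂ _ _).comp (P.VSub r T).subtype)) fun f => hmem f κ
  refine FiniteDimensional.of_injective (V₂ := (κ : T.cells) → Q.map (P.polyClass
    (convexHull ℝ (κ.1 : Set (Pt d))))) Φ ((injective_iff_map_eq_zero Φ).2 fun f hf => ?_)
  refine Subtype.ext (H0curl.eq_zero_of_fst_eq_zero P.isOpen f.2.1 (Lp.ext ?_))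
  have h0 : ∀ κ : T.cells, ∀ᵐ x ∂(volume.restrict (P.Ω ∩ convexHull ℝ (κ.1 : Set (Pt d)))),
      f.1.1 x = 0 := fun κ => by
    have h1 : P.restrictTo (convexHull ℝ (κ.1 : Set (Pt d))) f.1.1 = 0 :=
      congrArg Subtype.val (congrFun hf κ)
    exact AEEqFun.mk_eq_mk.1 h1
  have h1 : ∀ᵐ x ∂(volume.restrict
      (⋃ κ : T.cells, P.Ω ∩ convexHull ℝ (κ.1 : Set (Pt d)))), f.1.1 x = 0 :=
    (ae_restrict_iUnion_iff _ _).2 h0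
  have h2 : (⋃ κ : T.cells, P.Ω ∩ convexHull ℝ (κ.1 : Set (Pt d))) = P.Ω := by
    rw [← Set.inter_iUnion, Set.inter_eq_left]
    refine subset_closure.trans (T.union.symm.subset.trans ?_)
    exact Set.iUnion₂_subset fun κ hκ =>
      Set.subset_iUnion (fun κ : T.cells => convexHull ℝ (κ.1 : Set (Pt d))) ⟨κ, hκ⟩
  rw [h2] at h1
  filter_upwards [h1, Lp.coeFn_zero (CVec d) 2 (volume.restrict P.Ω)] with x hx h0
  rw [hx]
  exact h0.symm

end Problem

/-! ### Diagonalization of two forms and shifted inverse iteration -/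

section EigenFamilies

variable {F : Type*} [AddCommGroup F] [Module ℂ F] {e a B : F →ₗ[ℂ] F →ₗ⋆[ℂ] ℂ}

/-- Simultaneous diagonalization of two Hermitian forms on a finite-dimensional space, one of
which is definite. -/
lemma exists_eigenbasis (he : IsHermPos e) (ha : IsHermPos a) (W : Submodule ℂ F)
    [FiniteDimensional ℂ W] (hdef : ∀ x ∈ W, (e x x).re = 0 → x = 0) :
    ∃ (n : ℕ) (b : Fin n → F) (s : Fin n → ℝ), (∀ i, b i ∈ W) ∧
      (∀ i j, e (b i) (b j) = if i = j then 1 else 0) ∧ W = Submodule.span ℂ (Set.range b) ∧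
      ∀ i, ∀ v ∈ W, a (b i) v = (s i : ℂ) * e (b i) v := by
  let core : InnerProductSpace.Core ℂ W :=
    { inner := fun x y => e y x
      conj_inner_symm := fun x y => he.herm x y
      re_inner_nonneg := fun x => he.nonneg x
      add_left := fun x y z => by simp
      smul_left := fun x y r => by simp
      definite := fun x hx => Subtype.ext (hdef x x.2 (by rw [hx, Complex.zero_re])) }
  let _ : NormedAddCommGroup W := core.toNormedAddCommGroup
  let _ : InnerProductSpace ℂ W := InnerProductSpace.ofCore core.toCore
  have hin : ∀ x y : W, inner ℂ x y = e y x := fun x y => rfl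
  let o := stdOrthonormalBasis ℂ W
  -- The operator that represents `a` in the inner product given by `e`. It is symmetric, and the
  -- spectral theorem supplies the basis.
  let T : W →ₗ[ℂ] W := ∑ i, ((a.flip (o i)).comp W.subtype).smulRight (o i)
  have hT : ∀ x y : W, inner ℂ y (T x) = a x y := fun x y => by
    have hTx : T x = ∑ i, a x (o i) • o i := by simp [T, LinearMap.sum_apply]
    rw [hTx, inner_sum]
    conv_rhs => rw [← o.sum_repr' y]
    simp only [Submodule.coe_sum, Submodule.coe_smul, map_sum, map_smulₛₗ, smul_eq_mul,
      inner_smul_right]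
    exact Finset.sum_congr rfl fun i _ => by rw [inner_conj_symm, mul_comm]
  have hTs : T.IsSymmetric := fun x y => by
    rw [hT y x, ← ha.herm x y, ← hT x y, ← inner_conj_symm]
    rfl
  let b := hTs.eigenvectorBasis rfl
  refine ⟨_, fun i => b i, hTs.eigenvalues rfl, fun i => (b i).2, fun i j => ?_, ?_, ?_⟩
  · have := orthonormal_iff_ite.1 b.orthonormal j i
    rw [← hin, this]
    simp only [eq_comm]
  · have h1 := congrArg (Submodule.map W.subtype) b.toBasis.span_eq
    rw [Submodule.map_span, Submodule.map_top, Submodule.range_subtype, ← Set.range_comp] at h1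
    refine h1.symm.trans (congrArg (fun S => Submodule.span ℂ (Set.range S)) ?_)
    funext i
    simp
  · intro i v hv
    have h1 := hT (b i) ⟨v, hv⟩
    rw [hTs.apply_eigenvectorBasis, inner_smul_right, hin] at h1
    exact h1.symm

variable {ι : Type*} [DecidableEq ι] {b : ι → F}

lemma apply_sum_of_diagonal {t : ι → ℝ}
    (hB : ∀ i j, B (b i) (b j) = if i = j then (t i : ℂ) else 0) (J : Finset ι) (c : ι → ℂ)
    (j : ι) : B (∑ i ∈ J, c i • b i) (b j) = if j ∈ J then (t j : ℂ) * c j else 0 := by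
  simp only [map_sum, LinearMap.sum_apply, map_smul, LinearMap.smul_apply, hB, smul_eq_mul,
    mul_ite, mul_zero, Finset.sum_ite_eq', mul_comm]

lemma formNorm_sq_sum_of_diagonal (h : IsHermPos B) {t : ι → ℝ}
    (hB : ∀ i j, B (b i) (b j) = if i = j then (t i : ℂ) else 0) (J : Finset ι) (c : ι → ℂ) :
    formNorm B (∑ i ∈ J, c i • b i) ^ 2 = ∑ i ∈ J, t i * ‖c i‖ ^ 2 := by
  rw [h.sq]
  conv_lhs => rw [map_sum]
  rw [Complex.re_sum]
  refine Finset.sum_congr rfl fun i hi => ?_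
  rw [map_smulₛₗ, apply_sum_of_diagonal hB, if_pos hi, smul_eq_mul, mul_left_comm,
    mul_comm ((starRingEnd ℂ) (c i)), Complex.mul_conj, Complex.normSq_eq_norm_sq,
    ← Complex.ofReal_mul, Complex.ofReal_re]

/-- Bessel's inequality for a form that need not be definite: the projection x of y satisfies ‖x‖² =
Re e(y, x) ≤ ‖y‖ ‖x‖. -/
lemma sum_norm_sq_le (he : IsHermPos e) (ho : ∀ i j, e (b i) (b j) = if i = j then 1 else 0)
    (J : Finset ι) (y : F) : ∑ i ∈ J, ‖e y (b i)‖ ^ 2 ≤ formNorm e y ^ 2 := by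
  have ho' : ∀ i j, e (b i) (b j) = if i = j then (((fun _ => 1 : ι → ℝ) i : ℝ) : ℂ) else 0 := by
    simpa using ho
  set x := ∑ i ∈ J, e y (b i) • b i with hx
  have h1 : formNorm e x ^ 2 = ∑ i ∈ J, ‖e y (b i)‖ ^ 2 := by
    rw [hx, formNorm_sq_sum_of_diagonal he ho']
    simp
  have h2 : (e y x).re = ∑ i ∈ J, ‖e y (b i)‖ ^ 2 := by
    rw [hx, map_sum, Complex.re_sum]
    refine Finset.sum_congr rfl fun i _ => ?_
    rw [map_smulₛₗ, smul_eq_mul, mul_comm, Complex.mul_conj, Complex.normSq_eq_norm_sq,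
      Complex.ofReal_re]
  have h3 := (Complex.re_le_norm _).trans (he.norm_apply_le y x)
  rw [← h1]
  rw [h2, ← h1] at h3
  have h4 := formNorm_nonneg (B := e) x
  have h5 := formNorm_nonneg (B := e) y
  have h6 : formNorm e x ≤ formNorm e y := by
    rcases h4.eq_or_lt with h | h
    · rw [← h]; exact h5
    · nlinarith
  gcongr

variable [Fintype ι]

/-- One step of shifted inverse iteration. The component of the solution outside the cluster `J`
is controlled by the distance of the right-hand side to the cluster space, and its component in
the cluster space is large when the shift is close to the cluster. -/
lemma inverse_iteration (he : IsHermPos e) (ha : IsHermPos a) {c0 : ℝ} (hc0 : 0 < c0)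
    {s : ι → ℝ} (ho : ∀ i j, e (b i) (b j) = if i = j then 1 else 0)
    (hs : ∀ i j, a (b i) (b j) = if i = j then (s i : ℂ) else 0)
    (hA : IsHermPos (a + (c0 : ℂ) • e)) {lam0 κ θ : ℝ} (hκ : 0 < κ) (hθ : 0 ≤ θ)
    (J : Finset ι) (hout : ∀ i ∉ J, κ * (s i + c0) ≤ |s i - lam0|)
    (hin : ∀ i ∈ J, |s i - lam0| ≤ θ) {w u f : F} {cw : ι → ℂ} (hw : w = ∑ i, cw i • b i)
    (heq : ∀ i, a w (b i) - (lam0 : ℂ) * e w (b i) = e u (b i)) {cf : ι → ℂ}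
    (hf : f = ∑ i ∈ J, cf i • b i) :
    formNorm (a + (c0 : ℂ) • e) (w - ∑ i ∈ J, cw i • b i) ≤
        (κ * Real.sqrt c0)⁻¹ * formNorm e (u - f) ∧
      formNorm e f - formNorm e (u - f) ≤
        θ * (Real.sqrt c0)⁻¹ * formNorm (a + (c0 : ℂ) • e) w := by
  have ho' : ∀ i j, e (b i) (b j) = if i = j then (((fun _ => 1 : ι → ℝ) i : ℝ) : ℂ) else 0 := by
    simpa using ho
  have hAd : ∀ i j, (a + (c0 : ℂ) • e) (b i) (b j) =
      if i = j then (((fun i => s i + c0) i : ℝ) : ℂ) else 0 := fun i j => by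
    simp only [LinearMap.add_apply, LinearMap.smul_apply, hs, ho, smul_eq_mul]
    split_ifs <;> push_cast <;> ring
  have hs0 : ∀ i, 0 ≤ s i := fun i => by
    have := ha.nonneg (b i)
    rwa [hs, if_pos rfl, Complex.ofReal_re] at this
  -- Testing the equation with one basis function isolates one coefficient.
  have hcoef : ∀ i, ((s i - lam0 : ℝ) : ℂ) * cw i = e u (b i) := fun i => by
    rw [← heq, hw, apply_sum_of_diagonal hs, apply_sum_of_diagonal ho', if_pos (Finset.mem_univ _),
      if_pos (Finset.mem_univ _)]
    push_cast
    ring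
  have hcoef' : ∀ i, ‖e u (b i)‖ = |s i - lam0| * ‖cw i‖ := fun i => by
    rw [← hcoef, norm_mul, Complex.norm_real, Real.norm_eq_abs]
  have hsq : Real.sqrt c0 ^ 2 = c0 := Real.sq_sqrt hc0.le
  have hsq0 : 0 < Real.sqrt c0 := Real.sqrt_pos.2 hc0
  have hsplit : w - ∑ i ∈ J, cw i • b i = ∑ i ∈ Jᶜ, cw i • b i := by
    rw [hw, sub_eq_iff_eq_add, Finset.sum_compl_add_sum]
  constructor
  · rw [hsplit]
    refine (abs_le_of_sq_le_sq' ?_ (mul_nonneg (by positivity) (formNorm_nonneg _))).2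
    rw [formNorm_sq_sum_of_diagonal hA hAd, mul_pow]
    refine le_trans ?_ (mul_le_mul_of_nonneg_left (sum_norm_sq_le he ho Jᶜ (u - f))
      (by positivity))
    rw [Finset.mul_sum]
    refine Finset.sum_le_sum fun i hi => ?_
    rw [Finset.mem_compl] at hi
    -- Since `f` has no component outside `J`, only the distance of `u` to the cluster space enters.
    have h1 : e (u - f) (b i) = e u (b i) := by
      rw [map_sub, LinearMap.sub_apply, hf, apply_sum_of_diagonal ho', if_neg hi, sub_zero]
    rw [h1, hcoef', mul_pow |s i - lam0|, inv_pow, mul_pow, hsq,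
      ← div_eq_inv_mul, le_div_iff₀ (by positivity)]
    have h2 := hout i hi
    have h3 : (κ * (s i + c0)) ^ 2 ≤ |s i - lam0| ^ 2 := by
      have := hs0 i
      gcongr
    have h4 : (s i + c0) * (κ ^ 2 * c0) ≤ |s i - lam0| ^ 2 := by
      refine le_trans ?_ h3
      have : 0 ≤ κ ^ 2 * (s i + c0) * s i := by have := hs0 i; positivity
      nlinarith
    nlinarith [mul_le_mul_of_nonneg_right h4 (sq_nonneg ‖cw i‖)]
  -- `Pf` is the e-orthogonal projection onto the cluster space and fixes `f`. The coefficients of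
  -- `Pf u` are those of `w` times s_i - λ₀, hence small relative to `w`; so an upper bound for `f`
  -- is a lower bound for `w`.
  · set Pf : F → F := fun y => ∑ i ∈ J, e y (b i) • b i with hPf
    have h1 : Pf f = f := by
      simp only [hPf]
      conv_rhs => rw [hf]
      refine Finset.sum_congr rfl fun i hi => ?_
      rw [hf, apply_sum_of_diagonal ho', if_pos hi, Complex.ofReal_one, one_mul]
    have h2 : Pf f = Pf u - Pf (u - f) := by
      simp [hPf, ← Finset.sum_sub_distrib, sub_smul]
    have h3 : ∀ y, formNorm e (Pf y) ^ 2 = ∑ i ∈ J, ‖e y (b i)‖ ^ 2 := fun y => by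
      rw [formNorm_sq_sum_of_diagonal he ho']
      simp
    have h4 : formNorm e (Pf (u - f)) ≤ formNorm e (u - f) :=
      (abs_le_of_sq_le_sq' ((h3 _).trans_le (sum_norm_sq_le he ho J _)) (formNorm_nonneg _)).2
    have h5 : formNorm e (Pf u) ≤ θ * (Real.sqrt c0)⁻¹ * formNorm (a + (c0 : ℂ) • e) w := by
      refine (abs_le_of_sq_le_sq' ?_ (mul_nonneg (by positivity) (formNorm_nonneg _))).2
      rw [h3, mul_pow, hw, formNorm_sq_sum_of_diagonal hA hAd, Finset.mul_sum]
      refine (Finset.sum_le_sum fun i hi => ?_).trans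
        (Finset.sum_le_sum_of_subset_of_nonneg (Finset.subset_univ J) fun i _ _ => ?_)
      · rw [hcoef', mul_pow, mul_pow, inv_pow, hsq]
        have h6 : |s i - lam0| ^ 2 ≤ θ ^ 2 := by
          have := hin i hi
          gcongr
        -- This factor passes from the e-norm to the norm of `a + c0 e`, and uses s_i ≥ 0.
        have h7 : 1 ≤ c0⁻¹ * (s i + c0) := by
          rw [← div_eq_inv_mul, one_le_div hc0]
          linarith [hs0 i]
        calc |s i - lam0| ^ 2 * ‖cw i‖ ^ 2 ≤ θ ^ 2 * ‖cw i‖ ^ 2 * 1 := by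
              rw [mul_one]; gcongr
          _ ≤ θ ^ 2 * ‖cw i‖ ^ 2 * (c0⁻¹ * (s i + c0)) := by gcongr
          _ = _ := by ring
      · have := hs0 i
        positivity
    have h7 := he.add_le (Pf u) (-Pf (u - f))
    rw [← sub_eq_add_neg, ← h2, h1, formNorm_neg] at h7
    linarith

end EigenFamilies

/-! ### The Maxwell forms and their norms -/

namespace Problem

variable {d : ℕ} (P : Problem d)

/-- The form `(ε u, v)` on square integrable fields. -/
def epsL2 : VecL2 P.Ω d →ₗ[ℂ] VecL2 P.Ω d →ₗ⋆[ℂ] ℂ := coefficientForm P.ε_bounded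

/-- The form `(ε u, v)` as a sesquilinear form. -/
def epsSesq : Field P.Ω →ₗ[ℂ] Field P.Ω →ₗ⋆[ℂ] ℂ :=
  LinearMap.mk₂'ₛₗ (RingHom.id ℂ) (starRingEnd ℂ) (fun f g => P.epsL2 f.1 g.1)
    (fun f f' g => by simp) (fun c f g => by simp) (fun f g g' => by simp) (fun c f g => by simp)

/-- The form `a` as a sesquilinear form. -/
def aSesq : Field P.Ω →ₗ[ℂ] Field P.Ω →ₗ⋆[ℂ] ℂ :=
  LinearMap.mk₂'ₛₗ (RingHom.id ℂ) (starRingEnd ℂ)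
    (fun f g => coefficientForm P.μ_inv_bounded f.2 g.2)
    (fun f f' g => by simp) (fun c f g => by simp) (fun f g g' => by simp) (fun c f g => by simp)

/-- The form `A` as a sesquilinear form. -/
def ASesq : Field P.Ω →ₗ[ℂ] Field P.Ω →ₗ⋆[ℂ] ℂ := P.aSesq + (P.shiftConst : ℂ) • P.epsSesq

lemma epsForm_eq (f g : Field P.Ω) : P.epsForm f.1 g.1 = P.epsSesq f g := rfl

lemma aForm_eq (f g : Field P.Ω) : P.aForm f g = P.aSesq f g := rfl

lemma ASesq_apply (f g : Field P.Ω) :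
    P.ASesq f g = P.aSesq f g + (P.shiftConst : ℂ) * P.epsSesq f g := rfl

lemma normA_eq (f : Field P.Ω) : P.normA f = formNorm P.ASesq f := rfl

lemma normEps_eq (f : Field P.Ω) : P.normEps f = formNorm P.epsSesq f := rfl

lemma shiftConst_pos : 0 < P.shiftConst := div_pos P.γ_pos P.β_pos

lemma epsL2_isHermPos : IsHermPos P.epsL2 :=
  coefficientForm_isHermPos _ P.ε_hermitian P.β_pos.le P.ε_lower

lemma epsSesq_isHermPos : IsHermPos P.epsSesq where
  herm f g := P.epsL2_isHermPos.herm f.1 g.1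
  nonneg f := P.epsL2_isHermPos.nonneg f.1

lemma aSesq_isHermPos : IsHermPos P.aSesq := by
  have h : IsHermPos (coefficientForm P.μ_inv_bounded) :=
    coefficientForm_isHermPos _ (P.μ_hermitian.mono fun x hx => hx.inv) P.γ_pos.le P.μ_inv_lower
  exact ⟨fun f g => h.herm f.2 g.2, fun f => h.nonneg f.2⟩

lemma ASesq_self_re (f : Field P.Ω) : (P.ASesq f f).re =
    (P.aSesq f f).re + P.shiftConst * (P.epsSesq f f).re := by
  rw [ASesq_apply, Complex.add_re, Complex.re_ofReal_mul]

lemma ASesq_isHermPos : IsHermPos P.ASesq where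
  herm f g := by
    rw [ASesq_apply, ASesq_apply, star_add, star_mul', P.aSesq_isHermPos.herm,
      P.epsSesq_isHermPos.herm, Complex.star_def, Complex.conj_ofReal]
  nonneg f := by
    rw [ASesq_self_re]
    exact add_nonneg (P.aSesq_isHermPos.nonneg f)
      (mul_nonneg P.shiftConst_pos.le (P.epsSesq_isHermPos.nonneg f))

lemma normEps_le (f : Field P.Ω) : P.normEps f ≤ P.Cbar⁻¹ * P.normA f := by
  have h1 : P.shiftConst * (P.epsSesq f f).re ≤ (P.ASesq f f).re := by
    rw [ASesq_self_re]
    linarith [P.aSesq_isHermPos.nonneg f]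
  have h2 := Real.sqrt_le_sqrt h1
  rw [Real.sqrt_mul P.shiftConst_pos.le] at h2
  have h3 : 0 < P.Cbar := Real.sqrt_pos.2 P.shiftConst_pos
  rw [← div_eq_inv_mul, le_div_iff₀ h3, mul_comm]
  exact h2

lemma eq_zero_of_eps_eq_zero {f : Field P.Ω} (hf : f ∈ H0curl P.Ω)
    (h : (P.epsSesq f f).re = 0) : f = 0 := by
  refine H0curl.eq_zero_of_fst_eq_zero P.isOpen hf ?_
  have h1 : P.β * ‖f.1‖ ^ 2 ≤ (P.epsSesq f f).re :=
    coefficientForm_lower P.ε_bounded P.ε_lower f.1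
  have h2 := P.β_pos
  have h3 : ‖f.1‖ ^ 2 = 0 := by nlinarith [sq_nonneg ‖f.1‖]
  simpa using h3

/-! ### Counting eigenvalues by the ranks of spans -/

section NthEigenvalue

variable {P} {W : Set (Field P.Ω)}

lemma IsEigenfunction.smul {W : Submodule ℂ (Field P.Ω)} {s : ℝ} {f : Field P.Ω}
    (h : P.IsEigenfunction W s f) {c : ℂ} (hc : c ≠ 0) : P.IsEigenfunction W s (c • f) := by
  refine ⟨W.smul_mem c h.1, smul_ne_zero hc h.2.1, fun v hv => ?_⟩
  have := h.2.2 v hv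
  rw [aForm_eq, epsForm_eq] at this ⊢
  rw [map_smul, map_smul, LinearMap.smul_apply, LinearMap.smul_apply, this, smul_eq_mul,
    smul_eq_mul]
  ring

lemma IsEigenfunction.nonneg {s : ℝ} {f : Field P.Ω} (h : P.IsEigenfunction W s f)
    (hW : W ⊆ H0curl P.Ω) : 0 ≤ s := by
  have h1 := congrArg Complex.re (h.2.2 f h.1)
  rw [aForm_eq, epsForm_eq, Complex.re_ofReal_mul] at h1
  have h2 := P.aSesq_isHermPos.nonneg f
  have h3 := P.epsSesq_isHermPos.nonneg f
  have h4 : (P.epsSesq f f).re ≠ 0 := fun h0 => h.2.1 (P.eq_zero_of_eps_eq_zero (hW h.1) h0)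
  by_contra! hs
  have : 0 < (P.epsSesq f f).re := lt_of_le_of_ne h3 (Ne.symm h4)
  nlinarith

lemma IsEigenfunction.eps_eq_zero {s t : ℝ} {f g : Field P.Ω} (hf : P.IsEigenfunction W s f)
    (hg : P.IsEigenfunction W t g) (hst : s ≠ t) : P.epsSesq f g = 0 := by
  have h1 := hf.2.2 g hg.1
  have h2 := congrArg star (hg.2.2 f hf.1)
  rw [aForm_eq, epsForm_eq] at h1 h2
  rw [star_mul', P.aSesq_isHermPos.herm, P.epsSesq_isHermPos.herm, Complex.star_def,
    Complex.conj_ofReal] at h2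
  have h3 : ((s - t : ℝ) : ℂ) * P.epsSesq f g = 0 := by
    push_cast
    linear_combination h2 - h1
  exact (mul_eq_zero.1 h3).resolve_left (Complex.ofReal_ne_zero.2 (sub_ne_zero.2 hst))

/-- Without an eigenfunction at `s`, the families strictly below and up to `s` would coincide, and
so would the two ranks. -/
lemma IsNthEigenvalue.exists_eigenfunction {j : ℕ} {s : ℝ} (h : P.IsNthEigenvalue W j s) :
    ∃ f, P.IsEigenfunction W s f := by
  by_contra! hn
  have : {f | ∃ t ≤ s, P.IsEigenfunction W t f} ⊆ {f | ∃ t < s, P.IsEigenfunction W t f} := by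
    rintro f ⟨t, ht, hf⟩
    refine ⟨t, lt_of_le_of_ne ht ?_, hf⟩
    rintro rfl
    exact hn f hf
  exact absurd (h.2.trans (Submodule.rank_mono (Submodule.span_mono this))) (not_le.2 h.1)

lemma IsNthEigenvalue.mono {i j : ℕ} {s t : ℝ} (hs : P.IsNthEigenvalue W i s)
    (ht : P.IsNthEigenvalue W j t) (hij : i ≤ j) : s ≤ t := by
  by_contra! h
  have h1 : {f | ∃ u ≤ t, P.IsEigenfunction W u f} ⊆ {f | ∃ u < s, P.IsEigenfunction W u f} := by
    rintro f ⟨u, hu, hf⟩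
    exact ⟨u, hu.trans_lt h, hf⟩
  have h2 := (ht.2.trans (Submodule.rank_mono (Submodule.span_mono h1))).trans_lt hs.1
  exact absurd (Nat.cast_lt.1 h2) (not_lt.2 hij)

lemma IsNthEigenvalue.of_between {i j k : ℕ} {s : ℝ} (hi : P.IsNthEigenvalue W i s)
    (hk : P.IsNthEigenvalue W k s) (hij : i ≤ j) (hjk : j ≤ k) : P.IsNthEigenvalue W j s :=
  ⟨hi.1.trans_le (Nat.cast_le.2 hij), (Nat.cast_le.2 hjk).trans hk.2⟩

end NthEigenvalue

/-! ### Indices of eigenvalues in finite dimension -/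

section FiniteDimensional

variable {P} {W : Submodule ℂ (Field P.Ω)}

lemma span_eigenfunctions_le (p : ℝ → Prop) :
    Submodule.span ℂ {f | ∃ t, p t ∧ P.IsEigenfunction W t f} ≤ W :=
  Submodule.span_le.2 fun _ ⟨_, _, hf⟩ => hf.1

variable [FiniteDimensional ℂ W]

lemma rank_span_eigenfunctions (p : ℝ → Prop) :
    Module.rank ℂ (Submodule.span ℂ {f | ∃ t, p t ∧ P.IsEigenfunction W t f}) =
      (Module.finrank ℂ (Submodule.span ℂ {f | ∃ t, p t ∧ P.IsEigenfunction W t f}) :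
        Cardinal) := by
  have : FiniteDimensional ℂ (Submodule.span ℂ {f | ∃ t, p t ∧ P.IsEigenfunction W t f}) :=
    Submodule.finiteDimensional_of_le (span_eigenfunctions_le p)
  exact (Module.finrank_eq_rank ℂ _).symm

/-- An eigenfunction for `s` is ε-orthogonal to those for smaller values, so the span grows strictly
at `s`. The first index occupied by `s` is one more than the dimension strictly below it. -/
lemma IsEigenfunction.exists_isNthEigenvalue (hW : W ≤ H0curl P.Ω) {s : ℝ} {f : Field P.Ω}
    (hf : P.IsEigenfunction W s f) : ∃ j, 1 ≤ j ∧ P.IsNthEigenvalue W j s := by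
  have hle : {f | ∃ t < s, P.IsEigenfunction (W : Set (Field P.Ω)) t f} ⊆
      {f | ∃ t ≤ s, P.IsEigenfunction (W : Set (Field P.Ω)) t f} := by
    rintro f ⟨t, ht, hf⟩
    exact ⟨t, ht.le, hf⟩
  have hnot : f ∉ Submodule.span ℂ {f | ∃ t < s, P.IsEigenfunction (W : Set (Field P.Ω)) t f} := by
    intro hmem
    have hle : Submodule.span ℂ {f | ∃ t < s, P.IsEigenfunction (W : Set (Field P.Ω)) t f} ≤
        LinearMap.ker (P.epsSesq.flip f) :=
      Submodule.span_le.2 fun g ⟨t, ht, hg⟩ => hg.eps_eq_zero hf ht.ne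
    have h0 : P.epsSesq f f = 0 := hle hmem
    exact hf.2.1 (P.eq_zero_of_eps_eq_zero (hW hf.1) (by rw [h0, Complex.zero_re]))
  have hlt : Submodule.span ℂ {f | ∃ t < s, P.IsEigenfunction (W : Set (Field P.Ω)) t f} <
      Submodule.span ℂ {f | ∃ t ≤ s, P.IsEigenfunction (W : Set (Field P.Ω)) t f} := by
    refine lt_of_le_of_ne (Submodule.span_mono hle) fun h => hnot ?_
    rw [h]
    exact Submodule.subset_span ⟨s, le_rfl, hf⟩
  have : FiniteDimensional ℂ
      (Submodule.span ℂ {f | ∃ t ≤ s, P.IsEigenfunction (W : Set (Field P.Ω)) t f}) :=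
    Submodule.finiteDimensional_of_le (span_eigenfunctions_le (· ≤ s))
  have hfin := Submodule.finrank_lt_finrank_of_lt hlt
  refine ⟨Module.finrank ℂ (Submodule.span ℂ
    {f | ∃ t < s, P.IsEigenfunction (W : Set (Field P.Ω)) t f}) + 1, by omega, ?_, ?_⟩
  · rw [rank_span_eigenfunctions (· < s)]
    exact Nat.cast_lt.2 (Nat.lt_succ_self _)
  · rw [rank_span_eigenfunctions (· ≤ s)]
    exact Nat.cast_le.2 hfin

lemma finite_eigenvalues (hW : W ≤ H0curl P.Ω) :
    {s | ∃ f, P.IsEigenfunction (W : Set (Field P.Ω)) s f}.Finite := by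
  obtain ⟨n, b, s, hb, ho, hspan, heig⟩ := exists_eigenbasis P.epsSesq_isHermPos
    P.aSesq_isHermPos W fun x hx h => P.eq_zero_of_eps_eq_zero (hW hx) h
  refine (Set.finite_range s).subset ?_
  rintro t ⟨f, hf⟩
  by_contra hn
  have h1 : ∀ i, P.epsSesq (b i) f = 0 := fun i => by
    have h2 : P.IsEigenfunction (W : Set (Field P.Ω)) (s i) (b i) := by
      refine ⟨hb i, fun h0 => ?_, fun v hv => heig i v hv⟩
      have := ho i i
      simp [h0] at this
    exact h2.eps_eq_zero hf fun h => hn ⟨i, h⟩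
  have h3 : Submodule.span ℂ (Set.range b) ≤ LinearMap.ker (P.epsSesq.flip f) :=
    Submodule.span_le.2 (by rintro _ ⟨i, rfl⟩; exact h1 i)
  have h0 : P.epsSesq f f = 0 := h3 (hspan ▸ hf.1)
  exact hf.2.1 (P.eq_zero_of_eps_eq_zero (hW hf.1) (by rw [h0, Complex.zero_re]))

/-- The i-th eigenvalue is the least one at which the count reaches i. If the count strictly below
it already reached i, the largest smaller eigenvalue would do as well; finiteness of the spectrum
provides both extrema. -/
lemma IsNthEigenvalue.exists_le (hW : W ≤ H0curl P.Ω) {i j : ℕ} {s : ℝ}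
    (h : P.IsNthEigenvalue W j s) (hi : 1 ≤ i) (hij : i ≤ j) :
    ∃ t ≤ s, P.IsNthEigenvalue W i t := by
  let S : Set ℝ := {t | t ≤ s ∧ (∃ f, P.IsEigenfunction (W : Set (Field P.Ω)) t f) ∧
    (i : Cardinal) ≤ Module.rank ℂ (Submodule.span ℂ
      {f | ∃ u ≤ t, P.IsEigenfunction (W : Set (Field P.Ω)) u f})}
  have hS : S.Finite := (finite_eigenvalues hW).subset fun t ht => ht.2.1
  obtain ⟨t, ht, hmin⟩ := Set.exists_min_image S id hS
    ⟨s, le_rfl, h.exists_eigenfunction, (Nat.cast_le.2 hij).trans h.2⟩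
  refine ⟨t, ht.1, ?_, ht.2.2⟩
  by_contra! hge
  have hne : {u | u < t ∧ ∃ f, P.IsEigenfunction (W : Set (Field P.Ω)) u f}.Nonempty := by
    by_contra hemp
    have : {f | ∃ u < t, P.IsEigenfunction (W : Set (Field P.Ω)) u f} = ∅ := by
      refine Set.eq_empty_iff_forall_notMem.2 fun f ⟨u, hu, hf⟩ => hemp ⟨u, hu, f, hf⟩
    rw [this, Submodule.span_empty, rank_bot] at hge
    have : i = 0 := by exact_mod_cast le_antisymm hge zero_le
    omega
  obtain ⟨v, hv, hmax⟩ := Set.exists_max_image _ id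
    ((finite_eigenvalues hW).subset fun u (hu : u < t ∧ _) => hu.2) hne
  have hv' : v ∈ S := by
    refine ⟨hv.1.le.trans ht.1, hv.2, hge.trans (Submodule.rank_mono (Submodule.span_mono ?_))⟩
    rintro f ⟨u, hu, hf⟩
    exact ⟨u, hmax u ⟨hu, f, hf⟩, hf⟩
  exact absurd (hmin v hv') (not_le.2 hv.1)

end FiniteDimensional

/-! ### A basis of eigenfunctions and gradients -/

section DiscreteBasis

variable {P} {r : ℕ} {T : Mesh P.Ω}

variable (P r T) in
/-- The space of discrete gradients. -/
def gradSub : Submodule ℂ (Field P.Ω) :=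
  Submodule.span ℂ {f | ∃ p ∈ P.U r T, f = (p.2, 0)}

variable (P r T) in
/-- The discretely divergence-free space as a submodule. -/
def XhSub : Submodule ℂ (Field P.Ω) where
  carrier := P.Xh r T
  zero_mem' := ⟨zero_mem (P.VSub r T), fun p _ => by
    change P.epsL2 0 p.2 = 0
    simp⟩
  add_mem' := by
    rintro f g ⟨hf, hf'⟩ ⟨hg, hg'⟩
    refine ⟨(P.VSub r T).add_mem hf hg, fun p hp => ?_⟩
    have h1 : P.epsL2 f.1 p.2 = 0 := hf' p hp
    have h2 : P.epsL2 g.1 p.2 = 0 := hg' p hp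
    change P.epsL2 (f.1 + g.1) p.2 = 0
    rw [map_add, LinearMap.add_apply, h1, h2, add_zero]
  smul_mem' := by
    rintro c f ⟨hf, hf'⟩
    refine ⟨(P.VSub r T).smul_mem c hf, fun p hp => ?_⟩
    have h1 : P.epsL2 f.1 p.2 = 0 := hf' p hp
    change P.epsL2 (c • f.1) p.2 = 0
    rw [map_smul, LinearMap.smul_apply, h1, smul_zero]

lemma XhSub_le_VSub : P.XhSub r T ≤ P.VSub r T := fun _ hf => hf.1

lemma gradSub_le_VSub : P.gradSub r T ≤ P.VSub r T :=
  Submodule.span_le.2 (by rintro _ ⟨p, hp, rfl⟩; exact P.gradient_mem_V hp)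

lemma VSub_le_H0curl : P.VSub r T ≤ H0curl P.Ω := fun _ hf => hf.1

lemma XhSub_le_H0curl : P.XhSub r T ≤ H0curl P.Ω := XhSub_le_VSub.trans VSub_le_H0curl

instance : FiniteDimensional ℂ (P.XhSub r T) := Submodule.finiteDimensional_of_le XhSub_le_VSub

instance : FiniteDimensional ℂ (P.gradSub r T) :=
  Submodule.finiteDimensional_of_le gradSub_le_VSub

lemma gradSub_snd {g : Field P.Ω} (hg : g ∈ P.gradSub r T) : g.2 = 0 := by
  have : P.gradSub r T ≤ LinearMap.ker (LinearMap.snd ℂ (VecL2 P.Ω d) (VecL2 P.Ω (d.choose 2))) :=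
    Submodule.span_le.2 (by rintro _ ⟨p, hp, rfl⟩; rfl)
  exact this hg

lemma aSesq_gradSub {g : Field P.Ω} (hg : g ∈ P.gradSub r T) (f : Field P.Ω) :
    P.aSesq f g = 0 := by
  change coefficientForm P.μ_inv_bounded f.2 g.2 = 0
  rw [gradSub_snd hg, map_zero]

lemma mem_XhSub_iff {f : Field P.Ω} : f ∈ P.XhSub r T ↔
    f ∈ P.VSub r T ∧ ∀ g ∈ P.gradSub r T, P.epsSesq f g = 0 := by
  refine ⟨fun h => ⟨h.1, fun g hg => ?_⟩, fun h => ⟨h.1, fun p hp => ?_⟩⟩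
  · have : P.gradSub r T ≤ LinearMap.ker (P.epsSesq f) :=
      Submodule.span_le.2 (by rintro _ ⟨p, hp, rfl⟩; exact h.2 p hp)
    exact this hg
  · exact h.2 (p.2, 0) (Submodule.subset_span ⟨p, hp, rfl⟩)

variable (P r T) in
/-- An orthonormal basis of the edge element space that consists of discrete Maxwell
eigenfunctions and of discrete gradients. -/
lemma exists_discrete_eigenbasis : ∃ (n m : ℕ) (b : Fin n ⊕ Fin m → Field P.Ω)
    (s : Fin n ⊕ Fin m → ℝ), (∀ i, b i ∈ P.V r T) ∧
    (∀ i j, P.epsSesq (b i) (b j) = if i = j then 1 else 0) ∧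
    (∀ i j, P.aSesq (b i) (b j) = if i = j then (s i : ℂ) else 0) ∧
    (∀ v ∈ P.V r T, ∃ c : Fin n ⊕ Fin m → ℂ, v = ∑ i, c i • b i) ∧
    (∀ v ∈ P.Xh r T, ∀ i, P.epsSesq v (b (Sum.inr i)) = 0) ∧
    (∀ i, P.IsEigenfunction (P.Xh r T) (s (Sum.inl i)) (b (Sum.inl i))) ∧
    ∀ i, s (Sum.inr i) = 0 := by
  obtain ⟨n, bX, s, hbX, hoX, hspX, heX⟩ := exists_eigenbasis P.epsSesq_isHermPos
    P.aSesq_isHermPos (P.XhSub r T) fun x hx h => P.eq_zero_of_eps_eq_zero (XhSub_le_H0curl hx) h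
  -- Only orthonormality is kept here: `a` vanishes on gradients, so all their eigenvalues are 0.
  obtain ⟨m, bG, -, hbG, hoG, hspG, -⟩ := exists_eigenbasis P.epsSesq_isHermPos
    P.aSesq_isHermPos (P.gradSub r T) fun x hx h =>
      P.eq_zero_of_eps_eq_zero (VSub_le_H0curl (gradSub_le_VSub hx)) h
  have hXG : ∀ i j, P.epsSesq (bX i) (bG j) = 0 := fun i j =>
    (mem_XhSub_iff.1 (hbX i)).2 _ (hbG j)
  have hGX : ∀ i j, P.epsSesq (bG j) (bX i) = 0 := fun i j => by
    rw [← P.epsSesq_isHermPos.herm, hXG, star_zero]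
  have haG : ∀ f j, P.aSesq (bG j) f = 0 := fun f j => by
    rw [← P.aSesq_isHermPos.herm, aSesq_gradSub (hbG j), star_zero]
  refine ⟨n, m, Sum.elim bX bG, Sum.elim s 0, ?_, ?_, ?_, ?_, ?_, ?_, fun i => rfl⟩
  · rintro (i | j)
    · exact (hbX i).1
    · exact gradSub_le_VSub (hbG j)
  · rintro (i | i) (j | j) <;> simp [hoX, hoG, hXG, hGX]
  · rintro (i | i) (j | j)
    · simp only [Sum.elim_inl, heX i _ (hbX j), hoX, Sum.inl.injEq]
      split_ifs <;> simp
    · simp [aSesq_gradSub (hbG j)]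
    · simp [haG]
    · simp [haG]
  · intro v hv
    -- The discrete Helmholtz splitting: removing the ε-projection onto the discrete gradients
    -- leaves an element of `X_h`.
    have hx : v - ∑ j, P.epsSesq v (bG j) • bG j ∈ P.XhSub r T := by
      refine mem_XhSub_iff.2 ⟨Submodule.sub_mem _ hv (Submodule.sum_mem _ fun j _ =>
        Submodule.smul_mem _ _ (gradSub_le_VSub (hbG j))), fun g hg => ?_⟩
      have hle : P.gradSub r T ≤
          LinearMap.ker (P.epsSesq (v - ∑ j, P.epsSesq v (bG j) • bG j)) := by
        rw [hspG, Submodule.span_le]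
        rintro _ ⟨i, rfl⟩
        change P.epsSesq (v - ∑ j, P.epsSesq v (bG j) • bG j) (bG i) = 0
        simp [LinearMap.sum_apply, hoG]
      exact hle hg
    rw [hspX] at hx
    obtain ⟨c, hc⟩ := (Submodule.mem_span_range_iff_exists_fun ℂ).1 hx
    refine ⟨Sum.elim c fun j => P.epsSesq v (bG j), ?_⟩
    simp only [Fintype.sum_sum_type, Sum.elim_inl, Sum.elim_inr, hc, sub_add_cancel]
  · exact fun v hv i => (mem_XhSub_iff.1 (show v ∈ P.XhSub r T from hv)).2 _ (hbG i)
  · intro i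
    refine ⟨hbX i, fun h0 => ?_, fun v hv => heX i v hv⟩
    have h0' : bX i = 0 := h0
    have := hoX i i
    simp [h0'] at this

end DiscreteBasis

end Problem

/-! ### Helmholtz splitting, exact eigenspaces and the error of discrete eigenvalues -/

namespace Problem

variable {d : ℕ} (P : Problem d)

lemma X_subset_H0curl : P.X ⊆ H0curl P.Ω := fun _ hf => hf.1

lemma epsL2_bound : ∃ C : ℝ, ∀ u v, ‖P.epsL2 u v‖ ≤ C * ‖u‖ * ‖v‖ := by
  obtain ⟨K, hK0, hK⟩ := coefficientForm_self_le P.ε_bounded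
  refine ⟨K, fun u v => (P.epsL2_isHermPos.norm_apply_le u v).trans ?_⟩
  have h : ∀ u, formNorm P.epsL2 u ≤ Real.sqrt K * ‖u‖ := fun u => by
    rw [← Real.sqrt_sq (norm_nonneg u), ← Real.sqrt_mul hK0]
    exact Real.sqrt_le_sqrt (hK u)
  calc formNorm P.epsL2 u * formNorm P.epsL2 v ≤ (Real.sqrt K * ‖u‖) * (Real.sqrt K * ‖v‖) :=
        mul_le_mul (h u) (h v) (formNorm_nonneg _) (by positivity)
    _ = (Real.sqrt K * Real.sqrt K) * ‖u‖ * ‖v‖ := by ring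
    _ = K * ‖u‖ * ‖v‖ := by rw [Real.mul_self_sqrt hK0]

/-- The splitting of a field into a divergence-free part and a limit of gradients. -/
lemma exists_helmholtz {v : Field P.Ω} (hv : v ∈ H0curl P.Ω) : ∃ x ∈ P.X, ∃ y : Field P.Ω,
    v = x + y ∧ y.2 = 0 ∧ ∀ f ∈ P.X, P.epsSesq f y = 0 := by
  -- Taking the L² closure avoids having to prove that the gradients form a closed space. Limits of
  -- gradients still have zero curl in `H0curl`, and are still ε-orthogonal to `X`.
  let K : Submodule ℂ (VecL2 P.Ω d) :=
    ((H10 P.Ω).map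
      (LinearMap.snd ℂ (Lp ℂ 2 (volume.restrict P.Ω)) (VecL2 P.Ω d))).topologicalClosure
  obtain ⟨C, hC⟩ := P.epsL2_bound
  obtain ⟨y, hy, hort⟩ := exists_projection_of_coercive P.epsL2_isHermPos P.β_pos
    (coefficientForm_lower P.ε_bounded P.ε_lower) hC K (Submodule.isClosed_topologicalClosure _) v.1
  have hKcurl : ∀ z ∈ K, ((z, 0) : Field P.Ω) ∈ H0curl P.Ω := by
    let L : VecL2 P.Ω d →L[ℂ] Field P.Ω := (ContinuousLinearMap.id ℂ _).prod 0
    have hle : K ≤ (H0curl P.Ω).comap L.toLinearMap := by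
      refine Submodule.topologicalClosure_minimal _ ?_
        ((Submodule.isClosed_topologicalClosure _).preimage L.continuous)
      rintro _ ⟨p, hp, rfl⟩
      exact H10.gradient_mem_H0curl hp
    exact fun z hz => hle hz
  refine ⟨v - (y, 0), ⟨sub_mem hv (hKcurl y hy), fun p hp => ?_⟩, (y, 0), by simp, rfl,
    fun f hf => ?_⟩
  · exact hort p.2 (Submodule.le_topologicalClosure _ ⟨p, hp, rfl⟩)
  · have hle : K ≤ LinearMap.ker (P.epsL2 f.1) := by
      refine Submodule.topologicalClosure_minimal _ ?_ ?_
      · rintro _ ⟨p, hp, rfl⟩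
        exact hf.2 p hp
      · have hcont : Continuous (P.epsL2 f.1) :=
          AddMonoidHomClass.continuous_of_bound (P.epsL2 f.1) (C * ‖f.1‖) (hC f.1)
        exact isClosed_singleton.preimage hcont
    exact hle hy

variable {P}

lemma M_le_H0curl (lam : ℝ) : P.M lam ≤ H0curl P.Ω :=
  Submodule.span_le.2 fun _ hf => hf.1.1

/-- The eigenvalue equation is only tested in `X`, but the other Helmholtz component of `v` is curl
free and ε-orthogonal to `X`, so it contributes to neither side. Discrete fields, which need not lie
in `X`, thereby become admissible test fields. -/
lemma aSesq_of_mem_M {lam : ℝ} {g v : Field P.Ω} (hg : g ∈ P.M lam) (hv : v ∈ H0curl P.Ω) :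
    P.aSesq g v = (lam : ℂ) * P.epsSesq g v := by
  obtain ⟨x, hx, y, rfl, hy, hort⟩ := P.exists_helmholtz hv
  have hle : P.M lam ≤ LinearMap.eqLocus (P.aSesq.flip (x + y))
      ((lam : ℂ) • P.epsSesq.flip (x + y)) := by
    refine Submodule.span_le.2 fun f hf => ?_
    change P.aSesq f (x + y) = (lam : ℂ) * P.epsSesq f (x + y)
    have h1 : P.aSesq f y = 0 := by
      change coefficientForm P.μ_inv_bounded f.2 y.2 = 0
      rw [hy, map_zero]
    rw [map_add, map_add, hort f hf.1, h1, add_zero, add_zero]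
    exact hf.2.2 x hx
  exact hle hg

lemma normA_sq_of_mem_M {lam : ℝ} {g : Field P.Ω} (hg : g ∈ P.M lam) :
    P.normA g ^ 2 = P.tl lam * P.normEps g ^ 2 := by
  rw [normA_eq, normEps_eq, P.ASesq_isHermPos.sq, P.epsSesq_isHermPos.sq, ASesq_self_re,
    aSesq_of_mem_M hg (M_le_H0curl _ hg), Complex.re_ofReal_mul, tl]
  ring

lemma normA_sq_of_isEigenfunction {W : Set (Field P.Ω)} {s : ℝ} {f : Field P.Ω}
    (hf : P.IsEigenfunction W s f) : P.normA f ^ 2 = P.tl s * P.normEps f ^ 2 := by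
  have h := hf.2.2 f hf.1
  rw [aForm_eq, epsForm_eq] at h
  rw [normA_eq, normEps_eq, P.ASesq_isHermPos.sq, P.epsSesq_isHermPos.sq, ASesq_self_re,
    h, Complex.re_ofReal_mul, tl]
  ring

lemma IsEigenfunction.normA_pos {W : Set (Field P.Ω)} (hW : W ⊆ H0curl P.Ω) {s : ℝ}
    {f : Field P.Ω} (hf : P.IsEigenfunction W s f) : 0 < P.normA f := by
  have h0 : P.normEps f ≠ 0 := fun h => hf.2.1 (P.eq_zero_of_eps_eq_zero (hW hf.1) (by
    rw [← P.epsSesq_isHermPos.sq, ← normEps_eq, h]; norm_num))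
  have h1 : 0 < P.normA f ^ 2 := by
    rw [normA_sq_of_isEigenfunction hf, tl]
    have := hf.nonneg hW
    have := P.shiftConst_pos
    positivity
  have h2 : 0 ≤ P.normA f := Real.sqrt_nonneg _
  exact lt_of_le_of_ne h2 fun h => by rw [← h] at h1; norm_num at h1

lemma normA_smul (c : ℂ) (f : Field P.Ω) : P.normA (c • f) = ‖c‖ * P.normA f :=
  formNorm_smul (B := P.ASesq) c f

lemma normEps_smul (c : ℂ) (f : Field P.Ω) : P.normEps (c • f) = ‖c‖ * P.normEps f :=
  formNorm_smul (B := P.epsSesq) c f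

lemma normA_inv_smul {f : Field P.Ω} (hf : 0 < P.normA f) :
    P.normA ((P.normA f : ℂ)⁻¹ • f) = 1 := by
  rw [normA_smul, norm_inv, Complex.norm_real, Real.norm_of_nonneg hf.le, inv_mul_cancel₀ hf.ne']

/-- The reciprocal of a shifted discrete eigenvalue is a second order approximation. -/
lemma abs_inv_tl_sub_le {W : Set (Field P.Ω)} (hW : W ⊆ H0curl P.Ω) {s lam η : ℝ}
    {f g : Field P.Ω} (hf : P.IsEigenfunction W s f) (hf1 : P.normA f = 1) (hg : g ∈ P.M lam)
    (hlam : 0 ≤ lam) (hη : P.normA (g - f) ≤ η) :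
    |(P.tl s)⁻¹ - (P.tl lam)⁻¹| ≤ η ^ 2 / P.shiftConst := by
  have hc := P.shiftConst_pos
  have hs := hf.nonneg hW
  have hts : 0 < P.tl s := by rw [tl]; linarith
  have htl : 0 < P.tl lam := by rw [tl]; linarith
  have hE : (P.epsSesq f f).re = (P.tl s)⁻¹ := by
    have h := normA_sq_of_isEigenfunction hf
    rw [hf1, normEps_eq, P.epsSesq_isHermPos.sq] at h
    rw [eq_comm, inv_eq_iff_eq_inv, eq_comm, inv_eq_iff_eq_inv, eq_comm]
    field_simp
    linarith
  have hfH := hW hf.1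
  have e1 := aSesq_of_mem_M hg hfH
  have e2 := aSesq_of_mem_M hg (M_le_H0curl _ hg)
  have e3 : P.aSesq f g = (lam : ℂ) * P.epsSesq f g := by
    rw [← P.aSesq_isHermPos.herm, e1, star_mul', P.epsSesq_isHermPos.herm, Complex.star_def,
      Complex.conj_ofReal]
  have e4 : P.aSesq f f = (s : ℂ) * P.epsSesq f f := hf.2.2 f hf.1
  -- The usual identity behind second order convergence: the difference of the eigenvalues is a
  -- quadratic form in g - f. No normalization of `g` is needed.
  have e5 : P.aSesq (g - f) (g - f) - (lam : ℂ) * P.epsSesq (g - f) (g - f) =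
      ((s - lam : ℝ) : ℂ) * P.epsSesq f f := by
    simp only [map_sub, LinearMap.sub_apply, e1, e2, e3, e4]
    push_cast
    ring
  have e6 := congrArg Complex.re e5
  rw [Complex.sub_re, Complex.re_ofReal_mul, Complex.re_ofReal_mul, hE] at e6
  have e7 := P.ASesq_self_re (g - f)
  rw [← P.ASesq_isHermPos.sq, ← normA_eq] at e7
  set x := P.normA (g - f) ^ 2
  set y := (P.epsSesq (g - f) (g - f)).re
  have hy : 0 ≤ y := P.epsSesq_isHermPos.nonneg _
  have ha : 0 ≤ (P.aSesq (g - f) (g - f)).re := P.aSesq_isHermPos.nonneg _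
  have hx : x ≤ η ^ 2 := pow_le_pow_left₀ (Real.sqrt_nonneg _) hη 2
  have key : 1 - P.tl lam * (P.tl s)⁻¹ = x - P.tl lam * y := by
    have h1 : P.tl s * (P.tl s)⁻¹ = 1 := mul_inv_cancel₀ hts.ne'
    have h2 : P.tl s = s + P.shiftConst := rfl
    have h3 : P.tl lam = lam + P.shiftConst := rfl
    rw [e7, ← h1, h2, h3]
    rw [h2] at e6
    linear_combination -e6
  -- The reciprocal difference is y - x/λ̃, a difference of two numbers in [0, η²β/γ], hence bounded
  -- by η²β/γ rather than by twice that.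
  have hid : (P.tl s)⁻¹ - (P.tl lam)⁻¹ = -((P.tl lam)⁻¹ * (x - P.tl lam * y)) := by
    rw [← key]
    field_simp
    ring
  have hmul : (P.tl lam)⁻¹ * (x - P.tl lam * y) = (P.tl lam)⁻¹ * x - y := by
    field_simp
  have hinv : (P.tl lam)⁻¹ ≤ P.shiftConst⁻¹ := by
    apply inv_anti₀ hc
    rw [tl]; linarith
  have hyx : y ≤ η ^ 2 / P.shiftConst := by
    rw [le_div_iff₀ hc]
    linarith
  have hxx : (P.tl lam)⁻¹ * x ≤ η ^ 2 / P.shiftConst := by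
    rw [div_eq_inv_mul]
    have : 0 ≤ x := sq_nonneg _
    gcongr
  have hx0 : 0 ≤ (P.tl lam)⁻¹ * x := mul_nonneg (by positivity) (sq_nonneg _)
  rw [hid, hmul, abs_neg, abs_le]
  constructor <;> linarith

lemma delta_nonneg (r : ℕ) (T : Mesh P.Ω) (lam : ℝ) : 0 ≤ P.delta r T lam := by
  -- In ℝ the supremum of an empty or unbounded set is 0, so no boundedness is required.
  refine Real.sSup_nonneg ?_
  rintro t ⟨f, -, -, rfl⟩
  refine Real.sInf_nonneg ?_
  rintro s ⟨v, -, rfl⟩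
  exact Real.sqrt_nonneg _

lemma EigenEstimates.abs_inv_tl_sub_le {r : ℕ} {T : Mesh P.Ω} {C3 lam s : ℝ}
    (hE : P.EigenEstimates r T C3 lam) (hs : P.Belongs r T lam s) (hlam : 0 ≤ lam) :
    |(P.tl s)⁻¹ - (P.tl lam)⁻¹| ≤ (C3 * P.delta r T lam) ^ 2 / P.shiftConst := by
  obtain ⟨j, -, hj⟩ := id hs
  obtain ⟨f, hf⟩ := hj.exists_eigenfunction
  have hXh : P.Xh r T ⊆ H0curl P.Ω := fun _ h => XhSub_le_H0curl (r := r) (T := T) h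
  have hpos := hf.normA_pos hXh
  have hf' : P.IsEigenfunction (P.XhSub r T : Set (Field P.Ω)) s f := hf
  have hne : (P.normA f : ℂ)⁻¹ ≠ 0 := inv_ne_zero (Complex.ofReal_ne_zero.2 hpos.ne')
  obtain ⟨g, hg, hgf⟩ := hE.1 s _ hs (hf'.smul hne) (normA_inv_smul hpos)
  exact Problem.abs_inv_tl_sub_le hXh (hf'.smul hne) (normA_inv_smul hpos) hg hlam hgf

end Problem

/-! ### The cluster and its separation from the other eigenvalues -/

namespace Problem

variable {d : ℕ} {P : Problem d}

variable (P) in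
/-- `lam k` is a positive eigenvalue of multiplicity `q` with the indices `k, …, k + q - 1`. -/
structure IsCluster (k q : ℕ) (lam : ℕ → ℝ) : Prop where
  one_le : 1 ≤ k
  one_le_mult : 1 ≤ q
  nth : ∀ j, 1 ≤ j → j ≤ k + q → P.IsNthEigenvalue P.X j (lam j)
  pos : 0 < lam k
  low : 2 ≤ k → lam (k - 1) < lam k
  mult : lam (k + q - 1) = lam k
  up : lam k < lam (k + q)

lemma rho_le {lam s : ℝ} {f : Field P.Ω} (hs : s ≠ lam) (hf : P.IsEigenfunction P.X s f) :
    P.rho lam ≤ |(P.tl s)⁻¹ - (P.tl lam)⁻¹| := by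
  refine csInf_le ⟨0, ?_⟩ ⟨s, hs, ⟨f, hf⟩, rfl⟩
  rintro t ⟨s, -, -, rfl⟩
  exact abs_nonneg _

lemma tl_pos {lam : ℝ} (h : 0 ≤ lam) : 0 < P.tl lam := add_pos_of_nonneg_of_pos h P.shiftConst_pos

lemma Cbar_pos : 0 < P.Cbar := Real.sqrt_pos.2 P.shiftConst_pos

lemma Cbar_sq : P.Cbar ^ 2 = P.shiftConst := Real.sq_sqrt P.shiftConst_pos.le

namespace IsCluster

variable {k q : ℕ} {lam : ℕ → ℝ}

lemma exists_eigenfunction {j : ℕ} (hj : 1 ≤ j) (hj' : j ≤ k + q) (h : P.IsCluster k q lam) :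
    ∃ f, P.IsEigenfunction P.X (lam j) f :=
  (h.nth j hj hj').exists_eigenfunction

lemma nonneg {j : ℕ} (hj : 1 ≤ j) (hj' : j ≤ k + q) (h : P.IsCluster k q lam) : 0 ≤ lam j := by
  obtain ⟨f, hf⟩ := h.exists_eigenfunction hj hj'
  exact hf.nonneg P.X_subset_H0curl

lemma nth_of_mem {j : ℕ} (hj : k ≤ j) (hj' : j < k + q) (h : P.IsCluster k q lam) :
    P.IsNthEigenvalue P.X j (lam k) := by
  have h1 := h.nth (k + q - 1) (by have := h.one_le; have := h.one_le_mult; omega) (by omega)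
  rw [h.mult] at h1
  exact (h.nth k h.one_le (by omega)).of_between h1 hj (by omega)

lemma index_lt {j : ℕ} (h : P.IsCluster k q lam) (hj : P.IsNthEigenvalue P.X j (lam k)) :
    j < k + q := by
  by_contra! hn
  exact absurd ((h.nth (k + q) (by have := h.one_le; omega) le_rfl).mono hj hn) (not_le.2 h.up)

lemma le_index {j : ℕ} (h : P.IsCluster k q lam) (hj : P.IsNthEigenvalue P.X j (lam k)) :
    k ≤ j := by
  by_contra! hn
  -- Index 0 is excluded by definition: no rank is smaller than 0.
  rcases Nat.eq_zero_or_pos j with rfl | hj0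
  · exact not_lt_zero (hj.1.trans_eq Nat.cast_zero)
  · exact absurd (hj.mono (h.nth (k - 1) (by omega) (by omega)) (by omega))
      (not_le.2 (h.low (by omega)))

lemma rho_le_low (h : P.IsCluster k q lam) (hk : 2 ≤ k) :
    P.rho (lam k) ≤ (P.tl (lam (k - 1)))⁻¹ - (P.tl (lam k))⁻¹ := by
  obtain ⟨f, hf⟩ := h.exists_eigenfunction (j := k - 1) (by omega) (by omega)
  have h1 := rho_le (h.low hk).ne hf
  have h2 : (P.tl (lam k))⁻¹ ≤ (P.tl (lam (k - 1)))⁻¹ :=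
    inv_anti₀ (tl_pos (h.nonneg (by omega) (by omega))) (by
      unfold tl; linarith [h.low hk])
  rwa [abs_of_nonneg (sub_nonneg.2 h2)] at h1

lemma rho_le_up (h : P.IsCluster k q lam) :
    P.rho (lam k) ≤ (P.tl (lam k))⁻¹ - (P.tl (lam (k + q)))⁻¹ := by
  obtain ⟨f, hf⟩ := h.exists_eigenfunction (j := k + q) (by have := h.one_le; omega) le_rfl
  have h1 := rho_le h.up.ne' hf
  have h2 : (P.tl (lam (k + q)))⁻¹ ≤ (P.tl (lam k))⁻¹ :=
    inv_anti₀ (tl_pos h.pos.le) (by unfold tl; linarith [h.up])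
  rwa [abs_sub_comm, abs_of_nonneg (sub_nonneg.2 h2)] at h1

lemma rho_le_inv (h : P.IsCluster k q lam) : P.rho (lam k) ≤ (P.tl (lam k))⁻¹ := by
  have h1 := h.rho_le_up
  have h2 : 0 < (P.tl (lam (k + q)))⁻¹ :=
    inv_pos.2 (tl_pos (h.nonneg (by have := h.one_le; omega) le_rfl))
  linarith

variable {C3 dl0 dl1 : ℝ}

/-- The threshold condition on `dl1` already bounds ρ below by a positive number, so no discreteness
of the exact spectrum is invoked. -/
lemma rho_pos (h : P.IsCluster k q lam) (hdl : P.Thresholds k q lam C3 dl0 dl1) :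
    0 < P.rho (lam k) := by
  have h1 := hdl.dl1_gap
  have h2 := hdl.dl1_pos
  have h3 := hdl.dl1_le
  have h4 : 0 < P.tl (lam k) := tl_pos h.pos.le
  have h5 : 0 < P.tl (lam k) - dl1 := by
    have := P.shiftConst_pos
    have := h.pos
    unfold tl
    linarith
  have : 0 < dl1 / ((P.tl (lam k) - dl1) * P.tl (lam k)) := by positivity
  linarith

/-- Since C₄(λ) = 4 λ̃² β/γ, enlarging the denominator in `dl0_gap` to λ̃² cancels λ̃ and leaves 4
(C₃ δ₀)² β/γ ≤ ρ/4. -/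
lemma sq_div_le (h : P.IsCluster k q lam) (hC3 : 0 < C3)
    (hdl : P.Thresholds k q lam C3 dl0 dl1) {j : ℕ} (hj : j ∈ ({k - 1, k, k + q} : Set ℕ))
    (hj0 : j ≠ 0) : (C3 * dl0) ^ 2 / P.shiftConst ≤ P.rho (lam k) / 16 := by
  have hjle : j ≤ k + q := by
    rcases hj with rfl | rfl | rfl <;> omega
  have ht : 0 < P.tl (lam j) := tl_pos (h.nonneg (by omega) hjle)
  have hc := P.shiftConst_pos
  have hlam := h.nonneg (j := j) (by omega) hjle
  have hd := hdl.dl0_pos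
  have hlt := hdl.dl0_lt j hj hj0
  have hgap := hdl.dl0_gap j hj hj0
  have hC4 : P.C4 (lam j) = 4 * P.tl (lam j) ^ 2 / P.shiftConst := by
    rw [C4, Cbar_sq, tl]
    field_simp
    ring
  have hC4pos : 0 < P.C4 (lam j) := by rw [hC4]; positivity
  have hden : 0 < P.tl (lam j) - P.C4 (lam j) * C3 * dl0 ^ 2 := sub_pos.2 hlt
  have h1 : P.C4 (lam j) * C3 ^ 2 * dl0 ^ 2 / (P.tl (lam j) * P.tl (lam j)) ≤
      P.rho (lam k) / 4 := by
    refine le_trans ?_ hgap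
    have : 0 ≤ P.C4 (lam j) * C3 * dl0 ^ 2 := by positivity
    gcongr
    linarith
  have h2 : P.C4 (lam j) * C3 ^ 2 * dl0 ^ 2 / (P.tl (lam j) * P.tl (lam j)) =
      4 * ((C3 * dl0) ^ 2 / P.shiftConst) := by
    rw [hC4]
    field_simp
  linarith

lemma inv_shift_sub_le (h : P.IsCluster k q lam) (hdl : P.Thresholds k q lam C3 dl0 dl1)
    {lam0 : ℝ} (h0 : |lam0 - lam k| ≤ dl1) :
    |(P.tl lam0)⁻¹ - (P.tl (lam k))⁻¹| ≤ P.rho (lam k) / 4 := by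
  have hc := P.shiftConst_pos
  have hp := h.pos
  have h1 := abs_le.1 h0
  have h2 := hdl.dl1_le
  have hl0 : 0 < P.tl lam0 := tl_pos (by linarith)
  have hlk : 0 < P.tl (lam k) := tl_pos hp.le
  refine le_trans ?_ hdl.dl1_gap
  have h3 : (P.tl lam0)⁻¹ - (P.tl (lam k))⁻¹ =
      (lam k - lam0) / (P.tl lam0 * P.tl (lam k)) := by
    rw [inv_sub_inv hl0.ne' hlk.ne']
    congr 1
    unfold tl
    ring
  have h4 : P.tl (lam k) - dl1 ≤ P.tl lam0 := by unfold tl; linarith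
  have h5 : 0 < P.tl (lam k) - dl1 := by unfold tl; linarith
  rw [h3, abs_div, abs_of_pos (mul_pos hl0 hlk), abs_sub_comm]
  have := hdl.dl1_pos
  gcongr

/-- The discrete eigenvalues belonging to the cluster and to its neighbours are close to the exact
ones. -/
lemma belongs_close (h : P.IsCluster k q lam) (hC3 : 0 < C3)
    (hdl : P.Thresholds k q lam C3 dl0 dl1) {r : ℕ} {T : Mesh P.Ω}
    (hE : ∀ j ∈ ({k - 1, k, k + q} : Set ℕ), j ≠ 0 → P.EigenEstimates r T C3 (lam j))
    (hδ : ∀ j ∈ ({k - 1, k, k + q} : Set ℕ), j ≠ 0 → P.delta r T (lam j) ≤ dl0)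
    {j : ℕ} (hj : j ∈ ({k - 1, k, k + q} : Set ℕ)) (hj0 : j ≠ 0) {s : ℝ}
    (hs : P.Belongs r T (lam j) s) :
    |(P.tl s)⁻¹ - (P.tl (lam j))⁻¹| ≤ P.rho (lam k) / 16 := by
  have hjle : j ≤ k + q := by
    rcases hj with rfl | rfl | rfl <;> omega
  refine ((hE j hj hj0).abs_inv_tl_sub_le hs (h.nonneg (by omega) hjle)).trans ?_
  refine le_trans ?_ (h.sq_div_le hC3 hdl hj hj0)
  have h1 := hδ j hj hj0
  have h2 := P.delta_nonneg r T (lam j)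
  have h3 := P.shiftConst_pos
  gcongr

end IsCluster

/-- A gap between reciprocals yields a relative gap. -/
lemma mul_le_abs_sub {x y c ρ : ℝ} (hx : 0 < x) (hcy : c ≤ y) (hy : 0 < y)
    (hρ : 0 ≤ ρ) (h : ρ ≤ |x⁻¹ - y⁻¹|) : ρ * c * x ≤ |x - y| := by
  have h1 : |x - y| = x * y * |x⁻¹ - y⁻¹| := by
    rw [inv_sub_inv hx.ne' hy.ne', abs_div, abs_of_pos (mul_pos hx hy), abs_sub_comm]
    field_simp
  rw [h1]
  calc ρ * c * x ≤ ρ * y * x := by gcongr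
    _ = x * y * ρ := by ring
    _ ≤ _ := by gcongr

lemma Xh_subset_H0curl (r : ℕ) (T : Mesh P.Ω) : P.Xh r T ⊆ H0curl P.Ω :=
  fun _ h => XhSub_le_H0curl (r := r) (T := T) h

namespace IsCluster

variable {k q : ℕ} {lam : ℕ → ℝ} {C3 dl0 dl1 : ℝ} {r : ℕ} {T : Mesh P.Ω}

/-- Otherwise `Mh` is zero, and a unit exact eigenfunction would have distance 1 from it. -/
lemma exists_belongs (h : P.IsCluster k q lam) (hC : C3 * P.delta r T (lam k) < 1)
    (hE : P.EigenEstimates r T C3 (lam k)) : ∃ s, P.Belongs r T (lam k) s := by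
  by_contra! hn
  obtain ⟨f, hf⟩ := h.exists_eigenfunction h.one_le (by omega)
  have hpos := hf.normA_pos P.X_subset_H0curl
  obtain ⟨g, hg, hgf⟩ := hE.2 ((P.normA f : ℂ)⁻¹ • f)
    (Submodule.smul_mem _ _ (Submodule.subset_span hf)) (normA_inv_smul hpos)
  have h0 : g = 0 := by
    have : {f | ∃ lamh, P.Belongs r T (lam k) lamh ∧ P.IsEigenfunction (P.Xh r T) lamh f} = ∅ :=
      Set.eq_empty_iff_forall_notMem.2 fun f ⟨s, hs, _⟩ => hn s hs
    rw [Mh, this, Submodule.span_empty] at hg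
    exact hg
  rw [h0, sub_zero, normA_inv_smul hpos] at hgf
  linarith

/-- A discrete eigenvalue either belongs to the cluster or is well separated from the shift. -/
lemma belongs_or_separated (h : P.IsCluster k q lam) (hC3 : 0 < C3)
    (hdl : P.Thresholds k q lam C3 dl0 dl1)
    (hE : ∀ j ∈ ({k - 1, k, k + q} : Set ℕ), j ≠ 0 → P.EigenEstimates r T C3 (lam j))
    (hδ : ∀ j ∈ ({k - 1, k, k + q} : Set ℕ), j ≠ 0 → P.delta r T (lam j) ≤ dl0)
    (hC : C3 * P.delta r T (lam k) < 1) {lam0 : ℝ} (h0 : |lam0 - lam k| ≤ dl1) {s : ℝ}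
    {f : Field P.Ω} (hf : P.IsEigenfunction (P.Xh r T) s f) :
    P.Belongs r T (lam k) s ∨
      P.rho (lam k) / 2 * P.shiftConst * (s + P.shiftConst) ≤ |s - lam0| := by
  have hW : P.XhSub r T ≤ H0curl P.Ω := XhSub_le_H0curl
  have hW' : P.Xh r T ⊆ H0curl P.Ω := Xh_subset_H0curl r T
  have hs := hf.nonneg hW'
  have hρ := h.rho_pos hdl
  have hk := h.one_le
  have hc := P.shiftConst_pos
  have hl0 : 0 ≤ lam0 := by
    have := abs_le.1 h0
    have := hdl.dl1_le
    have := h.pos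
    linarith
  have hsep : P.rho (lam k) / 2 ≤ |(P.tl s)⁻¹ - (P.tl lam0)⁻¹| →
      P.rho (lam k) / 2 * P.shiftConst * (s + P.shiftConst) ≤ |s - lam0| := fun hd => by
    have := mul_le_abs_sub (tl_pos hs)
      (show P.shiftConst ≤ P.tl lam0 by unfold tl; linarith) (tl_pos hl0) (by positivity) hd
    simpa only [tl, add_sub_add_right_eq_sub] using this
  have hshift := abs_le.1 (h.inv_shift_sub_le hdl h0)
  have hf' : P.IsEigenfunction (P.XhSub r T : Set (Field P.Ω)) s f := hf
  obtain ⟨j, hj1, hj⟩ := hf'.exists_isNthEigenvalue hW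
  have hpos : ∀ {t : ℝ} {i : ℕ}, P.IsNthEigenvalue (P.XhSub r T : Set (Field P.Ω)) i t →
      0 ≤ t := fun ht => by
    obtain ⟨g, hg⟩ := ht.exists_eigenfunction
    exact hg.nonneg hW'
  rcases lt_or_ge j k with hjk | hjk
  · right
    apply hsep
    -- The discrete cluster occupies some index at least k, so a discrete eigenvalue of index k - 1
    -- exists, and `s` does not exceed it.
    obtain ⟨t, i, hi, hi'⟩ := h.exists_belongs hC (hE k (by simp) (by have := h.one_le; omega))
    obtain ⟨t', -, ht'⟩ := IsNthEigenvalue.exists_le (W := P.XhSub r T) hW hi' (i := k - 1)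
      (by omega) (by have := h.le_index hi; omega)
    have hst : s ≤ t' := hj.mono ht' (by omega)
    have h1 := abs_le.1 (h.belongs_close hC3 hdl hE hδ (j := k - 1) (by simp) (by omega)
      ⟨k - 1, h.nth (k - 1) (by omega) (by omega), ht'⟩)
    have h2 : (P.tl t')⁻¹ ≤ (P.tl s)⁻¹ := inv_anti₀ (tl_pos hs) (by unfold tl; linarith)
    have h3 := h.rho_le_low (by omega)
    -- What remains of the gap is ρ - ρ/16 - ρ/4 ≥ ρ/2.
    refine le_trans ?_ (le_abs_self _)
    linarith [h1.1, hshift.2]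
  rcases lt_or_ge j (k + q) with hjq | hjq
  · left
    exact ⟨j, h.nth_of_mem hjk hjq, hj⟩
  · right
    apply hsep
    obtain ⟨t', hst, ht'⟩ := IsNthEigenvalue.exists_le (W := P.XhSub r T) hW hj (i := k + q)
      (by omega) hjq
    have h1 := abs_le.1 (h.belongs_close hC3 hdl hE hδ (j := k + q) (by simp) (by omega)
      ⟨k + q, h.nth (k + q) (by omega) le_rfl, ht'⟩)
    have h2 : (P.tl s)⁻¹ ≤ (P.tl t')⁻¹ := inv_anti₀ (tl_pos (hpos ht')) (by unfold tl; linarith)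
    have h3 := h.rho_le_up
    rw [abs_sub_comm]
    refine le_trans ?_ (le_abs_self _)
    linarith [h1.2, hshift.1]

/-- The discrete cluster has bounded size. -/
lemma card_le (h : P.IsCluster k q lam) (hC3 : 0 < C3)
    (hdl : P.Thresholds k q lam C3 dl0 dl1)
    (hE : ∀ j ∈ ({k - 1, k, k + q} : Set ℕ), j ≠ 0 → P.EigenEstimates r T C3 (lam j))
    (hδ : ∀ j ∈ ({k - 1, k, k + q} : Set ℕ), j ≠ 0 → P.delta r T (lam j) ≤ dl0)
    {ι : Type*} [DecidableEq ι] {b : ι → Field P.Ω} {s : ι → ℝ}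
    (ho : ∀ i j, P.epsSesq (b i) (b j) = if i = j then 1 else 0) (J : Finset ι)
    (hJ : ∀ i ∈ J, P.Belongs r T (lam k) (s i) ∧ P.IsEigenfunction (P.Xh r T) (s i) (b i)) :
    J.card ≤ k + q := by
  rcases J.eq_empty_or_nonempty with rfl | hne
  · simp
  obtain ⟨i0, hi0, hmax⟩ := J.exists_max_image s hne
  have hk := h.one_le
  set S := Submodule.span ℂ
    {f | ∃ t ≤ s i0, P.IsEigenfunction (P.XhSub r T : Set (Field P.Ω)) t f} with hS
  have hfin : FiniteDimensional ℂ S :=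
    Submodule.finiteDimensional_of_le (span_eigenfunctions_le (· ≤ s i0))
  -- If the span had dimension k + q, the largest cluster value would also be the (k+q)-th discrete
  -- eigenvalue. Its reciprocal would then be within ρ/16 of two numbers at least ρ apart.
  have hnot : ¬ ((k + q : ℕ) : Cardinal) ≤ Module.rank ℂ S := fun hge => by
    obtain ⟨j, hj, hj'⟩ := (hJ i0 hi0).1
    have hb : P.Belongs r T (lam (k + q)) (s i0) :=
      ⟨k + q, h.nth (k + q) (by omega) le_rfl,
        hj'.1.trans_le (Nat.cast_le.2 (h.index_lt hj).le), hge⟩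
    have h1 := abs_le.1 (h.belongs_close hC3 hdl hE hδ (j := k + q) (by simp) (by omega) hb)
    have h2 := abs_le.1 (h.belongs_close hC3 hdl hE hδ (j := k) (by simp) (by omega)
      (hJ i0 hi0).1)
    linarith [h.rho_le_up, h.rho_pos hdl]
  have hlt : Module.finrank ℂ S < k + q := by
    rw [← Module.finrank_eq_rank, Nat.cast_le] at hnot
    omega
  have hli : LinearIndependent ℂ fun i : J => (⟨b i, Submodule.subset_span
      ⟨s i, hmax i i.2, (hJ i i.2).2⟩⟩ : S) := by
    refine LinearIndependent.of_comp S.subtype ?_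
    rw [Fintype.linearIndependent_iff]
    intro c hc i
    have h1 : P.epsSesq (∑ j : J, c j • b j) (b i) = 0 := by
      rw [show ∑ j : J, c j • b j = 0 from hc, map_zero, LinearMap.zero_apply]
    simpa only [map_sum, LinearMap.sum_apply, map_smul, LinearMap.smul_apply, ho, smul_eq_mul,
      mul_ite, mul_one, mul_zero, ← Subtype.ext_iff, Finset.sum_ite_eq', Finset.mem_univ,
      if_true] using h1
  have := hli.fintype_card_le_finrank
  rw [Fintype.card_coe] at this
  omega

end IsCluster

end Problem

/-! ### The error of one step of the iteration -/

namespace Problem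

variable {d : ℕ} {P : Problem d} {k q : ℕ} {lam : ℕ → ℝ} {C3 dl0 dl1 : ℝ} {r : ℕ} {T : Mesh P.Ω}

lemma normA_nonneg (f : Field P.Ω) : 0 ≤ P.normA f := Real.sqrt_nonneg _

lemma normEps_nonneg (f : Field P.Ω) : 0 ≤ P.normEps f := Real.sqrt_nonneg _

/-- Every element of the discrete cluster space is a combination of the basis functions of the
cluster. -/
lemma eq_sum_of_mem_Mh {ι : Type*} [Fintype ι] [DecidableEq ι] {b : ι → Field P.Ω} {mu : ℝ}
    (ho : ∀ i j, P.epsSesq (b i) (b j) = if i = j then 1 else 0)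
    (hspan : ∀ v ∈ P.V r T, ∃ c : ι → ℂ, v = ∑ i, c i • b i) (J : Finset ι)
    (hJ : ∀ s f, P.Belongs r T mu s → P.IsEigenfunction (P.Xh r T) s f →
      ∀ i ∉ J, P.epsSesq f (b i) = 0) {f : Field P.Ω} (hf : f ∈ P.Mh r T mu) :
    f = ∑ i ∈ J, P.epsSesq f (b i) • b i := by
  let R : Field P.Ω →ₗ[ℂ] Field P.Ω := ∑ i ∈ J, (P.epsSesq.flip (b i)).smulRight (b i)
  have hR : ∀ x, R x = ∑ i ∈ J, P.epsSesq x (b i) • b i := fun x => by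
    simp [R, LinearMap.sum_apply]
  have hle : P.Mh r T mu ≤ LinearMap.eqLocus LinearMap.id R := by
    refine Submodule.span_le.2 ?_
    rintro x ⟨s, hs, hx⟩
    change x = R x
    obtain ⟨c, hc⟩ := hspan x hx.1.1
    have hc' : ∀ i, P.epsSesq x (b i) = c i := fun i => by
      rw [hc]
      simp only [map_sum, LinearMap.sum_apply, map_smul, LinearMap.smul_apply, ho, smul_eq_mul,
        mul_ite, mul_one, mul_zero, Finset.sum_ite_eq', Finset.mem_univ, if_true]
    rw [hR]
    conv_lhs => rw [hc]
    simp only [hc']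
    refine (Finset.sum_subset (Finset.subset_univ J) fun i _ hi => ?_).symm
    rw [← hc', hJ s x hs hx i hi, zero_smul]
  exact (hle hf).trans (hR f)

/-- Combinations of discrete eigenfunctions of the cluster are close to exact eigenfunctions. -/
lemma EigenEstimates.exists_near_sum {mu : ℝ} (hE : P.EigenEstimates r T C3 mu) {ι : Type*}
    [DecidableEq ι] {b : ι → Field P.Ω} {s : ι → ℝ}
    (hA : ∀ i j, P.ASesq (b i) (b j) = if i = j then ((s i + P.shiftConst : ℝ) : ℂ) else 0)
    (J : Finset ι)
    (hJ : ∀ i ∈ J, P.Belongs r T mu (s i) ∧ P.IsEigenfunction (P.Xh r T) (s i) (b i))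
    (c : ι → ℂ) : ∃ g ∈ P.M mu, P.normA (∑ i ∈ J, c i • b i - g) ≤
      J.card * (C3 * P.delta r T mu) * P.normA (∑ i ∈ J, c i • b i) := by
  have hb : ∀ i, ∃ g : Field P.Ω, i ∈ J → g ∈ P.M mu ∧
      P.normA (g - b i) ≤ P.normA (b i) * (C3 * P.delta r T mu) := fun i => by
    by_cases hi : i ∈ J
    · obtain ⟨h1, h2⟩ := hJ i hi
      have hpos := h2.normA_pos (Xh_subset_H0curl r T)
      have hne : (P.normA (b i) : ℂ) ≠ 0 := Complex.ofReal_ne_zero.2 hpos.ne'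
      have h2' : P.IsEigenfunction (P.XhSub r T : Set (Field P.Ω)) (s i) (b i) := h2
      obtain ⟨g, hg, hgf⟩ := hE.1 (s i) _ h1 (h2'.smul (inv_ne_zero hne)) (normA_inv_smul hpos)
      refine ⟨(P.normA (b i) : ℂ) • g, fun _ => ⟨Submodule.smul_mem _ _ hg, ?_⟩⟩
      have h3 : (P.normA (b i) : ℂ) • g - b i =
          (P.normA (b i) : ℂ) • (g - (P.normA (b i) : ℂ)⁻¹ • b i) := by
        rw [smul_sub, smul_inv_smul₀ hne]
      rw [h3, normA_smul, Complex.norm_real, Real.norm_of_nonneg hpos.le]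
      gcongr
    · exact ⟨0, fun h => absurd h hi⟩
  choose g hg using hb
  refine ⟨∑ i ∈ J, c i • g i,
    Submodule.sum_mem _ fun i hi => Submodule.smul_mem _ _ (hg i hi).1, ?_⟩
  have hx := formNorm_sq_sum_of_diagonal P.ASesq_isHermPos hA J c
  rw [← Finset.sum_sub_distrib]
  refine (P.ASesq_isHermPos.sum_le J _).trans ?_
  rw [mul_assoc, ← nsmul_eq_mul]
  refine Finset.sum_le_card_nsmul _ _ _ fun i hi => ?_
  rw [← smul_sub, formNorm_smul, formNorm_sub_comm, ← normA_eq]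
  have hs : ∀ i ∈ J, 0 ≤ (s i + P.shiftConst) * ‖c i‖ ^ 2 := fun i hi => by
    have := (hJ i hi).2.nonneg (Xh_subset_H0curl r T)
    have := P.shiftConst_pos
    positivity
  -- By A-orthogonality no single term exceeds the sum in norm, so the relative errors add up to at
  -- most the number of terms times C₃ δ.
  have h1 : ‖c i‖ * P.normA (b i) ≤ P.normA (∑ i ∈ J, c i • b i) := by
    refine (abs_le_of_sq_le_sq' ?_ (normA_nonneg _)).2
    rw [P.normA_eq (∑ i ∈ J, c i • b i), hx, mul_pow, normA_eq, P.ASesq_isHermPos.sq, hA,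
      if_pos rfl, Complex.ofReal_re, mul_comm]
    exact Finset.single_le_sum hs hi
  calc ‖c i‖ * P.normA (g i - b i) ≤ ‖c i‖ * (P.normA (b i) * (C3 * P.delta r T mu)) :=
        mul_le_mul_of_nonneg_left (hg i hi).2 (norm_nonneg _)
    _ = (‖c i‖ * P.normA (b i)) * (C3 * P.delta r T mu) := by ring
    _ ≤ P.normA (∑ i ∈ J, c i • b i) * (C3 * P.delta r T mu) := by
        rcases le_or_gt 0 (C3 * P.delta r T mu) with h | h
        · gcongr
        · exfalso
          have h2 := (normA_nonneg _).trans (hg i hi).2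
          have h3 := (hJ i hi).2.normA_pos (Xh_subset_H0curl r T)
          nlinarith
    _ = _ := mul_comm _ _

/-- The exact eigenfunction that the previous iterate approximates is close to the discrete
cluster space, and its discrete counterpart dominates the error of the previous iterate. -/
lemma exists_cluster_element (h : P.IsCluster k q lam) (hC3 : 0 < C3)
    (hdl : P.Thresholds k q lam C3 dl0 dl1) (hE : P.EigenEstimates r T C3 (lam k))
    (hδ : P.delta r T (lam k) ≤ dl0) {v ubar : Field P.Ω} (hv : P.normA v = 1)
    (hu : ubar ∈ P.M (lam k)) (hclose : P.normA (v - ubar) ≤ dl0) :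
    ∃ f ∈ P.Mh r T (lam k),
      P.normEps (v - f) ≤
        P.normEps (v - ubar) + 2 * P.Cbar⁻¹ * C3 * P.delta r T (lam k) ∧
      (6 * Real.sqrt (P.tl (lam k)))⁻¹ ≤ P.normEps f - P.normEps (v - f) := by
  have hc := P.shiftConst_pos
  have hCb : 0 < P.Cbar := Cbar_pos
  have htl : 0 < P.tl (lam k) := tl_pos h.pos.le
  have hst : 0 < Real.sqrt (P.tl (lam k)) := Real.sqrt_pos.2 htl
  have hst2 : Real.sqrt (P.tl (lam k)) ^ 2 = P.tl (lam k) := Real.sq_sqrt htl.le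
  have hd0 := hdl.dl0_pos
  have hδ0 := P.delta_nonneg r T (lam k)
  -- From the term 3δ₀ in `dl0_sum`. It keeps N = ‖ū‖_A between 5/6 and 2.
  have hd6 : dl0 ≤ 1 / 6 := by
    have h1 := hdl.dl0_sum
    have h2 : 0 < P.C4 (lam k) := by
      have := h.pos
      unfold C4
      positivity
    have h3 : 0 ≤ (P.Cbar ^ 2)⁻¹ * (3 * lam k + 2 * P.Cbar ^ 2) * dl0 := by
      have := h.pos
      positivity
    have h4 : 0 ≤ 3 * (P.Cbar ^ 2)⁻¹ * P.C4 (lam k) * dl0 ^ 2 := by positivity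
    have h5 : 0 < C3 * dl0 := by positivity
    linarith
  set N := P.normA ubar with hN
  have hN1 : 5 / 6 ≤ N := by
    have := P.ASesq_isHermPos.le_sub_add v ubar
    rw [← normA_eq, ← normA_eq, ← normA_eq, hv] at this
    linarith
  have hN2 : N ≤ 2 := by
    have := P.ASesq_isHermPos.le_sub_add ubar v
    rw [formNorm_sub_comm, ← normA_eq, ← normA_eq, ← normA_eq, hv] at this
    linarith
  have hN0 : 0 < N := by linarith
  have hNc : (N : ℂ) ≠ 0 := Complex.ofReal_ne_zero.2 hN0.ne'
  obtain ⟨f', hf', hgf⟩ := hE.2 ((N : ℂ)⁻¹ • ubar) (Submodule.smul_mem _ _ hu)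
    (normA_inv_smul hN0)
  have hdist : P.normA (ubar - (N : ℂ) • f') ≤ N * (C3 * P.delta r T (lam k)) := by
    have h1 : ubar - (N : ℂ) • f' = (N : ℂ) • ((N : ℂ)⁻¹ • ubar - f') := by
      rw [smul_sub, smul_inv_smul₀ hNc]
    rw [h1, normA_smul, Complex.norm_real, Real.norm_of_nonneg hN0.le]
    gcongr
  have hdistE : P.normEps (ubar - (N : ℂ) • f') ≤ P.Cbar⁻¹ * (N * (C3 * P.delta r T (lam k))) :=
    (P.normEps_le _).trans (by gcongr)
  have htri : P.normEps (v - (N : ℂ) • f') ≤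
      P.normEps (v - ubar) + P.normEps (ubar - (N : ℂ) • f') := by
    have := P.epsSesq_isHermPos.add_le (v - ubar) (ubar - (N : ℂ) • f')
    rwa [sub_add_sub_cancel] at this
  refine ⟨(N : ℂ) • f', Submodule.smul_mem _ _ hf', ?_, ?_⟩
  · have : P.Cbar⁻¹ * (N * (C3 * P.delta r T (lam k))) ≤
        P.Cbar⁻¹ * (2 * (C3 * P.delta r T (lam k))) := by gcongr
    linarith
  · have hue : P.normEps ubar = N * (Real.sqrt (P.tl (lam k)))⁻¹ := by
      have h1 := normA_sq_of_mem_M hu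
      rw [← hN, ← hst2, ← mul_pow] at h1
      have h2 := (sq_eq_sq₀ hN0.le (mul_nonneg hst.le (normEps_nonneg _))).1 h1
      rw [h2]
      field_simp
    have hue2 : P.normEps ubar ≤ P.normEps (ubar - (N : ℂ) • f') + P.normEps ((N : ℂ) • f') :=
      P.epsSesq_isHermPos.le_sub_add _ _
    -- Squared, this is (C₃ δ₀)² β/γ ≤ ρ/16 together with ρ ≤ 1/λ̃_k.
    have hq1 : P.Cbar⁻¹ * (C3 * dl0) ≤ 1 / 4 * (Real.sqrt (P.tl (lam k)))⁻¹ := by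
      refine (abs_le_of_sq_le_sq' ?_ (by positivity)).2
      have h1 := h.sq_div_le hC3 hdl (j := k) (by simp) (by have := h.one_le; omega)
      have h2 := h.rho_le_inv
      rw [mul_pow] at h1
      simp only [mul_pow, inv_pow, Cbar_sq, hst2]
      rw [← div_eq_inv_mul]
      linarith
    have hq2 : P.Cbar⁻¹ * dl0 ≤ 1 / 4 * (Real.sqrt (P.tl (lam k)))⁻¹ := by
      have h1 := hdl.dl0_le.trans (min_le_left _ _)
      rw [← div_eq_inv_mul, div_le_iff₀ hCb]
      refine h1.trans_eq ?_
      rw [mul_inv]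
      ring
    have hq3 : P.Cbar⁻¹ * (N * (C3 * P.delta r T (lam k))) ≤
        N * (1 / 4 * (Real.sqrt (P.tl (lam k)))⁻¹) := by
      refine le_trans ?_ (mul_le_mul_of_nonneg_left hq1 hN0.le)
      rw [mul_left_comm]
      gcongr
    have hq4 : P.normEps (v - ubar) ≤ 1 / 4 * (Real.sqrt (P.tl (lam k)))⁻¹ :=
      (P.normEps_le _).trans (le_trans (by gcongr) hq2)
    rw [mul_inv]
    have hy : 0 < (Real.sqrt (P.tl (lam k)))⁻¹ := inv_pos.2 hst
    set y := (Real.sqrt (P.tl (lam k)))⁻¹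
    -- The lower bound is N y - 2 (N y/4) - y/4 = (N/2 - 1/4) y, and N ≥ 5/6 makes it at least y/6.
    nlinarith

/-- The constant of the error estimate, up to a factor two. -/
def stepConst (P : Problem d) (k q : ℕ) (mu C3 dl0 dl1 : ℝ) : ℝ :=
  -- `K1` δ bounds the error of the discrete cluster eigenvalues, `K2` δ the ε-distance added by
  -- passing from ū to its discrete counterpart. `κ` is the relative separation off the cluster,
  -- from other eigenvalues and from gradients; `K3` comes from dividing the two bounds of
  -- `inverse_iteration`.
  let K1 := 2 * P.tl mu ^ 2 * C3 ^ 2 * dl0 / P.shiftConst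
  let K2 := 2 * P.Cbar⁻¹ * C3
  let κ := min (P.rho mu / 2 * P.shiftConst) (mu / (2 * P.shiftConst))
  let K3 := 6 * Real.sqrt (P.tl mu) / (κ * P.shiftConst)
  K3 * (1 + K2 * dl1 + K1 * (P.Cbar⁻¹ * dl0 + K2 * dl0)) + (k + q : ℕ) * C3

lemma stepConst_pos (h : P.IsCluster k q lam) (hC3 : 0 < C3)
    (hdl : P.Thresholds k q lam C3 dl0 dl1) : 0 < P.stepConst k q (lam k) C3 dl0 dl1 := by
  have hc := P.shiftConst_pos
  have hCb : 0 < P.Cbar := Cbar_pos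
  have htl : 0 < P.tl (lam k) := tl_pos h.pos.le
  have hd0 := hdl.dl0_pos
  have hd1 := hdl.dl1_pos
  have hρ := h.rho_pos hdl
  have hp := h.pos
  have hκ : 0 < min (P.rho (lam k) / 2 * P.shiftConst) (lam k / (2 * P.shiftConst)) :=
    lt_min (by positivity) (by positivity)
  unfold stepConst
  positivity

/-- The error of one step of shifted inverse iteration, before normalization. -/
lemma exists_near_solution (h : P.IsCluster k q lam) (hC3 : 0 < C3)
    (hdl : P.Thresholds k q lam C3 dl0 dl1)
    (hE : ∀ j ∈ ({k - 1, k, k + q} : Set ℕ), j ≠ 0 → P.EigenEstimates r T C3 (lam j))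
    (hδ : ∀ j ∈ ({k - 1, k, k + q} : Set ℕ), j ≠ 0 → P.delta r T (lam j) ≤ dl0)
    {lam0 : ℝ} (h0 : |lam0 - lam k| ≤ dl1) {w u v ubar : Field P.Ω} (hw : w ∈ P.V r T)
    (heq : ∀ z ∈ P.V r T, P.aForm w z - (lam0 : ℂ) * P.epsForm w.1 z.1 = P.epsForm u.1 z.1)
    (huv : u = 0 ∨ ∃ t : ℝ, 0 < t ∧ u = (t : ℂ) • v ∧ P.normA v = 1)
    (hu : ubar ∈ P.M (lam k)) (hclose : P.normA (v - ubar) ≤ dl0) :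
    ∃ g ∈ P.M (lam k), P.normA (w - g) ≤ P.stepConst k q (lam k) C3 dl0 dl1 *
      (|lam0 - lam k| * P.normEps (v - ubar) + P.delta r T (lam k)) * P.normA w := by
  classical
  have hk := h.one_le
  have hc := P.shiftConst_pos
  have hCb : 0 < P.Cbar := Cbar_pos
  have hp := h.pos
  have htl : 0 < P.tl (lam k) := tl_pos hp.le
  have hst : 0 < Real.sqrt (P.tl (lam k)) := Real.sqrt_pos.2 htl
  have hd0 := hdl.dl0_pos
  have hd1 := hdl.dl1_pos
  have hρ := h.rho_pos hdl
  have hEk := hE k (by simp) (by omega)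
  have hδk := hδ k (by simp) (by omega)
  have hCδ : C3 * P.delta r T (lam k) < 1 := by
    have h1 := hdl.dl0_sum
    have h2 : 0 < P.C4 (lam k) := by unfold C4; positivity
    have h3 : 0 ≤ (P.Cbar ^ 2)⁻¹ * (3 * lam k + 2 * P.Cbar ^ 2) * dl0 := by positivity
    have h4 : 0 ≤ 3 * (P.Cbar ^ 2)⁻¹ * P.C4 (lam k) * dl0 ^ 2 := by positivity
    have h5 : C3 * P.delta r T (lam k) ≤ C3 * dl0 := by gcongr
    linarith
  set D := P.delta r T (lam k) with hD
  have hD0 : 0 ≤ D := P.delta_nonneg r T (lam k)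
  set Ev := P.normEps (v - ubar) with hEv
  have hEv0 : 0 ≤ Ev := normEps_nonneg _
  have hEv1 : Ev ≤ P.Cbar⁻¹ * dl0 := (P.normEps_le _).trans (by gcongr)
  obtain ⟨n, m, b, s, hbV, ho, ha, hspan, hXG, hXeig, hGs⟩ := P.exists_discrete_eigenbasis r T
  let J : Finset (Fin n ⊕ Fin m) :=
    Finset.univ.filter fun i => i.isLeft = true ∧ P.Belongs r T (lam k) (s i)
  have hJ : ∀ i ∈ J, P.Belongs r T (lam k) (s i) ∧ P.IsEigenfunction (P.Xh r T) (s i) (b i) := by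
    rintro (i | i) hi
    · exact ⟨(Finset.mem_filter.1 hi).2.2, hXeig i⟩
    · simp [J] at hi
  have hJout : ∀ t f, P.Belongs r T (lam k) t → P.IsEigenfunction (P.Xh r T) t f →
      ∀ i ∉ J, P.epsSesq f (b i) = 0 := by
    rintro t f ht hf (i | i) hi
    · refine hf.eps_eq_zero (hXeig i) fun hts => hi ?_
      simp only [J, Finset.mem_filter, Finset.mem_univ, Sum.isLeft_inl, true_and]
      rwa [← hts]
    · exact hXG f hf.1 i
  have hcard : J.card ≤ k + q := h.card_le hC3 hdl hE hδ ho J hJ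
  have hA : ∀ i j, P.ASesq (b i) (b j) =
      if i = j then ((s i + P.shiftConst : ℝ) : ℂ) else 0 := fun i j => by
    rw [ASesq_apply, ho, ha]
    split_ifs <;> push_cast <;> ring
  set K1 := 2 * P.tl (lam k) ^ 2 * C3 ^ 2 * dl0 / P.shiftConst with hK1
  set K2 := 2 * P.Cbar⁻¹ * C3 with hK2
  set κ := min (P.rho (lam k) / 2 * P.shiftConst) (lam k / (2 * P.shiftConst)) with hκdef
  set K3 := 6 * Real.sqrt (P.tl (lam k)) / (κ * P.shiftConst) with hK3
  have hκ : 0 < κ := lt_min (by positivity) (by positivity)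
  have hK1pos : 0 < K1 := by positivity
  have hK2pos : 0 < K2 := by positivity
  have hK3pos : 0 < K3 := by positivity
  set θ := |lam0 - lam k| + K1 * D with hθ
  have hθ0 : 0 ≤ θ := by positivity
  have hout : ∀ i ∉ J, κ * (s i + P.shiftConst) ≤ |s i - lam0| := by
    rintro (i | i) hi
    · have hs0 := (hXeig i).nonneg (Xh_subset_H0curl r T)
      rcases h.belongs_or_separated hC3 hdl hE hδ hCδ h0 (hXeig i) with hb | hb
      · exact absurd (by simpa [J] using hb) hi
      · refine le_trans ?_ hb
        gcongr
        exact min_le_left _ _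
    -- For gradients the distance to the shift is λ₀ itself, at least λ_k/2.
    · rw [hGs, zero_add, zero_sub, abs_neg]
      have h1 := abs_le.1 h0
      have h2 := hdl.dl1_le
      refine le_trans ?_ (le_abs_self _)
      calc κ * P.shiftConst ≤ lam k / (2 * P.shiftConst) * P.shiftConst := by
            gcongr
            exact min_le_right _ _
        _ = lam k / 2 := by field_simp
        _ ≤ lam0 := by linarith
  have hin : ∀ i ∈ J, |s i - lam0| ≤ θ := fun i hi => by
    obtain ⟨hb, he⟩ := hJ i hi
    have hs0 := he.nonneg (Xh_subset_H0curl r T)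
    have hts : 0 < P.tl (s i) := tl_pos hs0
    have h1 := hEk.abs_inv_tl_sub_le hb hp.le
    have h2 := abs_le.1 (h.belongs_close hC3 hdl hE hδ (j := k) (by simp) (by omega) hb)
    have h3 := h.rho_le_inv
    have h4 : P.tl (s i) ≤ 2 * P.tl (lam k) := by
      have h5 : (2 * P.tl (lam k))⁻¹ ≤ (P.tl (s i))⁻¹ := by
        rw [mul_inv]
        have : 0 < (P.tl (lam k))⁻¹ := inv_pos.2 htl
        linarith [h2.1]
      exact (inv_le_inv₀ (by positivity) hts).1 h5
    have h6 : |s i - lam k| = P.tl (s i) * P.tl (lam k) *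
        |(P.tl (s i))⁻¹ - (P.tl (lam k))⁻¹| := by
      rw [inv_sub_inv hts.ne' htl.ne', abs_div, abs_of_pos (mul_pos hts htl), abs_sub_comm]
      have : P.tl (lam k) - P.tl (s i) = lam k - s i := by unfold tl; ring
      rw [this]
      field_simp
    -- The error is quadratic in δ; one factor is traded for δ₀.
    have h7 : |s i - lam k| ≤ K1 * D := by
      rw [h6]
      calc P.tl (s i) * P.tl (lam k) * |(P.tl (s i))⁻¹ - (P.tl (lam k))⁻¹|
          ≤ 2 * P.tl (lam k) * P.tl (lam k) * ((C3 * D) ^ 2 / P.shiftConst) := by gcongr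
        _ = 2 * P.tl (lam k) ^ 2 * C3 ^ 2 * D / P.shiftConst * D := by ring
        _ ≤ K1 * D := by rw [hK1]; gcongr
    have h8 := abs_sub_le (s i) (lam k) lam0
    rw [abs_sub_comm (lam k)] at h8
    linarith
  obtain ⟨cw, hcw⟩ := hspan w hw
  have heq' : ∀ i, P.aSesq w (b i) - (lam0 : ℂ) * P.epsSesq w (b i) = P.epsSesq u (b i) :=
    fun i => heq (b i) (hbV i)
  set wJ := ∑ i ∈ J, cw i • b i with hwJ
  have hmain : P.normA (w - wJ) ≤ K3 * (θ * (Ev + K2 * D)) * P.normA w := by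
    -- For a vanishing right-hand side, taking f = 0 shows that `w` lies in the cluster space.
    rcases huv with hu0 | ⟨t, ht, hut, hv1⟩
    · have h1 := (inverse_iteration P.epsSesq_isHermPos P.aSesq_isHermPos hc ho ha
        P.ASesq_isHermPos hκ hθ0 J hout hin (f := 0) (cf := 0) hcw heq' (by simp)).1
      rw [hu0, sub_zero, formNorm_zero, mul_zero] at h1
      refine le_trans h1 ?_
      have := normA_nonneg w
      positivity
    · obtain ⟨f, hf, hvf, hfl⟩ := exists_cluster_element h hC3 hdl hEk hδk hv1 hu hclose
      have hfs := eq_sum_of_mem_Mh ho hspan J hJout (Submodule.smul_mem _ (t : ℂ) hf)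
      obtain ⟨h1, h2⟩ := inverse_iteration P.epsSesq_isHermPos P.aSesq_isHermPos hc ho ha
        P.ASesq_isHermPos hκ hθ0 J hout hin hcw heq' hfs
      change P.normA (w - wJ) ≤ (κ * P.Cbar)⁻¹ * P.normEps (u - (t : ℂ) • f) at h1
      change P.normEps ((t : ℂ) • f) - P.normEps (u - (t : ℂ) • f) ≤
        θ * P.Cbar⁻¹ * P.normA w at h2
      rw [hut, ← smul_sub, normEps_smul, Complex.norm_real, Real.norm_of_nonneg ht.le] at h1 h2
      rw [normEps_smul, Complex.norm_real, Real.norm_of_nonneg ht.le, ← mul_sub] at h2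
      have h3 : t * (6 * Real.sqrt (P.tl (lam k)))⁻¹ ≤ θ * P.Cbar⁻¹ * P.normA w :=
        (mul_le_mul_of_nonneg_left hfl ht.le).trans h2
      -- The unknown amplitude `t` of the right-hand side is eliminated: it is at most a multiple of
      -- θ ‖w‖_A.
      have h4 : t ≤ 6 * Real.sqrt (P.tl (lam k)) * (θ * P.Cbar⁻¹ * P.normA w) := by
        rwa [← div_eq_mul_inv, div_le_iff₀ (by positivity), mul_comm] at h3
      have h5 : 0 ≤ P.normA w := normA_nonneg w
      calc P.normA (w - wJ) ≤ (κ * P.Cbar)⁻¹ * (t * P.normEps (v - f)) := h1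
        _ ≤ (κ * P.Cbar)⁻¹ * ((6 * Real.sqrt (P.tl (lam k)) * (θ * P.Cbar⁻¹ * P.normA w)) *
            (Ev + K2 * D)) := by
          have := normEps_nonneg (v - f)
          gcongr
        _ = 6 * Real.sqrt (P.tl (lam k)) / (κ * P.Cbar ^ 2) * (θ * (Ev + K2 * D)) *
            P.normA w := by
          field_simp
        _ = _ := by rw [Cbar_sq]
  have hwJle : P.normA wJ ≤ P.normA w := by
    refine (abs_le_of_sq_le_sq' ?_ (normA_nonneg _)).2
    rw [normA_eq, normA_eq, hwJ, hcw, formNorm_sq_sum_of_diagonal P.ASesq_isHermPos hA,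
      formNorm_sq_sum_of_diagonal P.ASesq_isHermPos hA]
    refine Finset.sum_le_sum_of_subset_of_nonneg (Finset.subset_univ J) fun i _ _ => ?_
    have h1 := P.ASesq_isHermPos.nonneg (b i)
    rw [hA, if_pos rfl, Complex.ofReal_re] at h1
    positivity
  obtain ⟨g, hg, hgw⟩ := hEk.exists_near_sum hA J hJ cw
  refine ⟨g, hg, ?_⟩
  have htri : P.normA (w - g) ≤ P.normA (w - wJ) + P.normA (wJ - g) := by
    have := P.ASesq_isHermPos.add_le (w - wJ) (wJ - g)
    rwa [sub_add_sub_cancel] at this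
  have hw0 := normA_nonneg w
  have hgw' : P.normA (wJ - g) ≤ ((k + q : ℕ) * C3) * D * P.normA w := by
    refine hgw.trans ?_
    have hwJ0 := normA_nonneg wJ
    have hcard' : (J.card : ℝ) ≤ ((k + q : ℕ) : ℝ) := Nat.cast_le.2 hcard
    calc (J.card : ℝ) * (C3 * D) * P.normA wJ ≤ ((k + q : ℕ) : ℝ) * (C3 * D) * P.normA w := by
          gcongr
      _ = _ := by ring
  -- In the expanded product only |λ₀ - λ_k| ‖v - ū‖ lacks a factor δ; the cofactors of δ in the
  -- other terms are bounded through δ₀ and δ₀′.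
  have hprod : θ * (Ev + K2 * D) ≤ (1 + K2 * dl1 + K1 * (P.Cbar⁻¹ * dl0 + K2 * dl0)) *
      (|lam0 - lam k| * Ev + D) := by
    have h1 : θ * (Ev + K2 * D) ≤ |lam0 - lam k| * Ev +
        (K2 * dl1 + K1 * (P.Cbar⁻¹ * dl0 + K2 * dl0)) * D := by
      have h2 : |lam0 - lam k| * (K2 * D) ≤ dl1 * (K2 * D) := by gcongr
      have h3 : K1 * D * (Ev + K2 * D) ≤ K1 * D * (P.Cbar⁻¹ * dl0 + K2 * dl0) := by gcongr
      rw [hθ]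
      linarith
    refine h1.trans ?_
    have h4 : 0 ≤ |lam0 - lam k| * Ev := by positivity
    have h5 : 0 ≤ K2 * dl1 + K1 * (P.Cbar⁻¹ * dl0 + K2 * dl0) := by positivity
    have := mul_nonneg h5 h4
    linarith
  have hCdef : P.stepConst k q (lam k) C3 dl0 dl1 =
      K3 * (1 + K2 * dl1 + K1 * (P.Cbar⁻¹ * dl0 + K2 * dl0)) + (k + q : ℕ) * C3 := rfl
  rw [hCdef]
  have h6 : K3 * (θ * (Ev + K2 * D)) * P.normA w ≤ K3 * ((1 + K2 * dl1 + K1 *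
      (P.Cbar⁻¹ * dl0 + K2 * dl0)) * (|lam0 - lam k| * Ev + D)) * P.normA w := by gcongr
  have h7 : 0 ≤ ((k + q : ℕ) * C3) * (|lam0 - lam k| * Ev) * P.normA w := by positivity
  linarith

end Problem

/-! ### Normalized iterates and the final estimate -/

open Problem in
lemma IsRun.iterate_eq_smul {d : ℕ} {P : Problem d} {r : ℕ} {T : ℕ → Mesh P.Ω} {S : Scheme}
    {l : ℕ} {lamh : ℕ → ℝ} {u uhat : ℕ → Field P.Ω} (h : IsRun P r T S l lamh u uhat) {i : ℕ}
    (hi : i ≤ l) : u i = 0 ∨ ∃ t : ℝ, 0 < t ∧ u i = (t : ℂ) • uhat i ∧ P.normA (uhat i) = 1 := by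
  have key : ∀ f : Field P.Ω, P.normSmallA f ≠ 0 → 0 < P.normA f := fun f hf => by
    have h1 : 0 < P.normSmallA f := lt_of_le_of_ne (Real.sqrt_nonneg _) hf.symm
    have h2 : P.normSmallA f ≤ P.normA f := by
      refine Real.sqrt_le_sqrt ?_
      change (P.aSesq f f).re ≤ (P.ASesq f f).re
      rw [ASesq_self_re]
      have := mul_nonneg P.shiftConst_pos.le (P.epsSesq_isHermPos.nonneg f)
      linarith
    linarith
  rcases Nat.eq_zero_or_pos i with rfl | hi0
  · right
    have hpos := key (u 0) (by rw [h.init_norm]; norm_num)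
    refine ⟨P.normA (u 0), hpos, ?_, ?_⟩
    · rw [h.init_hat, smul_inv_smul₀ (Complex.ofReal_ne_zero.2 hpos.ne')]
    · rw [h.init_hat, normA_inv_smul hpos]
  · obtain ⟨w, -, -, hu, huh, -⟩ := h.step i hi0 hi
    -- When the solution has zero curl, the convention 0⁻¹ = 0 makes `u i` vanish, although `uhat i`
    -- may be nonzero.
    by_cases hw : P.normSmallA w = 0
    · left
      rw [hu, hw, Complex.ofReal_zero, inv_zero, zero_smul]
    · right
      have hpos := key w hw
      have hpos' : 0 < P.normSmallA w := lt_of_le_of_ne (Real.sqrt_nonneg _) (Ne.symm hw)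
      refine ⟨P.normA w / P.normSmallA w, by positivity, ?_, by rw [huh, normA_inv_smul hpos]⟩
      rw [hu, huh, smul_smul]
      congr 1
      have h1 : (P.normA w : ℂ) ≠ 0 := Complex.ofReal_ne_zero.2 hpos.ne'
      push_cast
      field_simp

end Maxwell

end

theorem theorem3p5 (d : ℕ) (hd : d = 2 ∨ d = 3) (P : Maxwell.Problem d) (r : ℕ)
    (k q : ℕ) (hk : 1 ≤ k) (hq : 1 ≤ q) (lam : ℕ → ℝ)
    (hlam : ∀ j, 1 ≤ j → j ≤ k + q → P.IsNthEigenvalue P.X j (lam j))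
    (hpos : 0 < lam k) (hlow : 2 ≤ k → lam (k - 1) < lam k)
    (hmult : lam (k + q - 1) = lam k) (hup : lam k < lam (k + q))
    (C3 dl0 dl1 : ℝ) (hC3 : 0 < C3) (hdl : P.Thresholds k q lam C3 dl0 dl1) :
    ∃ C0 : ℝ, 0 < C0 ∧
      ∀ (T : ℕ → Maxwell.Mesh P.Ω) (S : Maxwell.Scheme) (l : ℕ) (lamh : ℕ → ℝ)
        (u uhat : ℕ → Maxwell.Field P.Ω) (ubar : Maxwell.Field P.Ω),
        1 ≤ l →
        Maxwell.IsRun P r T S l lamh u uhat →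
        (∀ j ∈ ({k - 1, k, k + q} : Set ℕ), j ≠ 0 →
          P.EigenEstimates r (T l) C3 (lam j)) →
        Maxwell.IsClose P r k q lam dl0 dl1 T l (l - 1) lamh uhat ubar →
        Maxwell.IsClose P r k q lam dl0 dl1 T l (S.shift l) lamh uhat ubar →
        ∃ uk ∈ P.M (lam k),
          P.normA (uhat l - uk) ≤
            C0 / 2 * (|lamh (S.shift l) - lam k| *
                (|lamh (l - 1) - lam k| + P.normEps (uhat (l - 1) - ubar)) +
              P.delta r (T l) (lam k)) := by
  have h : P.IsCluster k q lam := ⟨hk, hq, hlam, hpos, hlow, hmult, hup⟩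
  have hC := Maxwell.Problem.stepConst_pos h hC3 hdl
  refine ⟨2 * P.stepConst k q (lam k) C3 dl0 dl1, by positivity, ?_⟩
  intro T S l lamh u uhat ubar hl hrun hE hclose hclose'
  rw [mul_div_cancel_left₀ _ (two_ne_zero' ℝ)]
  obtain ⟨w, hw, heq, -, huh, -⟩ := hrun.step l hl le_rfl
  obtain ⟨g, hg, hgw⟩ := Maxwell.Problem.exists_near_solution h hC3 hdl hE hclose.delta_le
    hclose'.eig_le hw heq (hrun.iterate_eq_smul (Nat.sub_le l 1)) hclose.mem hclose.close
  have hD := P.delta_nonneg r (T l) (lam k)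
  have hEv := Maxwell.Problem.normEps_nonneg (uhat (l - 1) - ubar)
  -- The one-step bound involves no eigenvalue error of the previous iterate; that term enters only
  -- as nonnegative slack.
  have hle : |lamh (S.shift l) - lam k| * P.normEps (uhat (l - 1) - ubar) +
      P.delta r (T l) (lam k) ≤ |lamh (S.shift l) - lam k| *
        (|lamh (l - 1) - lam k| + P.normEps (uhat (l - 1) - ubar)) +
          P.delta r (T l) (lam k) := by
    gcongr
    exact le_add_of_nonneg_left (abs_nonneg _)
  refine ⟨(P.normA w : ℂ)⁻¹ • g, Submodule.smul_mem _ _ hg, ?_⟩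
  rw [huh, ← smul_sub, Maxwell.Problem.normA_smul, norm_inv, Complex.norm_real,
    Real.norm_of_nonneg (Maxwell.Problem.normA_nonneg w)]
  -- If ‖w‖_A = 0, the scale factor is 0⁻¹ = 0 and the left side vanishes.
  rcases (Maxwell.Problem.normA_nonneg w).eq_or_lt with h0 | h0
  · rw [← h0, inv_zero, zero_mul]
    positivity
  · rw [inv_mul_le_iff₀ h0, mul_comm (P.normA w)]
    refine hgw.trans ?_
    gcongr
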